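/- Let $f$ be a germ at the origin $O$ of a holomorphic self-map of $\mathbb C^2$ with $f(O)=O$, $f\neq\mathrm{id}$, tangent to the identity ($df_O=\mathrm{id}$), and fixing pointwise the line $S=\{z_1=0\}$. Let $\nu\ge1$ be the order of contact of $f$ with $S$, i.e. $f(z)=z+z_1^{\nu}f^o(z)$ with $f^o=(f^o_1,f^o_2)$ a germ of holomorphic map not divisible by $z_1$. Assume that $O$ is a singular point of $f$ on $S$ ($f^o(O)=O$), that $f$ has pure order $1$ at $O$ (the linear part $P^1$ of $f^o$ at $O$ is not zero), and that $P^1$ sends $S$ into itself. We say that $f$ is *tangential* to $S$ if $f^o$ sends $S$ into itself, i.e. $z_1$ divides $f^o_1$, and that $f$ is *formally conjugate* to a formal map $\hat f$ if $\hat f=\chi^{-1}\circ f\circ\chi$ for some formal change of coordinates $\chi$ at $O$ (zero constant term, invertible linear part) preserving the line $\{z_1=0\}$, i.e. with $z_1\mid\chi_1$. Let $$E=\bigcup_{q=1}^{\nu}\tfrac1q\mathbb N\ \cup\ \{\tfrac1d : d\ge2\}\ \cup\ \{0\}\ \cup\ \mathbb Q^-,$$ where $\mathbb Q^-$ is the set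 of negative rational numbers. Then $f$ is formally conjugate to a normal form in one of the following families; moreover both the family and its label ($\lambda$, respectively the pair $(p,q)$ or the number $q$ determining $\lambda$) are uniquely determined by $f$ (the remaining parameters $a,g,g_1,g_2,p_o,p_\nu,t$ are not claimed to be unique). Here $a\in\mathbb C$, and $t,g,g_1,g_2\in\mathbb C[[\zeta]]$ are arbitrary formal power series unless otherwise specified. * $(\star_1^\lambda)$ with $\lambda\in\mathbb C\setminus E$: $\hat f(z)=\bigl(z_1+z_1^\nu[\lambda z_1+a z_1^{\nu+1}+z_2^2t(z_2)],\ z_2+z_1^\nu z_2\bigr)$; * $(\star_1^\lambda)$ with $\lambda=0$: $\hat f(z)=\bigl(z_1+z_1^\nu[z_1^2g(z_1)+z_2^2t(z_2)],\ z_2+z_1^\nu z_2\bigr)$; * $(\star_1^\lambda)$ with $\lambda=-p/q$, $p,q\ge1$ coprime integers: $\hat f(z)=\bigl(z_1+z_1^\nu[z_1g_1(z_1^qz_2^p)+z_1^{\nu+1}g_2(z_1^qz_2^p)+z_2^2t(z_2)],\ z_2+z_1^\nu z_2\bigr)$ with $g_1(0)=\lambda$; * $(\star_1^\lambda)$ with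 $\lambda=1/q$, $q\ge2$ an integer: $\hat f(z)=\bigl(z_1+z_1^\nu[\lambda z_1+z_1^{\nu+1}p_o(z_1^{-q}z_2)+z_2^2t(z_2)],\ z_2+z_1^\nu(z_2+az_1^q)\bigr)$, where $p_o\in\mathbb C[\zeta]$ has degree at most $\nu/q$; * $(\star_1^\lambda)$ with $\lambda=p/q$, $1\le q\le\nu$, $p\ge2$, $(p,q)=1$: $\hat f(z)=\bigl(z_1+z_1^\nu[\lambda z_1+z_1^{\nu+1}p_o(z_1^{-q}z_2^p)+z_2^2t(z_2)],\ z_2+z_1^\nu z_2\bigr)$, where $p_o\in\mathbb C[\zeta]$ has degree at most $\nu/q$; * $(\star_1^\lambda)$ with $\lambda=1$: $\hat f(z)=\bigl(z_1+z_1^\nu[z_1+z_1p_\nu(z_1,z_2)+z_2^2t(z_2)],\ z_2+z_1^\nu z_2\bigr)$, where $p_\nu\in\mathbb C[z_1,z_2]$ is homogeneous of degree $\nu$ (possibly zero); * $(J_1)$: $\hat f(z)=\bigl(z_1+z_1^\nu[z_1+az_1z_2^\nu+z_2^2t(z_2)],\ z_2+z_1^\nu(z_1+z_2)\bigr)$;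 * $(\star_2)$: $\hat f(z)=\bigl(z_1+z_1^\nu[z_1+z_1^{\nu+1}g_1(z_2)+z_2^2t(z_2)],\ z_2+z_1^\nu z_2^2g_2(z_2)\bigr)$; * $(J_0)$: $\hat f(z)=\bigl(z_1+z_1^\nu[z_1z_2g_1(z_2)+z_2^2t(z_2)],\ z_2+z_1^\nu[z_1+z_2^2g_2(z_2)]\bigr)$. Finally, for every normal form in this list to which $f$ is formally conjugate, $t\equiv0$ if and only if $f$ is tangential to $S$. -/

import Mathlib

open Filter Topology

noncomputable section

/-! ### Germs of holomorphic self-maps of `ℂ²` along the line `S = {z₁ = 0}`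

Points of `ℂ²` are functions `z : Fin 2 → ℂ`; the coordinate `z₁` is `z 0` and `z₂` is `z 1`.
Germs at the origin are represented by functions, every condition being required only near `0`. -/

/-- `f ∈ End(ℂ², O)`, tangent to the identity, different from the identity as a germ. -/
structure IsTangentToIdGerm (f : (Fin 2 → ℂ) → (Fin 2 → ℂ)) : Prop where
  analytic : AnalyticAt ℂ f 0
  map_zero : f 0 = 0
  deriv_eq_id : fderiv ℂ f 0 = ContinuousLinearMap.id ℂ (Fin 2 → ℂ)
  ne_id : ¬ f =ᶠ[𝓝 0] id

/-- `f` fixes pointwise the line `S = {z₁ = 0}` (near the origin). -/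
def FixesLine (f : (Fin 2 → ℂ) → (Fin 2 → ℂ)) : Prop :=
  ∀ᶠ z in 𝓝 (0 : Fin 2 → ℂ), z 0 = 0 → f z = z

/-- `f` has order of contact `ν` with `S`, and `fo` is the corresponding map `f^o`:
`f(z) = z + z₁^ν f^o(z)` with `f^o` holomorphic and not divisible by `z₁`. -/
structure HasOrderOfContact (f : (Fin 2 → ℂ) → (Fin 2 → ℂ)) (ν : ℕ)
    (fo : (Fin 2 → ℂ) → (Fin 2 → ℂ)) : Prop where
  analytic : AnalyticAt ℂ fo 0
  eq : ∀ᶠ z in 𝓝 (0 : Fin 2 → ℂ), f z = z + z 0 ^ ν • fo z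
  not_dvd : ¬ ∃ h : (Fin 2 → ℂ) → (Fin 2 → ℂ), AnalyticAt ℂ h 0 ∧
    ∀ᶠ z in 𝓝 (0 : Fin 2 → ℂ), fo z = z 0 • h z

/-- The linear part `P¹` of `f^o` at the origin. -/
def linPart (fo : (Fin 2 → ℂ) → (Fin 2 → ℂ)) : (Fin 2 → ℂ) →L[ℂ] (Fin 2 → ℂ) :=
  fderiv ℂ fo 0

/-- `f` is tangential to `S`: `f^o` sends `S` into itself, i.e. `z₁` divides `f^o_1`. -/
def IsTangential (fo : (Fin 2 → ℂ) → (Fin 2 → ℂ)) : Prop :=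
  ∀ᶠ z in 𝓝 (0 : Fin 2 → ℂ), z 0 = 0 → fo z 0 = 0

/-! ### Formal maps and formal conjugation -/

/-- Pairs of formal power series in `z₁`, `z₂`. -/
abbrev FormalMap : Type := Fin 2 → MvPowerSeries (Fin 2) ℂ

/-- `F` is the (convergent) power series expansion at the origin of the germ `f`. -/
def IsExpansion (f : (Fin 2 → ℂ) → (Fin 2 → ℂ)) (F : FormalMap) : Prop :=
  ∀ i : Fin 2, ∀ᶠ z in 𝓝 (0 : Fin 2 → ℂ),
    HasSum (fun m : Fin 2 →₀ ℕ => MvPowerSeries.coeff m (F i) * (z 0 ^ m 0 * z 1 ^ m 1)) (f z i)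

/-- Composition `F ∘ G` of formal maps (used only when `G` has no constant term). -/
def FormalMap.comp (F G : FormalMap) : FormalMap :=
  fun i => MvPowerSeries.subst G (F i)

/-- The linear part of a formal map, as a matrix. -/
def FormalMap.linMatrix (F : FormalMap) : Matrix (Fin 2) (Fin 2) ℂ :=
  Matrix.of fun i j => MvPowerSeries.coeff (Finsupp.single j 1) (F i)

/-- `χ` is a formal change of coordinates at the origin preserving the line `{z₁ = 0}`. -/
structure IsFormalChange (χ : FormalMap) : Prop where
  constantCoeff_eq : ∀ i, MvPowerSeries.constantCoeff (χ i) = 0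
  det_ne_zero : χ.linMatrix.det ≠ 0
  preserves_line : (MvPowerSeries.X 0 : MvPowerSeries (Fin 2) ℂ) ∣ χ 0

/-- The germ `f` is formally conjugated to the formal map `Fhat`: `χ⁻¹ ∘ f ∘ χ = Fhat`,
i.e. `f ∘ χ = χ ∘ Fhat`, for some formal change of coordinates `χ` preserving `{z₁ = 0}`. -/
def IsFormallyConjugate (f : (Fin 2 → ℂ) → (Fin 2 → ℂ)) (Fhat : FormalMap) : Prop :=
  ∃ F : FormalMap, IsExpansion f F ∧
    ∃ χ : FormalMap, IsFormalChange χ ∧ F.comp χ = χ.comp Fhat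

/-! ### The list of normal forms -/

/-- The exceptional set `E = ⋃_{q=1}^ν (1/q)ℕ ∪ {1/d | d ≥ 2} ∪ {0} ∪ ℚ⁻`. -/
def exceptionalSet (ν : ℕ) : Set ℂ :=
  {l | ∃ q n : ℕ, 1 ≤ q ∧ q ≤ ν ∧ l = (n : ℂ) / q} ∪ {l | ∃ d : ℕ, 2 ≤ d ∧ l = 1 / (d : ℂ)} ∪
    {0} ∪ {l | ∃ r : ℚ, r < 0 ∧ l = (r : ℂ)}

/-- The formal coordinates. -/
abbrev Z1 : MvPowerSeries (Fin 2) ℂ := MvPowerSeries.X 0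

abbrev Z2 : MvPowerSeries (Fin 2) ℂ := MvPowerSeries.X 1

/-- Constants, as formal power series in `z₁`, `z₂`. -/
abbrev cst (a : ℂ) : MvPowerSeries (Fin 2) ℂ := MvPowerSeries.C a

/-- `g(u)`, for a power series `g` in one variable and `u` without constant term. -/
def evalAt (g : PowerSeries ℂ) (u : MvPowerSeries (Fin 2) ℂ) : MvPowerSeries (Fin 2) ℂ :=
  PowerSeries.subst u g

/-- `z₁^(ν+1) p(z₁^(-q) z₂^s)`, for a polynomial `p` of degree at most `ν / q`; the exponent
`ν + 1 - q * l` is a genuine difference because `q * l ≤ ν` in the range of the sum. -/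
def laurentTerm (ν q s : ℕ) (p : Polynomial ℂ) : MvPowerSeries (Fin 2) ℂ :=
  ∑ l ∈ Finset.range (ν / q + 1), cst (p.coeff l) * Z1 ^ (ν + 1 - q * l) * Z2 ^ (s * l)

/-- The names of the families of normal forms, with their discrete or continuous labels: the six
subcases of `(⋆₁^λ)`, namely `λ = lam ∉ E`, `λ = 0`, `λ = -p/q`, `λ = 1/q`, `λ = p/q`, `λ = 1`,
and the types `(J₁)`, `(⋆₂)`, `(J₀)`. -/
inductive NormalFormType : Type
  | starGeneric (lam : ℂ)
  | starZero
  | starNeg (p q : ℕ)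
  | starInv (q : ℕ)
  | starPos (p q : ℕ)
  | starOne
  | J1
  | star2
  | J0

/-- `IsNormalForm ν T t F`: the formal map `F` is a normal form of type `T` (for the order of
contact `ν`) whose term `t` is the given power series. -/
def IsNormalForm (ν : ℕ) : NormalFormType → PowerSeries ℂ → FormalMap → Prop
  | .starGeneric lam, t, F =>
      lam ∉ exceptionalSet ν ∧
      ∃ a : ℂ, F = ![Z1 + Z1 ^ ν * (cst lam * Z1 + cst a * Z1 ^ (ν + 1) + Z2 ^ 2 * evalAt t Z2),
        Z2 + Z1 ^ ν * Z2]
  | .starZero, t, F =>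
      ∃ g : PowerSeries ℂ,
        F = ![Z1 + Z1 ^ ν * (Z1 ^ 2 * evalAt g Z1 + Z2 ^ 2 * evalAt t Z2), Z2 + Z1 ^ ν * Z2]
  | .starNeg p q, t, F =>
      1 ≤ p ∧ 1 ≤ q ∧ Nat.Coprime p q ∧
      ∃ g₁ g₂ : PowerSeries ℂ, PowerSeries.constantCoeff g₁ = -((p : ℂ) / (q : ℂ)) ∧
        F = ![Z1 + Z1 ^ ν * (Z1 * evalAt g₁ (Z1 ^ q * Z2 ^ p)
            + Z1 ^ (ν + 1) * evalAt g₂ (Z1 ^ q * Z2 ^ p) + Z2 ^ 2 * evalAt t Z2),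
          Z2 + Z1 ^ ν * Z2]
  | .starInv q, t, F =>
      2 ≤ q ∧
      ∃ (a : ℂ) (p₀ : Polynomial ℂ), p₀.natDegree ≤ ν / q ∧
        F = ![Z1 + Z1 ^ ν * (cst (1 / (q : ℂ)) * Z1 + laurentTerm ν q 1 p₀ + Z2 ^ 2 * evalAt t Z2),
          Z2 + Z1 ^ ν * (Z2 + cst a * Z1 ^ q)]
  | .starPos p q, t, F =>
      1 ≤ q ∧ q ≤ ν ∧ 2 ≤ p ∧ Nat.Coprime p q ∧
      ∃ p₀ : Polynomial ℂ, p₀.natDegree ≤ ν / q ∧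
        F = ![Z1 + Z1 ^ ν * (cst ((p : ℂ) / (q : ℂ)) * Z1 + laurentTerm ν q p p₀
            + Z2 ^ 2 * evalAt t Z2),
          Z2 + Z1 ^ ν * Z2]
  | .starOne, t, F =>
      ∃ pν : MvPolynomial (Fin 2) ℂ, pν.IsHomogeneous ν ∧
        F = ![Z1 + Z1 ^ ν * (Z1 + Z1 * (pν : MvPowerSeries (Fin 2) ℂ) + Z2 ^ 2 * evalAt t Z2),
          Z2 + Z1 ^ ν * Z2]
  | .J1, t, F =>
      ∃ a : ℂ, F = ![Z1 + Z1 ^ ν * (Z1 + cst a * Z1 * Z2 ^ ν + Z2 ^ 2 * evalAt t Z2),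
        Z2 + Z1 ^ ν * (Z1 + Z2)]
  | .star2, t, F =>
      ∃ g₁ g₂ : PowerSeries ℂ,
        F = ![Z1 + Z1 ^ ν * (Z1 + Z1 ^ (ν + 1) * evalAt g₁ Z2 + Z2 ^ 2 * evalAt t Z2),
          Z2 + Z1 ^ ν * (Z2 ^ 2 * evalAt g₂ Z2)]
  | .J0, t, F =>
      ∃ g₁ g₂ : PowerSeries ℂ,
        F = ![Z1 + Z1 ^ ν * (Z1 * Z2 * evalAt g₁ Z2 + Z2 ^ 2 * evalAt t Z2),
          Z2 + Z1 ^ ν * (Z1 + Z2 ^ 2 * evalAt g₂ Z2)]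

end

/-! Write the expansion of `f` as `z + z₁^ν G`. A change of coordinates preserving `z₁ = 0` has the
form `(z₁K, c)` with `K` a unit. Everything in the conjugacy equation beyond `χ` itself is therefore
divisible by `z₁^ν`, and after this division the equation can be compared degree by degree. The
two-index filtration `filt` keeps track of both the factor `z₁^ν` and the degree of the quotient.

Existence has two stages. A linear change `L = (a z₁, c z₁ + d z₂)` replaces the lower triangular
linear part `A` of `G` by `a^ν L⁻¹ A L`. Since `a` can be any `ν`-th root, `A` becomes `diag(λ, 1)`,
a Jordan block with eigenvalue `1`, `diag(1, 0)`, or the nilpotent block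
(`exists_conjugate_of_homSolvable`, `exists_isNormalForm`). Then a change tangent to the identity is
built degree by degree. Adding `(z₁k, h)` of degree `e` alters the degree `e` part of the divided
equation by the linear operator `homOp` (`defect_add_mem`), because all other effects have higher
degree. Hence `G` can be reduced to its linear part plus any set of monomials that spans a
complement of, or more than a complement of, the image of `homOp` (`exists_formal_solution`). On
monomials `homOp` is diagonal or triangular (`homOp_left_mem`, `homOp_right_mem`). Its first
component is always divisible by `z₁`, so the powers of `z₂` there survive as `z₂² t(z₂)`; the other
survivors are resonances, which lie on finitely many monomials or rays of exponents and are
assembled into the listed series.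

Uniqueness uses only degree one. Any conjugacy relates the linear parts by `a^ν L⁻¹ A L`
(`linear_part_of_conjugate`), and the ratio of the eigenvalues, their vanishing and the presence of
a Jordan block determine the family and its label (`IsNormalForm.type_unique`). Divisibility of the
first component by `z₁` is also a conjugacy invariant (`X_dvd_iff_of_conjugate`), and for a normal
form it means `t = 0`. The passage from germs to series rests on existence and uniqueness of double
power series expansions (`exists_expands`, `Expands.unique`). -/

/-! ### The filtration by order along the line `z₁ = 0` and by degree -/

/-- The ideal of formal power series all of whose monomials `z₁^i z₂^j` have `a ≤ i` and
`n ≤ i + j`. -/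
def filt (a n : ℕ) : Ideal (MvPowerSeries (Fin 2) ℂ) where
  carrier := {φ | ∀ m : Fin 2 →₀ ℕ, (m 0 < a ∨ m 0 + m 1 < n) → MvPowerSeries.coeff m φ = 0}
  add_mem' := by
    intro x y hx hy m hm
    rw [map_add, hx m hm, hy m hm, add_zero]
  zero_mem' := by
    intro m _
    simp
  smul_mem' := by
    classical
    intro c x hx m hm
    rw [smul_eq_mul, MvPowerSeries.coeff_mul]
    refine Finset.sum_eq_zero fun p hp => ?_
    have h := Finset.HasAntidiagonal.mem_antidiagonal.mp hp
    have h0 := DFunLike.congr_fun h 0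
    have h1 := DFunLike.congr_fun h 1
    simp only [Finsupp.add_apply] at h0 h1
    rw [hx p.2 (by omega), mul_zero]

theorem filt_mono {a n a' n' : ℕ} (ha : a' ≤ a) (hn : n' ≤ n) {φ : MvPowerSeries (Fin 2) ℂ}
    (h : φ ∈ filt a n) : φ ∈ filt a' n' :=
  fun m hm => h m (by omega)

theorem mul_mem_filt {a n b k : ℕ} {φ ψ : MvPowerSeries (Fin 2) ℂ}
    (hφ : φ ∈ filt a n) (hψ : ψ ∈ filt b k) : φ * ψ ∈ filt (a + b) (n + k) := by
  classical
  intro m hm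
  rw [MvPowerSeries.coeff_mul]
  refine Finset.sum_eq_zero fun p hp => ?_
  have h := Finset.HasAntidiagonal.mem_antidiagonal.mp hp
  have h0 := DFunLike.congr_fun h 0
  have h1 := DFunLike.congr_fun h 1
  simp only [Finsupp.add_apply] at h0 h1
  by_cases h2 : p.1 0 < a ∨ p.1 0 + p.1 1 < n
  · rw [hφ p.1 h2, zero_mul]
  · rw [hψ p.2 (by omega), mul_zero]

theorem mul_mem_filt_of_le {a n b k c l : ℕ} {φ ψ : MvPowerSeries (Fin 2) ℂ}
    (hφ : φ ∈ filt a n) (hψ : ψ ∈ filt b k) (hc : c ≤ a + b) (hl : l ≤ n + k) :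
    φ * ψ ∈ filt c l :=
  filt_mono hc hl (mul_mem_filt hφ hψ)

theorem mem_filt_zero_zero (φ : MvPowerSeries (Fin 2) ℂ) : φ ∈ filt 0 0 :=
  fun m hm => absurd hm (by omega)

theorem pow_mem_filt {a n : ℕ} {φ : MvPowerSeries (Fin 2) ℂ} (h : φ ∈ filt a n) (k : ℕ) :
    φ ^ k ∈ filt (k * a) (k * n) := by
  induction k with
  | zero => simpa using mem_filt_zero_zero _
  | succ k ih =>
    rw [pow_succ]
    exact mul_mem_filt_of_le ih h (by rw [Nat.succ_mul]) (by rw [Nat.succ_mul])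

theorem X_zero_mem_filt : (MvPowerSeries.X 0 : MvPowerSeries (Fin 2) ℂ) ∈ filt 1 1 := by
  intro m hm
  rw [MvPowerSeries.coeff_X, if_neg]
  rintro rfl
  simp at hm

theorem X_mem_filt (i : Fin 2) : (MvPowerSeries.X i : MvPowerSeries (Fin 2) ℂ) ∈ filt 0 1 := by
  intro m hm
  rw [MvPowerSeries.coeff_X, if_neg]
  rintro rfl
  fin_cases i <;> simp at hm

theorem X_zero_pow_mem_filt (ν : ℕ) :
    (MvPowerSeries.X 0 : MvPowerSeries (Fin 2) ℂ) ^ ν ∈ filt ν ν := by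
  simpa using pow_mem_filt X_zero_mem_filt ν

theorem mem_filt_zero_one {φ : MvPowerSeries (Fin 2) ℂ} :
    φ ∈ filt 0 1 ↔ MvPowerSeries.constantCoeff φ = 0 := by
  constructor
  · intro h
    rw [← MvPowerSeries.coeff_zero_eq_constantCoeff_apply]
    exact h 0 (by simp)
  · intro h m hm
    have : m = 0 := by
      ext i
      fin_cases i <;> simp <;> omega
    rw [this, MvPowerSeries.coeff_zero_eq_constantCoeff_apply, h]

theorem eq_zero_of_forall_mem_filt {φ : MvPowerSeries (Fin 2) ℂ} (h : ∀ n, φ ∈ filt 0 n) :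
    φ = 0 := by
  ext m
  rw [map_zero]
  exact h (m 0 + m 1 + 1) m (by omega)

theorem hasSubst_of_mem_filt {x : FormalMap} (hx : ∀ i, x i ∈ filt 0 1) :
    MvPowerSeries.HasSubst x :=
  MvPowerSeries.hasSubst_of_constantCoeff_zero fun i => mem_filt_zero_one.mp (hx i)

theorem finsupp_prod_fin_two (x : FormalMap) (d : Fin 2 →₀ ℕ) :
    (d.prod fun s e => x s ^ e) = x 0 ^ d 0 * x 1 ^ d 1 := by
  rw [Finsupp.prod_fintype _ _ (by simp), Fin.prod_univ_two]

/-- This is why the filtration has two indices: a factor `z₁^ν` can be removed from an error term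
with no loss of information on the degree of the quotient. -/
theorem mem_filt_iff_exists {ν d : ℕ} {φ : MvPowerSeries (Fin 2) ℂ} :
    φ ∈ filt ν (ν + d) ↔ ∃ ψ ∈ filt 0 d, φ = MvPowerSeries.X 0 ^ ν * ψ := by
  constructor
  · intro h
    obtain ⟨ψ, rfl⟩ := (MvPowerSeries.X_pow_dvd_iff (s := (0 : Fin 2)) (n := ν) (φ := φ)).mpr
      fun m hm => h m (Or.inl hm)
    refine ⟨ψ, fun m hm => ?_, rfl⟩
    have := h (Finsupp.single 0 ν + m) (by simp; omega)
    rwa [MvPowerSeries.X_pow_eq, MvPowerSeries.coeff_add_monomial_mul, one_mul] at this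
  · rintro ⟨ψ, hψ, rfl⟩
    exact mul_mem_filt_of_le (X_zero_pow_mem_filt ν) hψ (by omega) le_rfl

/-! ### Substitution and the filtration -/

/-- Each coefficient of a substitution is a sum over the monomials of `φ`, so the difference can be
tested on those monomials alone. -/
theorem subst_sub_subst_mem {a n : ℕ} {x y : FormalMap}
    (hx : ∀ i, x i ∈ filt 0 1) (hy : ∀ i, y i ∈ filt 0 1) {φ : MvPowerSeries (Fin 2) ℂ}
    (h : ∀ d : Fin 2 →₀ ℕ, MvPowerSeries.coeff d φ ≠ 0 →
      y 0 ^ d 0 * y 1 ^ d 1 - x 0 ^ d 0 * x 1 ^ d 1 ∈ filt a n) :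
    MvPowerSeries.subst y φ - MvPowerSeries.subst x φ ∈ filt a n := by
  intro m hm
  rw [map_sub, MvPowerSeries.coeff_subst (hasSubst_of_mem_filt hy),
    MvPowerSeries.coeff_subst (hasSubst_of_mem_filt hx), sub_eq_zero]
  refine finsum_congr fun d => ?_
  by_cases hd : MvPowerSeries.coeff d φ = 0
  · rw [hd, zero_smul, zero_smul]
  · have := h d hd m hm
    rw [map_sub, sub_eq_zero] at this
    rw [finsupp_prod_fin_two, finsupp_prod_fin_two, this]

theorem subst_mem_filt {k : ℕ} {x : FormalMap} (hx : ∀ i, x i ∈ filt 0 1)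
    {φ : MvPowerSeries (Fin 2) ℂ} (hφ : φ ∈ filt 0 k) : MvPowerSeries.subst x φ ∈ filt 0 k := by
  intro m hm
  rw [MvPowerSeries.coeff_subst (hasSubst_of_mem_filt hx), finsum_eq_zero_of_forall_eq_zero]
  intro d
  by_cases hd : d 0 + d 1 < k
  · rw [hφ d (Or.inr hd), zero_smul]
  · rw [finsupp_prod_fin_two]
    have : x 0 ^ d 0 * x 1 ^ d 1 ∈ filt 0 k :=
      mul_mem_filt_of_le (pow_mem_filt (hx 0) (d 0)) (pow_mem_filt (hx 1) (d 1)) (by omega)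
        (by omega)
    rw [this m hm, smul_zero]

/-- The factor `y - x` comes out and the cofactor has order `p - 1`. For `p = 0` the difference is
zero, hence the bound on `N` is demanded only for `p ≠ 0`. -/
theorem pow_sub_pow_mem_filt {a n N p : ℕ} {x y : MvPowerSeries (Fin 2) ℂ}
    (hx : x ∈ filt 0 1) (hy : y ∈ filt 0 1) (h : y - x ∈ filt a n) (hN : p ≠ 0 → N + 1 ≤ n + p) :
    y ^ p - x ^ p ∈ filt a N := by
  rcases eq_or_ne p 0 with rfl | hp
  · simp
  have hN := hN hp
  rw [← (Commute.all y x).mul_geom_sum₂ p]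
  refine mul_mem_filt_of_le (b := 0) (k := p - 1) h (Ideal.sum_mem _ fun i hi => ?_) (by omega)
    (by omega)
  have := Finset.mem_range.mp hi
  exact mul_mem_filt_of_le (pow_mem_filt hy i) (pow_mem_filt hx (p - 1 - i)) (by omega)
    (by omega)

theorem monomial_sub_monomial_mem_filt {a n N p q : ℕ} {x y : FormalMap}
    (hx : ∀ i, x i ∈ filt 0 1) (hy : ∀ i, y i ∈ filt 0 1) (h : ∀ i, y i - x i ∈ filt a n)
    (hN : N + 1 ≤ n + (p + q)) :
    y 0 ^ p * y 1 ^ q - x 0 ^ p * x 1 ^ q ∈ filt a N := by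
  have e : y 0 ^ p * y 1 ^ q - x 0 ^ p * x 1 ^ q
      = (y 0 ^ p - x 0 ^ p) * y 1 ^ q + (y 1 ^ q - x 1 ^ q) * x 0 ^ p := by ring
  rw [e]
  refine Ideal.add_mem _ ?_ ?_
  -- The truncated subtraction is harmless: if `q > N`, the factor `y 1 ^ q` alone already has order
  -- at least `N`.
  · exact mul_mem_filt_of_le (n := N - q)
      (pow_sub_pow_mem_filt (hx 0) (hy 0) (h 0) (by omega))
      (pow_mem_filt (hy 1) q) (by omega) (by omega)
  · exact mul_mem_filt_of_le (n := N - p)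
      (pow_sub_pow_mem_filt (hx 1) (hy 1) (h 1) (by omega))
      (pow_mem_filt (hx 0) p) (by omega) (by omega)

/-- The basic estimate: perturbing the arguments in order `n` changes a series of order `k` in order
`n + k - 1`, and the factor `z₁^a` of the perturbation is kept. -/
theorem subst_sub_subst_mem_filt {a n k N : ℕ} {x y : FormalMap}
    (hx : ∀ i, x i ∈ filt 0 1) (hy : ∀ i, y i ∈ filt 0 1) (h : ∀ i, y i - x i ∈ filt a n)
    {φ : MvPowerSeries (Fin 2) ℂ} (hφ : φ ∈ filt 0 k) (hN : N + 1 ≤ n + k) :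
    MvPowerSeries.subst y φ - MvPowerSeries.subst x φ ∈ filt a N := by
  refine subst_sub_subst_mem hx hy fun d hd => monomial_sub_monomial_mem_filt hx hy h ?_
  have : ¬ d 0 + d 1 < k := fun hk => hd (hφ d (Or.inr hk))
  omega

/-- First order Taylor expansion. The quadratic remainder carries `z₁^(2ν)` and so has order at
least `2ν + p`; it is negligible precisely because `ν ≥ 1`. -/
theorem pow_taylor_mem_filt {ν : ℕ} (hν : 1 ≤ ν) {x y v : MvPowerSeries (Fin 2) ℂ}
    (hx : x ∈ filt 0 1) (hy : y ∈ filt 0 1) (hv : v ∈ filt ν (ν + 1))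
    (h : y - x - v ∈ filt ν (ν + 2)) (p : ℕ) :
    y ^ p - x ^ p - p * x ^ (p - 1) * v ∈ filt ν (ν + p + 1) := by
  have hyx : y - x ∈ filt ν (ν + 1) := by
    have := Ideal.add_mem _ (filt_mono le_rfl (by omega) h) hv
    simpa using this
  induction p with
  | zero => simp
  | succ p ih =>
    have e : y ^ (p + 1) - x ^ (p + 1) - ((p + 1 : ℕ) : MvPowerSeries (Fin 2) ℂ)
          * x ^ (p + 1 - 1) * v
        = y * (y ^ p - x ^ p - p * x ^ (p - 1) * v) + (y - x - v) * x ^ p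
          + p * ((y - x) * (x ^ (p - 1) * v)) := by
      rcases p with _ | p
      · simp
      · simp only [Nat.add_sub_cancel]
        push_cast
        ring
    rw [e]
    refine Ideal.add_mem _ (Ideal.add_mem _ ?_ ?_) ?_
    · exact mul_mem_filt_of_le hy ih (by omega) (by omega)
    · exact mul_mem_filt_of_le h (pow_mem_filt hx p) (by omega) (by omega)
    · rcases p with _ | p
      · simp
      · refine Ideal.mul_mem_left _ _ (mul_mem_filt_of_le hyx
          (mul_mem_filt (pow_mem_filt hx (p + 1 - 1)) hv) (by omega) ?_)
        simp only [Nat.add_sub_cancel, mul_one]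
        omega

theorem monomial_taylor_mem_filt {ν : ℕ} (hν : 1 ≤ ν) {x y v : FormalMap}
    (hx : ∀ i, x i ∈ filt 0 1) (hy : ∀ i, y i ∈ filt 0 1) (hv : ∀ i, v i ∈ filt ν (ν + 1))
    (h : ∀ i, y i - x i - v i ∈ filt ν (ν + 2)) (p q : ℕ) :
    y 0 ^ p * y 1 ^ q - x 0 ^ p * x 1 ^ q
      - (p * x 0 ^ (p - 1) * x 1 ^ q * v 0 + q * x 0 ^ p * x 1 ^ (q - 1) * v 1)
        ∈ filt ν (ν + (p + q) + 1) := by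
  have hyx : ∀ i, y i - x i ∈ filt ν (ν + 1) := fun i => by
    have := Ideal.add_mem _ (filt_mono le_rfl (by omega) (h i)) (hv i)
    simpa using this
  have e : y 0 ^ p * y 1 ^ q - x 0 ^ p * x 1 ^ q
      - (p * x 0 ^ (p - 1) * x 1 ^ q * v 0 + q * x 0 ^ p * x 1 ^ (q - 1) * v 1)
      = (y 0 ^ p - x 0 ^ p - p * x 0 ^ (p - 1) * v 0) * y 1 ^ q
        + x 0 ^ p * (y 1 ^ q - x 1 ^ q - q * x 1 ^ (q - 1) * v 1)
        + p * ((y 1 ^ q - x 1 ^ q) * (x 0 ^ (p - 1) * v 0)) := by ring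
  rw [e]
  refine Ideal.add_mem _ (Ideal.add_mem _ ?_ ?_) ?_
  · exact mul_mem_filt_of_le (pow_taylor_mem_filt hν (hx 0) (hy 0) (hv 0) (h 0) p)
      (pow_mem_filt (hy 1) q) (by omega) (by omega)
  · exact mul_mem_filt_of_le (pow_mem_filt (hx 0) p)
      (pow_taylor_mem_filt hν (hx 1) (hy 1) (hv 1) (h 1) q) (by omega) (by omega)
  · rcases p with _ | p
    · simp
    · refine Ideal.mul_mem_left _ _ (mul_mem_filt_of_le
        (pow_sub_pow_mem_filt (N := ν + q) (hx 1) (hy 1) (hyx 1) (by omega))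
        (mul_mem_filt (pow_mem_filt (hx 0) (p + 1 - 1)) (hv 0)) (by omega) ?_)
      simp only [Nat.add_sub_cancel, mul_one]
      omega

/-![MvPowerSeries.X 0 * (K + (k : MvPowerSeries (Fin 2) ℂ)), c + (h : MvPowerSeries (Fin 2) ℂ)]### Maps `id + z₁^ν G` and the homological operator -/

/-- The formal map `z + z₁^ν G(z)`. -/
noncomputable def contactMap (ν : ℕ) (G : FormalMap) : FormalMap :=
  fun i => MvPowerSeries.X i + MvPowerSeries.X 0 ^ ν * G i

/-- The matrix `A` acting on pairs of polynomials. -/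
noncomputable def polyAct (A : Matrix (Fin 2) (Fin 2) ℂ) (v : Fin 2 → MvPolynomial (Fin 2) ℂ) :
    Fin 2 → MvPolynomial (Fin 2) ℂ :=
  fun i => MvPolynomial.C (A i 0) * v 0 + MvPolynomial.C (A i 1) * v 1

/-- The derivative of `h` along the linear vector field `A`. -/
noncomputable def lieDeriv (A : Matrix (Fin 2) (Fin 2) ℂ) (h : MvPolynomial (Fin 2) ℂ) :
    MvPolynomial (Fin 2) ℂ :=
  MvPolynomial.pderiv 0 h * polyAct A MvPolynomial.X 0
    + MvPolynomial.pderiv 1 h * polyAct A MvPolynomial.X 1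

/-- The homological operator: the effect of the change of coordinates `z + (z₁ k, h)` on the lowest
order terms of `G` in `z + z₁^ν G(z)`, when `G` has linear part `A`. -/
noncomputable def homOp (ν : ℕ) (A : Matrix (Fin 2) (Fin 2) ℂ) (k h : MvPolynomial (Fin 2) ℂ) :
    Fin 2 → MvPolynomial (Fin 2) ℂ :=
  fun i => ν * k * polyAct A MvPolynomial.X i
    + polyAct A ![MvPolynomial.X 0 * k, h] i
    - lieDeriv A ((![MvPolynomial.X 0 * k, h] : Fin 2 → MvPolynomial (Fin 2) ℂ) i)

theorem contactMap_sub_X_mem {ν : ℕ} {G : FormalMap} (hG : ∀ i, G i ∈ filt 0 1) (i : Fin 2) :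
    contactMap ν G i - MvPowerSeries.X i ∈ filt ν (ν + 1) := by
  rw [contactMap, add_sub_cancel_left]
  exact mul_mem_filt_of_le (X_zero_pow_mem_filt ν) (hG i) (by omega) (by omega)

theorem contactMap_mem {ν : ℕ} {G : FormalMap} (hG : ∀ i, G i ∈ filt 0 1) (i : Fin 2) :
    contactMap ν G i ∈ filt 0 1 := by
  have := Ideal.add_mem _ (filt_mono (Nat.zero_le _) (by omega) (contactMap_sub_X_mem (ν := ν) hG i))
    (X_mem_filt i)
  simpa using this

theorem coe_polyAct (A : Matrix (Fin 2) (Fin 2) ℂ) (v : Fin 2 → MvPolynomial (Fin 2) ℂ)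
    (i : Fin 2) : (polyAct A v i : MvPowerSeries (Fin 2) ℂ)
      = cst (A i 0) * (v 0 : MvPowerSeries (Fin 2) ℂ) + cst (A i 1) * (v 1 : MvPowerSeries (Fin 2) ℂ) := by
  simp [polyAct]

theorem coe_polyAct_X (A : Matrix (Fin 2) (Fin 2) ℂ) (i : Fin 2) :
    (polyAct A MvPolynomial.X i : MvPowerSeries (Fin 2) ℂ) = cst (A i 0) * Z1 + cst (A i 1) * Z2 := by
  rw [coe_polyAct, MvPolynomial.coe_X, MvPolynomial.coe_X]

theorem coe_polyAct_X_mem (A : Matrix (Fin 2) (Fin 2) ℂ) (i : Fin 2) :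
    (polyAct A MvPolynomial.X i : MvPowerSeries (Fin 2) ℂ) ∈ filt 0 1 := by
  rw [coe_polyAct_X]
  exact Ideal.add_mem _ (Ideal.mul_mem_left _ _ (X_mem_filt 0))
    (Ideal.mul_mem_left _ _ (X_mem_filt 1))

theorem mem_filt_zero_one_of_sub_polyAct {A : Matrix (Fin 2) (Fin 2) ℂ} {i : Fin 2}
    {g : MvPowerSeries (Fin 2) ℂ}
    (hg : g - (polyAct A MvPolynomial.X i : MvPowerSeries (Fin 2) ℂ) ∈ filt 0 2) :
    g ∈ filt 0 1 := by
  have := Ideal.add_mem _ (filt_mono le_rfl (by omega) hg) (coe_polyAct_X_mem A i)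
  simpa using this

theorem degree_fin_two (m : Fin 2 →₀ ℕ) : m.degree = m 0 + m 1 := by
  rw [Finsupp.degree_eq_sum, Fin.sum_univ_two]

theorem coe_mem_filt_of_isHomogeneous {h : MvPolynomial (Fin 2) ℂ} {e : ℕ}
    (hh : h.IsHomogeneous e) : (h : MvPowerSeries (Fin 2) ℂ) ∈ filt 0 e := by
  intro m hm
  rw [MvPolynomial.coeff_coe]
  exact hh.coeff_eq_zero (by rw [degree_fin_two]; omega)

theorem coe_monomial_fin_two (m : Fin 2 →₀ ℕ) (c : ℂ) :
    (MvPolynomial.monomial m c : MvPowerSeries (Fin 2) ℂ)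
      = cst c * (MvPowerSeries.X 0 ^ m 0 * MvPowerSeries.X 1 ^ m 1) := by
  rw [MvPolynomial.monomial_eq, Finsupp.prod_fintype _ _ (by simp), Fin.prod_univ_two]
  simp

theorem subst_monomial_fin_two {x : FormalMap} (hx : MvPowerSeries.HasSubst x)
    (m : Fin 2 →₀ ℕ) (c : ℂ) :
    MvPowerSeries.subst x (MvPolynomial.monomial m c : MvPowerSeries (Fin 2) ℂ)
      = cst c * (x 0 ^ m 0 * x 1 ^ m 1) := by
  rw [MvPolynomial.coe_monomial, MvPowerSeries.subst_monomial hx, finsupp_prod_fin_two]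
  rfl

/-- Composing with `z + z₁^ν G` is, to first order, adding `z₁^ν` times the derivative along `G`.
Only the linear part `A` of `G` contributes in the lowest degree. Both sides are additive in `h`, so
monomials suffice. -/
theorem subst_contactMap_taylor_mem {ν e : ℕ} (hν : 1 ≤ ν) {A : Matrix (Fin 2) (Fin 2) ℂ}
    {G : FormalMap}
    (hG : ∀ i, G i - (polyAct A MvPolynomial.X i : MvPowerSeries (Fin 2) ℂ) ∈ filt 0 2)
    {h : MvPolynomial (Fin 2) ℂ} (hh : h.IsHomogeneous e) :
    MvPowerSeries.subst (contactMap ν G) (h : MvPowerSeries (Fin 2) ℂ)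
      - (h : MvPowerSeries (Fin 2) ℂ)
      - MvPowerSeries.X 0 ^ ν * (lieDeriv A h : MvPowerSeries (Fin 2) ℂ) ∈ filt ν (ν + e + 1) := by
  have hG1 : ∀ i, G i ∈ filt 0 1 := fun i => mem_filt_zero_one_of_sub_polyAct (hG i)
  have hF := hasSubst_of_mem_filt (contactMap_mem (ν := ν) hG1)
  have key : ∀ m : Fin 2 →₀ ℕ, m 0 + m 1 = e → ∀ c : ℂ,
      MvPowerSeries.subst (contactMap ν G) (MvPolynomial.monomial m c : MvPowerSeries (Fin 2) ℂ)
        - (MvPolynomial.monomial m c : MvPowerSeries (Fin 2) ℂ)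
        - MvPowerSeries.X 0 ^ ν * (lieDeriv A (MvPolynomial.monomial m c) : MvPowerSeries (Fin 2) ℂ)
          ∈ filt ν (ν + e + 1) := by
    intro m hm c
    have hT := monomial_taylor_mem_filt hν (x := MvPowerSeries.X) (y := contactMap ν G)
      (v := fun i => MvPowerSeries.X 0 ^ ν * (polyAct A MvPolynomial.X i : MvPowerSeries (Fin 2) ℂ))
      X_mem_filt (contactMap_mem hG1)
      (fun i => mul_mem_filt_of_le (X_zero_pow_mem_filt ν) (coe_polyAct_X_mem A i) (by omega)
        (by omega))
      (fun i => by
        rw [contactMap, add_sub_cancel_left, ← mul_sub]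
        exact mul_mem_filt_of_le (X_zero_pow_mem_filt ν) (hG i) (by omega) (by omega))
      (m 0) (m 1)
    rw [hm] at hT
    rw [subst_monomial_fin_two hF, coe_monomial_fin_two]
    convert Ideal.mul_mem_left _ (cst c) hT using 1
    rw [lieDeriv, MvPolynomial.pderiv_monomial, MvPolynomial.pderiv_monomial,
      MvPolynomial.coe_add, MvPolynomial.coe_mul, MvPolynomial.coe_mul, coe_monomial_fin_two,
      coe_monomial_fin_two]
    simp [cst]
    ring
  have sum : ∀ s : Finset (Fin 2 →₀ ℕ), (∀ m ∈ s, m 0 + m 1 = e) →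
      MvPowerSeries.subst (contactMap ν G)
        ((∑ m ∈ s, MvPolynomial.monomial m (h.coeff m) : MvPolynomial (Fin 2) ℂ) :
          MvPowerSeries (Fin 2) ℂ)
        - ((∑ m ∈ s, MvPolynomial.monomial m (h.coeff m) : MvPolynomial (Fin 2) ℂ) :
          MvPowerSeries (Fin 2) ℂ)
        - MvPowerSeries.X 0 ^ ν *
          (lieDeriv A (∑ m ∈ s, MvPolynomial.monomial m (h.coeff m)) : MvPowerSeries (Fin 2) ℂ)
          ∈ filt ν (ν + e + 1) := by
    classical
    intro s
    induction s using Finset.induction_on with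
    | empty =>
      intro _
      rw [Finset.sum_empty, MvPolynomial.coe_zero, ← MvPowerSeries.substAlgHom_apply hF, map_zero]
      simp [lieDeriv]
    | insert m s hms ih =>
      intro hs
      have h1 := ih fun m' hm' => hs m' (Finset.mem_insert_of_mem hm')
      have h2 := key m (hs m (Finset.mem_insert_self _ _)) (h.coeff m)
      convert Ideal.add_mem _ h2 h1 using 1
      rw [Finset.sum_insert hms, MvPolynomial.coe_add, MvPowerSeries.subst_add hF]
      simp only [lieDeriv, map_add, MvPolynomial.coe_add, MvPolynomial.coe_mul]
      ring
  have := sum h.support fun m hm => by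
    rw [← degree_fin_two]
    by_contra hne
    exact MvPolynomial.mem_support_iff.mp hm (hh.coeff_eq_zero hne)
  rwa [MvPolynomial.support_sum_monomial_coeff] at this

theorem subst_polyAct_X {x : FormalMap} (hx : MvPowerSeries.HasSubst x)
    (A : Matrix (Fin 2) (Fin 2) ℂ) (i : Fin 2) :
    MvPowerSeries.subst x (polyAct A MvPolynomial.X i : MvPowerSeries (Fin 2) ℂ)
      = cst (A i 0) * x 0 + cst (A i 1) * x 1 := by
  rw [coe_polyAct_X, MvPowerSeries.subst_add hx, MvPowerSeries.subst_mul hx,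
    MvPowerSeries.subst_mul hx, MvPowerSeries.subst_X hx, MvPowerSeries.subst_X hx,
    MvPowerSeries.subst_C, MvPowerSeries.subst_C]

/-- The conjugacy defect of `χ` between `z + z₁^ν G` and `z + z₁^ν H`. -/
noncomputable def defect (ν : ℕ) (G H χ : FormalMap) : FormalMap :=
  fun i => MvPowerSeries.subst χ (contactMap ν G i)
    - MvPowerSeries.subst (contactMap ν H) (χ i)

theorem subst_contactMap {ν : ℕ} {G χ : FormalMap} (hχ : MvPowerSeries.HasSubst χ) (i : Fin 2) :
    MvPowerSeries.subst χ (contactMap ν G i)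
      = χ i + χ 0 ^ ν * MvPowerSeries.subst χ (G i) := by
  rw [contactMap, MvPowerSeries.subst_add hχ, MvPowerSeries.subst_mul hχ,
    MvPowerSeries.subst_pow hχ, MvPowerSeries.subst_X hχ, MvPowerSeries.subst_X hχ]

theorem changed_mem {K c : MvPowerSeries (Fin 2) ℂ}
    (hc : c - MvPowerSeries.X 1 ∈ filt 0 2) (i : Fin 2) :
    (![MvPowerSeries.X 0 * K, c] : FormalMap) i ∈ filt 0 1 := by
  fin_cases i
  · exact Ideal.mul_mem_right _ _ (X_mem_filt 0)
  · have := Ideal.add_mem _ (filt_mono le_rfl (by omega) hc) (X_mem_filt 1)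
    simpa using this

theorem changed_sub_X_mem {K c : MvPowerSeries (Fin 2) ℂ} (hK : K - 1 ∈ filt 0 1)
    (hc : c - MvPowerSeries.X 1 ∈ filt 0 2) (i : Fin 2) :
    (![MvPowerSeries.X 0 * K, c] : FormalMap) i - MvPowerSeries.X i ∈ filt 0 2 := by
  fin_cases i
  · have := mul_mem_filt_of_le (c := 0) (l := 2) X_zero_mem_filt hK (by omega) (by omega)
    simpa [mul_sub] using this
  · exact hc

/-- The change of the conjugacy defect when terms of degree `e` are added to the data. -/
theorem defect_add_mem {ν e : ℕ} (hν : 1 ≤ ν) (he : 2 ≤ e) {A : Matrix (Fin 2) (Fin 2) ℂ}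
    {G H : FormalMap}
    (hG : ∀ i, G i - (polyAct A MvPolynomial.X i : MvPowerSeries (Fin 2) ℂ) ∈ filt 0 2)
    (hH : ∀ i, H i - (polyAct A MvPolynomial.X i : MvPowerSeries (Fin 2) ℂ) ∈ filt 0 2)
    {K c : MvPowerSeries (Fin 2) ℂ} (hK : K - 1 ∈ filt 0 1)
    (hc : c - MvPowerSeries.X 1 ∈ filt 0 2)
    {k h : MvPolynomial (Fin 2) ℂ} {g : Fin 2 → MvPolynomial (Fin 2) ℂ}
    (hk : k.IsHomogeneous (e - 1)) (hh : h.IsHomogeneous e) (hg : ∀ i, (g i).IsHomogeneous e)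
    (i : Fin 2) :
    defect ν G (fun i => H i + g i) ![MvPowerSeries.X 0 * (K + (k : MvPowerSeries (Fin 2) ℂ)), c + h] i
      - defect ν G H ![MvPowerSeries.X 0 * K, c] i
      - MvPowerSeries.X 0 ^ ν * ((homOp ν A k h i - g i : MvPolynomial (Fin 2) ℂ) :
          MvPowerSeries (Fin 2) ℂ) ∈ filt ν (ν + e + 1) := by
  set χ : FormalMap := ![MvPowerSeries.X 0 * K, c] with hχdef
  set χ' : FormalMap := ![MvPowerSeries.X 0 * (K + (k : MvPowerSeries (Fin 2) ℂ)), c + h] with hχ'def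
  set w : Fin 2 → MvPolynomial (Fin 2) ℂ := ![MvPolynomial.X 0 * k, h] with hwdef
  set H' : FormalMap := fun i => H i + g i with hH'def
  have hkf := coe_mem_filt_of_isHomogeneous hk
  have hhf := coe_mem_filt_of_isHomogeneous hh
  have hw : ∀ i, (w i).IsHomogeneous e := by
    intro i
    fin_cases i
    · have := (MvPolynomial.isHomogeneous_X ℂ (0 : Fin 2)).mul hk
      rwa [show 1 + (e - 1) = e by omega] at this
    · exact hh
  have hχw : ∀ i, χ' i = χ i + (w i : MvPowerSeries (Fin 2) ℂ) := by
    intro i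
    fin_cases i <;> simp [hχdef, hχ'def, hwdef, mul_add]
  have hK' : K + (k : MvPowerSeries (Fin 2) ℂ) - 1 ∈ filt 0 1 := by
    have := Ideal.add_mem _ hK (filt_mono le_rfl (show 1 ≤ e - 1 by omega) hkf)
    convert this using 1
    ring
  have hc' : c + (h : MvPowerSeries (Fin 2) ℂ) - MvPowerSeries.X 1 ∈ filt 0 2 := by
    have := Ideal.add_mem _ hc (filt_mono le_rfl he hhf)
    convert this using 1
    ring
  have hH' : ∀ i, H' i - (polyAct A MvPolynomial.X i : MvPowerSeries (Fin 2) ℂ) ∈ filt 0 2 := by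
    intro i
    have := Ideal.add_mem _ (hH i)
      (filt_mono le_rfl he (coe_mem_filt_of_isHomogeneous (hg i)))
    convert this using 1
    simp only [hH'def]
    ring
  have hH1 : ∀ i, H i ∈ filt 0 1 := fun i => mem_filt_zero_one_of_sub_polyAct (hH i)
  have hH'1 : ∀ i, H' i ∈ filt 0 1 := fun i => mem_filt_zero_one_of_sub_polyAct (hH' i)
  have hχ : MvPowerSeries.HasSubst χ := hasSubst_of_mem_filt (changed_mem (K := K) hc)
  have hχ' : MvPowerSeries.HasSubst χ' := hasSubst_of_mem_filt (changed_mem (K := K + (k : MvPowerSeries (Fin 2) ℂ)) hc')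
  have hF := hasSubst_of_mem_filt (contactMap_mem (ν := ν) hH1)
  have hF' := hasSubst_of_mem_filt (contactMap_mem (ν := ν) hH'1)
  -- The change of the defect splits into three pieces: `a1` is the added term `w` composed with the
  -- new target map, `a2` is the old `χ` composed with the changed target map, and `a3` is the
  -- effect on `χ₁^ν G(χ)` after division by `z₁^ν`.
  have a1 := subst_contactMap_taylor_mem hν hH' (hw i)
  have a2 : MvPowerSeries.subst (contactMap ν H') (χ i)
      - MvPowerSeries.subst (contactMap ν H) (χ i)
      - MvPowerSeries.X 0 ^ ν * (g i : MvPowerSeries (Fin 2) ℂ) ∈ filt ν (ν + e + 1) := by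
    have hd : ∀ i, contactMap ν H' i - contactMap ν H i ∈ filt ν (ν + e) := by
      intro i
      have e1 : contactMap ν H' i - contactMap ν H i
          = MvPowerSeries.X 0 ^ ν * (g i : MvPowerSeries (Fin 2) ℂ) := by
        simp only [contactMap, hH'def]
        ring
      rw [e1]
      exact mul_mem_filt_of_le (X_zero_pow_mem_filt ν)
        (coe_mem_filt_of_isHomogeneous (hg i)) (by omega) (by omega)
    have := subst_sub_subst_mem_filt (N := ν + e + 1) (contactMap_mem hH1) (contactMap_mem hH'1) hd
      (changed_sub_X_mem hK hc i) (by omega)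
    convert this using 1
    rw [MvPowerSeries.subst_sub hF', MvPowerSeries.subst_sub hF, MvPowerSeries.subst_X hF',
      MvPowerSeries.subst_X hF]
    simp only [contactMap, hH'def]
    ring
  have a3 : (K + (k : MvPowerSeries (Fin 2) ℂ)) ^ ν * MvPowerSeries.subst χ' (G i) - K ^ ν * MvPowerSeries.subst χ (G i)
      - ((ν * k * polyAct A MvPolynomial.X i + polyAct A w i : MvPolynomial (Fin 2) ℂ) :
        MvPowerSeries (Fin 2) ℂ)
        ∈ filt 0 (e + 1) := by
    set P : MvPowerSeries (Fin 2) ℂ := (polyAct A MvPolynomial.X i : MvPowerSeries (Fin 2) ℂ)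
    have hP : P ∈ filt 0 1 := coe_polyAct_X_mem A i
    have b1 : MvPowerSeries.subst χ' (G i) - MvPowerSeries.subst χ (G i)
        - (polyAct A w i : MvPowerSeries (Fin 2) ℂ) ∈ filt 0 (e + 1) := by
      have := subst_sub_subst_mem_filt (N := e + 1) (n := e) (x := χ) (y := χ') (a := 0)
        (changed_mem hc) (changed_mem hc')
        (fun i => by
          rw [hχw, add_sub_cancel_left]
          exact coe_mem_filt_of_isHomogeneous (hw i)) (hG i) (by omega)
      convert this using 1
      rw [MvPowerSeries.subst_sub hχ', MvPowerSeries.subst_sub hχ, subst_polyAct_X hχ',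
        subst_polyAct_X hχ, hχw, hχw, coe_polyAct]
      ring
    have b2 : MvPowerSeries.subst χ' (G i) - P ∈ filt 0 2 := by
      have h1 := subst_mem_filt (changed_mem (K := K + (k : MvPowerSeries (Fin 2) ℂ)) hc') (hG i)
      rw [MvPowerSeries.subst_sub hχ', subst_polyAct_X hχ'] at h1
      have h2 : cst (A i 0) * (χ' 0 - MvPowerSeries.X 0) + cst (A i 1) * (χ' 1 - MvPowerSeries.X 1)
          ∈ filt 0 2 :=
        Ideal.add_mem _ (Ideal.mul_mem_left _ _ (changed_sub_X_mem hK' hc' 0))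
          (Ideal.mul_mem_left _ _ (changed_sub_X_mem hK' hc' 1))
      have := Ideal.add_mem _ h1 h2
      convert this using 1
      simp only [P]
      rw [coe_polyAct_X]
      ring
    -- The binomial remainder is quadratic in `k`, of order at least `2(e - 1) ≥ e` since `e ≥ 2`.
    -- Replacing `K^(ν-1)` by `1` in the linear term gains one order because `K - 1` has order one.
    have b3 : (K + (k : MvPowerSeries (Fin 2) ℂ)) ^ ν - K ^ ν - ν * (k : MvPowerSeries (Fin 2) ℂ) ∈ filt 0 e := by
      obtain ⟨q, hq⟩ : ∃ q, (K + (k : MvPowerSeries (Fin 2) ℂ)) ^ ν - K ^ ν - ν * K ^ (ν - 1) * (k : MvPowerSeries (Fin 2) ℂ)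
          = q * (k : MvPowerSeries (Fin 2) ℂ) ^ 2 := by
        obtain ⟨q, hq⟩ := Polynomial.powAddExpansion K (k : MvPowerSeries (Fin 2) ℂ) ν
        exact ⟨q, by rw [hq]; ring⟩
      have c1 : (k : MvPowerSeries (Fin 2) ℂ) ^ 2 ∈ filt 0 e := 
        filt_mono le_rfl (by omega) (pow_mem_filt hkf 2)
      have c2 : K ^ (ν - 1) - 1 ∈ filt 0 1 := by
        obtain ⟨s, hs⟩ := sub_dvd_pow_sub_pow K 1 (ν - 1)
        rw [one_pow] at hs
        rw [hs]
        exact Ideal.mul_mem_right _ _ hK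
      have c3 : (K ^ (ν - 1) - 1) * (k : MvPowerSeries (Fin 2) ℂ) ∈ filt 0 e :=
        mul_mem_filt_of_le c2 hkf (by omega) (by omega)
      have := Ideal.add_mem _ (Ideal.mul_mem_left _ q c1)
        (Ideal.mul_mem_left _ (ν : MvPowerSeries (Fin 2) ℂ) c3)
      rw [← hq] at this
      convert this using 1
      ring
    have b4 : K ^ ν - 1 ∈ filt 0 1 := by
      obtain ⟨s, hs⟩ := sub_dvd_pow_sub_pow K 1 ν
      rw [one_pow] at hs
      rw [hs]
      exact Ideal.mul_mem_right _ _ hK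
    have hwA : (polyAct A w i : MvPowerSeries (Fin 2) ℂ) ∈ filt 0 e := by
      rw [coe_polyAct]
      exact Ideal.add_mem _ (Ideal.mul_mem_left _ _ (coe_mem_filt_of_isHomogeneous (hw 0)))
        (Ideal.mul_mem_left _ _ (coe_mem_filt_of_isHomogeneous (hw 1)))
    have b2' : MvPowerSeries.subst χ' (G i) ∈ filt 0 1 := by
      have := Ideal.add_mem _ (filt_mono le_rfl (by omega) b2) hP
      simpa using this
    have d1 : ((K + (k : MvPowerSeries (Fin 2) ℂ)) ^ ν - K ^ ν - ν * (k : MvPowerSeries (Fin 2) ℂ)) * MvPowerSeries.subst χ' (G i) ∈ filt 0 (e + 1) :=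
      mul_mem_filt b3 b2'
    have d2 : (k : MvPowerSeries (Fin 2) ℂ) * (MvPowerSeries.subst χ' (G i) - P)
        ∈ filt 0 (e + 1) := mul_mem_filt_of_le hkf b2 (by omega) (by omega)
    have d3 : (K ^ ν - 1) * (polyAct A w i : MvPowerSeries (Fin 2) ℂ)
        ∈ filt 0 (e + 1) := mul_mem_filt_of_le b4 hwA (by omega) (by omega)
    have := Ideal.add_mem _ (Ideal.add_mem _ (Ideal.add_mem _ d1
      (Ideal.mul_mem_left _ (ν : MvPowerSeries (Fin 2) ℂ) d2)) d3)
      (Ideal.mul_mem_left _ (K ^ ν) b1)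
    convert this using 1
    simp only [MvPolynomial.coe_add, MvPolynomial.coe_mul]
    have : (((ν : MvPolynomial (Fin 2) ℂ)) : MvPowerSeries (Fin 2) ℂ) = ν :=
      map_natCast (MvPolynomial.coeToMvPowerSeries.ringHom (R := ℂ) (σ := Fin 2)) ν
    rw [this]
    ring
  have a4 := mul_mem_filt_of_le (c := ν) (l := ν + e + 1) (X_zero_pow_mem_filt ν) a3 (by omega)
    (by omega)
  have := Ideal.sub_mem _ (Ideal.sub_mem _ a4 a1) a2
  convert this using 1
  have coe_sub : ∀ a b : MvPolynomial (Fin 2) ℂ,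
      ((a - b : MvPolynomial (Fin 2) ℂ) : MvPowerSeries (Fin 2) ℂ) = a - b := fun a b =>
    map_sub (MvPolynomial.coeToMvPowerSeries.ringHom (R := ℂ) (σ := Fin 2)) a b
  have z0 : χ 0 = MvPowerSeries.X 0 * K := rfl
  have z0' : χ' 0 = MvPowerSeries.X 0 * (K + (k : MvPowerSeries (Fin 2) ℂ)) := rfl
  simp only [defect, homOp]
  rw [subst_contactMap hχ', subst_contactMap hχ, hχw i, MvPowerSeries.subst_add hF', z0, z0', 
    ← hwdef, coe_sub, coe_sub, mul_pow, mul_pow]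
  ring

/-! ### Solving the conjugacy equation degree by degree -/

/-- In every degree `e ≥ 2`, the homological operator is surjective modulo the polynomials whose
monomials lie in `S`. -/
def HomSolvable (ν : ℕ) (A : Matrix (Fin 2) (Fin 2) ℂ) (S : Fin 2 → Set (Fin 2 →₀ ℕ)) : Prop :=
  ∀ e, 2 ≤ e → ∀ r : Fin 2 → MvPolynomial (Fin 2) ℂ, (∀ i, (r i).IsHomogeneous e) →
    ∃ (k h : MvPolynomial (Fin 2) ℂ) (g : Fin 2 → MvPolynomial (Fin 2) ℂ),
      k.IsHomogeneous (e - 1) ∧ h.IsHomogeneous e ∧ (∀ i, (g i).IsHomogeneous e) ∧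
      (∀ i m, MvPolynomial.coeff m (g i) ≠ 0 → m ∈ S i) ∧ ∀ i, homOp ν A k h i = g i + r i

/-- `z + z₁^ν H` has linear part `A` and higher order monomials in `S`, and the change of
coordinates `(z₁ K, c)`, tangent to the identity, conjugates `z + z₁^ν G` to it up to order `n`. -/
structure IsApproxSolution (ν : ℕ) (A : Matrix (Fin 2) (Fin 2) ℂ) (S : Fin 2 → Set (Fin 2 →₀ ℕ))
    (G : FormalMap) (n : ℕ) (K c : MvPowerSeries (Fin 2) ℂ) (H : FormalMap) : Prop where
  unit : K - 1 ∈ filt 0 1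
  tangent : c - MvPowerSeries.X 1 ∈ filt 0 2
  linear : ∀ i, H i - (polyAct A MvPolynomial.X i : MvPowerSeries (Fin 2) ℂ) ∈ filt 0 2
  support : ∀ i m, 2 ≤ m 0 + m 1 → MvPowerSeries.coeff m (H i) ≠ 0 → m ∈ S i
  defect_mem : ∀ i, defect ν G H ![MvPowerSeries.X 0 * K, c] i ∈ filt ν (ν + n)

theorem coe_sub_mvPowerSeries (a b : MvPolynomial (Fin 2) ℂ) :
    ((a - b : MvPolynomial (Fin 2) ℂ) : MvPowerSeries (Fin 2) ℂ) = a - b :=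
  map_sub (MvPolynomial.coeToMvPowerSeries.ringHom (R := ℂ) (σ := Fin 2)) a b

/-- The homogeneous component of degree `e` of a power series. -/
theorem exists_homogeneous_part {e : ℕ} {ψ : MvPowerSeries (Fin 2) ℂ} (hψ : ψ ∈ filt 0 e) :
    ∃ r : MvPolynomial (Fin 2) ℂ, r.IsHomogeneous e ∧
      ψ - (r : MvPowerSeries (Fin 2) ℂ) ∈ filt 0 (e + 1) := by
  classical
  refine ⟨∑ m ∈ Finset.finsuppAntidiag Finset.univ e,
    MvPolynomial.monomial m (MvPowerSeries.coeff m ψ), ?_, ?_⟩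
  · refine MvPolynomial.IsHomogeneous.sum _ _ _ fun m hm =>
      MvPolynomial.isHomogeneous_monomial _ ?_
    rw [Finset.mem_finsuppAntidiag] at hm
    rw [Finsupp.degree_eq_sum, hm.1]
  · intro m hm
    rw [map_sub, MvPolynomial.coeff_coe, MvPolynomial.coeff_sum]
    simp only [MvPolynomial.coeff_monomial, Finset.sum_ite_eq', Finset.mem_finsuppAntidiag,
      Fin.sum_univ_two, Finset.subset_univ, and_true]
    split_ifs with h
    · rw [sub_self]
    · rw [sub_zero]
      exact hψ m (by omega)

/-- One step of the recursion: the degree `n` part of the defect, divided by `z₁^ν`, is cancelled by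
a solution of the homological equation. The corrections have degree `n`, except that of `K`, which
has degree `n - 1` because `z₁K` is what enters the change. -/
theorem IsApproxSolution.exists_next {ν : ℕ} (hν : 1 ≤ ν) {A : Matrix (Fin 2) (Fin 2) ℂ}
    {S : Fin 2 → Set (Fin 2 →₀ ℕ)} (hS : HomSolvable ν A S) {G : FormalMap}
    (hG : ∀ i, G i - (polyAct A MvPolynomial.X i : MvPowerSeries (Fin 2) ℂ) ∈ filt 0 2)
    {n : ℕ} (hn : 2 ≤ n) {K c : MvPowerSeries (Fin 2) ℂ} {H : FormalMap}
    (h : IsApproxSolution ν A S G n K c H) :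
    ∃ K' c' H', IsApproxSolution ν A S G (n + 1) K' c' H' ∧ K' - K ∈ filt 0 (n - 1) ∧
      c' - c ∈ filt 0 n ∧ ∀ i, H' i - H i ∈ filt 0 n := by
  choose ψ hψ hψd using fun i => mem_filt_iff_exists.mp (h.defect_mem i)
  choose r hr hrψ using fun i => exists_homogeneous_part (hψ i)
  -- The equation is solved for minus the residue, so that `homOp ν A k w i - g i` cancels `r i`.
  obtain ⟨k, w, g, hk, hw, hg, hgS, heq⟩ := hS n hn (fun i => -r i) fun i => (hr i).neg
  refine ⟨K + (k : MvPowerSeries (Fin 2) ℂ), c + (w : MvPowerSeries (Fin 2) ℂ),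
    fun i => H i + (g i : MvPowerSeries (Fin 2) ℂ), ⟨?_, ?_, ?_, ?_, ?_⟩, ?_, ?_, ?_⟩
  · have := Ideal.add_mem _ h.unit
      (filt_mono le_rfl (show 1 ≤ n - 1 by omega) (coe_mem_filt_of_isHomogeneous hk))
    convert this using 1
    ring
  · have := Ideal.add_mem _ h.tangent (filt_mono le_rfl hn (coe_mem_filt_of_isHomogeneous hw))
    convert this using 1
    ring
  · intro i
    have := Ideal.add_mem _ (h.linear i)
      (filt_mono le_rfl hn (coe_mem_filt_of_isHomogeneous (hg i)))
    convert this using 1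
    ring
  · intro i m hm hne
    by_contra hmS
    refine hne ?_
    rw [map_add, MvPolynomial.coeff_coe, not_not.mp (mt (h.support i m hm) hmS),
      not_not.mp (mt (hgS i m) hmS), add_zero]
  · intro i
    have h1 := defect_add_mem hν hn hG h.linear h.unit h.tangent hk hw hg i
    have h2 := mul_mem_filt_of_le (c := ν) (l := ν + n + 1) (X_zero_pow_mem_filt ν) (hrψ i)
      (by omega) (by omega)
    have := Ideal.add_mem _ h1 h2
    rw [← add_assoc]
    convert this using 1
    rw [hψd i, heq i, coe_sub_mvPowerSeries, MvPolynomial.coe_add,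
      show ((-r i : MvPolynomial (Fin 2) ℂ) : MvPowerSeries (Fin 2) ℂ) = -(r i) from
        map_neg (MvPolynomial.coeToMvPowerSeries.ringHom (R := ℂ) (σ := Fin 2)) (r i)]
    ring
  · rw [add_sub_cancel_left]
    exact coe_mem_filt_of_isHomogeneous hk
  · rw [add_sub_cancel_left]
    exact coe_mem_filt_of_isHomogeneous hw
  · intro i
    rw [add_sub_cancel_left]
    exact coe_mem_filt_of_isHomogeneous (hg i)

/-- Completeness of formal power series in the degree filtration: each coefficient is eventually
constant along the sequence. -/
theorem exists_limit {a : ℕ} (φ : ℕ → MvPowerSeries (Fin 2) ℂ)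
    (h : ∀ n, φ (n + 1) - φ n ∈ filt 0 (n + a)) : ∃ ψ, ∀ n, ψ - φ n ∈ filt 0 (n + a) := by
  have mono : ∀ n k, φ (n + k) - φ n ∈ filt 0 (n + a) := by
    intro n k
    induction k with
    | zero => simp
    | succ k ih =>
      have := Ideal.add_mem _ ih (filt_mono le_rfl (by omega) (h (n + k)))
      convert this using 1
      rw [← add_assoc]
      ring
  -- From the index `m 0 + m 1 + 1` on, all increments have order greater than the degree of `m`, so
  -- this coefficient no longer changes.
  let ψ : MvPowerSeries (Fin 2) ℂ := fun m => MvPowerSeries.coeff m (φ (m 0 + m 1 + 1))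
  have hψ : ∀ m, MvPowerSeries.coeff m ψ = MvPowerSeries.coeff m (φ (m 0 + m 1 + 1)) :=
    fun m => rfl
  refine ⟨ψ, fun n m hm => ?_⟩
  rw [map_sub, hψ]
  rcases le_total n (m 0 + m 1 + 1) with hle | hle
  · obtain ⟨k, hk⟩ := Nat.exists_eq_add_of_le hle
    rw [hk, ← map_sub]
    exact mono n k m hm
  · obtain ⟨k, hk⟩ := Nat.exists_eq_add_of_le hle
    rw [← neg_sub, neg_eq_zero, hk, ← map_sub]
    exact mono _ k m (by omega)

/-- The approximate solutions converge, and substitution is continuous for the degree filtration, so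
the defect of the limit has arbitrarily high order and vanishes. -/
theorem exists_formal_solution {ν : ℕ} (hν : 1 ≤ ν) {A : Matrix (Fin 2) (Fin 2) ℂ}
    {S : Fin 2 → Set (Fin 2 →₀ ℕ)} (hS : HomSolvable ν A S) {G : FormalMap}
    (hG : ∀ i, G i - (polyAct A MvPolynomial.X i : MvPowerSeries (Fin 2) ℂ) ∈ filt 0 2) :
    ∃ (K c : MvPowerSeries (Fin 2) ℂ) (H : FormalMap),
      K - 1 ∈ filt 0 1 ∧ c - MvPowerSeries.X 1 ∈ filt 0 2 ∧
      (∀ i, H i - (polyAct A MvPolynomial.X i : MvPowerSeries (Fin 2) ℂ) ∈ filt 0 2) ∧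
      (∀ i m, 2 ≤ m 0 + m 1 → MvPowerSeries.coeff m (H i) ≠ 0 → m ∈ S i) ∧
      ∀ i, defect ν G H ![MvPowerSeries.X 0 * K, c] i = 0 := by
  let State := MvPowerSeries (Fin 2) ℂ × MvPowerSeries (Fin 2) ℂ × FormalMap
  -- The index is shifted by two: the identity, with target reduced to its linear part, already
  -- solves the equation up to degree two.
  let Good : ℕ → State → Prop := fun n s => IsApproxSolution ν A S G (n + 2) s.1 s.2.1 s.2.2
  have h0 : Good 0 (1, MvPowerSeries.X 1,
      fun i => (polyAct A MvPolynomial.X i : MvPowerSeries (Fin 2) ℂ)) := by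
    have hX : (![MvPowerSeries.X 0 * 1, MvPowerSeries.X 1] : FormalMap) = MvPowerSeries.X := by
      funext i
      fin_cases i <;> simp
    refine ⟨by simp, by simp, by simp, ?_, ?_⟩
    · intro i m hm hne
      refine absurd ?_ hne
      rw [MvPolynomial.coeff_coe]
      refine MvPolynomial.IsHomogeneous.coeff_eq_zero (n := 1) ?_ (by rw [degree_fin_two]; omega)
      exact ((MvPolynomial.isHomogeneous_C_mul_X _ _).add (MvPolynomial.isHomogeneous_C_mul_X _ _))
    · intro i
      have hP : ∀ i, (polyAct A MvPolynomial.X i : MvPowerSeries (Fin 2) ℂ) ∈ filt 0 1 :=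
        coe_polyAct_X_mem A
      have := mul_mem_filt_of_le (c := ν) (l := ν + (0 + 2)) (X_zero_pow_mem_filt ν) (hG i)
        (by omega) (by omega)
      convert this using 1
      simp only [defect, hX]
      rw [MvPowerSeries.subst_self, MvPowerSeries.subst_X
        (hasSubst_of_mem_filt (contactMap_mem hP))]
      simp only [contactMap, id]
      ring
  have hstep : ∀ n (s : State), Good n s → ∃ s' : State, Good (n + 1) s' ∧
      s'.1 - s.1 ∈ filt 0 (n + 1) ∧ s'.2.1 - s.2.1 ∈ filt 0 (n + 2) ∧
      ∀ i, s'.2.2 i - s.2.2 i ∈ filt 0 (n + 2) := by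
    intro n s hs
    obtain ⟨K', c', H', h1, h2, h3, h4⟩ := IsApproxSolution.exists_next hν hS hG (by omega) hs
    exact ⟨(K', c', H'), h1, h2, h3, h4⟩
  choose! next hnext using hstep
  let seq : ℕ → State := fun n => Nat.rec (1, MvPowerSeries.X 1,
      fun i => (polyAct A MvPolynomial.X i : MvPowerSeries (Fin 2) ℂ)) next n
  have hseq : ∀ n, Good n (seq n) := by
    intro n
    induction n with
    | zero => exact h0
    | succ n ih => exact (hnext n _ ih).1
  obtain ⟨K, hK⟩ := exists_limit (a := 1) (fun n => (seq n).1) fun n =>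
    (hnext n _ (hseq n)).2.1
  obtain ⟨c, hc⟩ := exists_limit (a := 2) (fun n => (seq n).2.1) fun n =>
    (hnext n _ (hseq n)).2.2.1
  choose H hH using fun i => exists_limit (a := 2) (fun n => (seq n).2.2 i) fun n =>
    (hnext n _ (hseq n)).2.2.2 i
  have hK1 : K - 1 ∈ filt 0 1 := by
    have := Ideal.add_mem _ (hK 0) (hseq 0).unit
    simpa using this
  have hc1 : c - MvPowerSeries.X 1 ∈ filt 0 2 := by
    have := Ideal.add_mem _ (hc 0) (hseq 0).tangent
    simpa using this
  have hH1 : ∀ i, H i - (polyAct A MvPolynomial.X i : MvPowerSeries (Fin 2) ℂ) ∈ filt 0 2 := by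
    intro i
    have := Ideal.add_mem _ (hH i 0) ((hseq 0).linear i)
    simpa using this
  refine ⟨K, c, H, hK1, hc1, hH1, ?_, fun i => eq_zero_of_forall_mem_filt fun n => ?_⟩
  · intro i m hm hne
    refine (hseq (m 0 + m 1)).support i m hm fun h => hne ?_
    have := hH i (m 0 + m 1) m (Or.inr (by omega))
    rwa [map_sub, h, sub_zero] at this
  -- The defect of the limit is compared with that of the `n`-th approximation. The three
  -- differences come from the change inside `G`, from the target map, and from the change outside
  -- it.
  · set s := seq n with hs
    have hg := hseq n
    rw [← hs] at hg
    have hχ : ∀ i, (![MvPowerSeries.X 0 * K, c] : FormalMap) i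
        - (![MvPowerSeries.X 0 * s.1, s.2.1] : FormalMap) i ∈ filt 0 (n + 2) := by
      intro i
      fin_cases i
      · have := mul_mem_filt_of_le (c := 0) (l := n + 2) X_zero_mem_filt (hK n) (by omega)
          (by omega)
        simpa [mul_sub] using this
      · exact hc n
    have hF1 := contactMap_mem (ν := ν) fun i => mem_filt_zero_one_of_sub_polyAct (hH1 i)
    have hF2 := contactMap_mem (ν := ν) fun i => mem_filt_zero_one_of_sub_polyAct (hg.linear i)
    have hF : ∀ i, contactMap ν H i - contactMap ν s.2.2 i ∈ filt 0 (n + 2) := by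
      intro i
      have := Ideal.mul_mem_left _ (MvPowerSeries.X 0 ^ ν) (hH i n)
      convert this using 1
      simp only [contactMap]
      ring
    have d1 := subst_sub_subst_mem_filt (N := n + 1) (changed_mem hg.tangent) (changed_mem hc1) hχ
      (mem_filt_zero_zero (contactMap ν G i)) (by omega)
    have d2 := subst_sub_subst_mem_filt (N := n + 1) hF2 hF1 hF
      (mem_filt_zero_zero ((![MvPowerSeries.X 0 * s.1, s.2.1] : FormalMap) i)) (by omega)
    have d3 := subst_mem_filt hF1 (hχ i)
    rw [MvPowerSeries.subst_sub (hasSubst_of_mem_filt hF1)] at d3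
    have := Ideal.add_mem _ (Ideal.sub_mem _ (Ideal.sub_mem _ (filt_mono le_rfl (by omega) d1)
      (filt_mono le_rfl (by omega) d2)) (filt_mono le_rfl (by omega) d3))
      (filt_mono (Nat.zero_le _) (show n ≤ ν + (n + 2) by omega) (hg.defect_mem i))
    convert this using 1
    simp only [defect]
    ring

/-! ### Solving the homological equation -/

theorem lieDeriv_add (A : Matrix (Fin 2) (Fin 2) ℂ) (h h' : MvPolynomial (Fin 2) ℂ) :
    lieDeriv A (h + h') = lieDeriv A h + lieDeriv A h' := by
  simp only [lieDeriv, map_add]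
  ring

theorem lieDeriv_C_mul (A : Matrix (Fin 2) (Fin 2) ℂ) (c : ℂ) (h : MvPolynomial (Fin 2) ℂ) :
    lieDeriv A (MvPolynomial.C c * h) = MvPolynomial.C c * lieDeriv A h := by
  simp only [lieDeriv, MvPolynomial.pderiv_C_mul]
  ring

theorem homOp_add (ν : ℕ) (A : Matrix (Fin 2) (Fin 2) ℂ) (k k' h h' : MvPolynomial (Fin 2) ℂ)
    (i : Fin 2) : homOp ν A (k + k') (h + h') i = homOp ν A k h i + homOp ν A k' h' i := by
  fin_cases i <;> simp [homOp, polyAct, mul_add, lieDeriv_add] <;> ring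

theorem homOp_C_mul (ν : ℕ) (A : Matrix (Fin 2) (Fin 2) ℂ) (c : ℂ) (k h : MvPolynomial (Fin 2) ℂ)
    (i : Fin 2) : homOp ν A (MvPolynomial.C c * k) (MvPolynomial.C c * h) i
      = MvPolynomial.C c * homOp ν A k h i := by
  have e : MvPolynomial.X 0 * (MvPolynomial.C c * k) = MvPolynomial.C c * (MvPolynomial.X 0 * k) := by
    ring
  fin_cases i <;> simp [homOp, polyAct, e, lieDeriv_C_mul] <;> ring

/-- The pairs of homogeneous polynomials of degree `e` in the image of the homological operator,
modulo those with monomials in `S`. -/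
def solvable (ν : ℕ) (A : Matrix (Fin 2) (Fin 2) ℂ) (S : Fin 2 → Set (Fin 2 →₀ ℕ)) (e : ℕ) :
    Submodule ℂ (Fin 2 → MvPolynomial (Fin 2) ℂ) where
  carrier := {r | ∃ (k h : MvPolynomial (Fin 2) ℂ) (g : Fin 2 → MvPolynomial (Fin 2) ℂ),
      k.IsHomogeneous (e - 1) ∧ h.IsHomogeneous e ∧ (∀ i, (g i).IsHomogeneous e) ∧
      (∀ i m, MvPolynomial.coeff m (g i) ≠ 0 → m ∈ S i) ∧ ∀ i, homOp ν A k h i = g i + r i}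
  zero_mem' := ⟨0, 0, 0, MvPolynomial.isHomogeneous_zero _ _ _, MvPolynomial.isHomogeneous_zero _ _ _,
    fun i => MvPolynomial.isHomogeneous_zero _ _ _, by simp, fun i => by
      have := homOp_C_mul ν A 0 0 0 i
      simpa using this⟩
  add_mem' := by
    rintro r r' ⟨k, h, g, hk, hh, hg, hS, he⟩ ⟨k', h', g', hk', hh', hg', hS', he'⟩
    refine ⟨k + k', h + h', g + g', hk.add hk', hh.add hh', fun i => (hg i).add (hg' i), ?_,
      fun i => ?_⟩
    · intro i m hm
      by_contra hmS
      refine hm ?_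
      rw [Pi.add_apply, MvPolynomial.coeff_add, not_not.mp (mt (hS i m) hmS),
        not_not.mp (mt (hS' i m) hmS), add_zero]
    · rw [homOp_add, he, he', Pi.add_apply, Pi.add_apply]
      ring
  smul_mem' := by
    rintro c r ⟨k, h, g, hk, hh, hg, hS, he⟩
    refine ⟨MvPolynomial.C c * k, MvPolynomial.C c * h, fun i => MvPolynomial.C c * g i,
      hk.C_mul c, hh.C_mul c, fun i => (hg i).C_mul c, ?_, fun i => ?_⟩
    · intro i m hm
      refine hS i m fun h0 => hm ?_
      rw [MvPolynomial.coeff_C_mul, h0, mul_zero]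
    · rw [homOp_C_mul, he, Pi.smul_apply, MvPolynomial.smul_eq_C_mul]
      ring

/-- The monomial `z₁^a z₂^b` in the `i`-th component. -/
noncomputable def vecMonomial (i : Fin 2) (a b : ℕ) : Fin 2 → MvPolynomial (Fin 2) ℂ :=
  Pi.single i (MvPolynomial.X 0 ^ a * MvPolynomial.X 1 ^ b)

theorem X_pow_mul_X_pow_eq_monomial (a b : ℕ) :
    (MvPolynomial.X 0 ^ a * MvPolynomial.X 1 ^ b : MvPolynomial (Fin 2) ℂ)
      = MvPolynomial.monomial (Finsupp.single 0 a + Finsupp.single 1 b) 1 := by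
  rw [MvPolynomial.X_pow_eq_monomial, MvPolynomial.X_pow_eq_monomial, MvPolynomial.monomial_mul,
    one_mul]

theorem isHomogeneous_X_pow_mul_X_pow (a b : ℕ) :
    (MvPolynomial.X 0 ^ a * MvPolynomial.X 1 ^ b : MvPolynomial (Fin 2) ℂ).IsHomogeneous (a + b) :=
  (MvPolynomial.isHomogeneous_X_pow 0 a).mul (MvPolynomial.isHomogeneous_X_pow 1 b)

theorem homSolvable_of_vecMonomial_mem {ν : ℕ} {A : Matrix (Fin 2) (Fin 2) ℂ}
    {S : Fin 2 → Set (Fin 2 →₀ ℕ)}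
    (h : ∀ i a b, 2 ≤ a + b → vecMonomial i a b ∈ solvable ν A S (a + b)) :
    HomSolvable ν A S := by
  intro e he r hr
  have : r ∈ solvable ν A S e := by
    have hsum : r = ∑ i, ∑ m ∈ (r i).support, (r i).coeff m • vecMonomial i (m 0) (m 1) := by
      funext j
      have e1 : ∀ i, (∑ m ∈ (r i).support, (r i).coeff m • vecMonomial i (m 0) (m 1)) j
          = if i = j then r i else 0 := by
        intro i
        rw [Finset.sum_apply]
        split_ifs with hij
        · subst hij
          conv_rhs => rw [← MvPolynomial.support_sum_monomial_coeff (r i)]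
          refine Finset.sum_congr rfl fun m _ => ?_
          rw [Pi.smul_apply, vecMonomial, Pi.single_eq_same, MvPolynomial.smul_eq_C_mul,
            MvPolynomial.monomial_eq, Finsupp.prod_fintype _ _ (by simp), Fin.prod_univ_two]
        · refine Finset.sum_eq_zero fun m _ => ?_
          rw [Pi.smul_apply, vecMonomial, Pi.single_eq_of_ne (Ne.symm hij), smul_zero]
      rw [Finset.sum_apply]
      simp [e1]
    rw [hsum]
    refine Submodule.sum_mem _ fun i _ => Submodule.sum_mem _ fun m hm =>
      Submodule.smul_mem _ _ ?_
    have hm' : m 0 + m 1 = e := by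
      rw [← degree_fin_two]
      by_contra hne
      exact MvPolynomial.mem_support_iff.mp hm ((hr i).coeff_eq_zero hne)
    have := h i (m 0) (m 1) (by omega)
    rwa [hm'] at this
  exact this

/-- A permitted monomial costs nothing: with zero change of coordinates it is absorbed by `g`. -/
theorem vecMonomial_mem_of_mem {ν : ℕ} {A : Matrix (Fin 2) (Fin 2) ℂ}
    {R : Fin 2 → ℕ → ℕ → Prop} {i : Fin 2} {a b : ℕ} (h : R i a b) :
    vecMonomial i a b ∈ solvable ν A (fun i => {m | R i (m 0) (m 1)}) (a + b) := by
  refine ⟨0, 0, -vecMonomial i a b, MvPolynomial.isHomogeneous_zero _ _ _,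
    MvPolynomial.isHomogeneous_zero _ _ _, fun j => ?_, fun j m hm => ?_, fun j => ?_⟩
  · rw [Pi.neg_apply]
    refine MvPolynomial.IsHomogeneous.neg ?_
    rcases eq_or_ne j i with rfl | hji
    · rw [vecMonomial, Pi.single_eq_same]
      exact isHomogeneous_X_pow_mul_X_pow a b
    · rw [vecMonomial, Pi.single_eq_of_ne hji]
      exact MvPolynomial.isHomogeneous_zero _ _ _
  · rcases eq_or_ne j i with rfl | hji
    · rw [Pi.neg_apply, vecMonomial, Pi.single_eq_same, X_pow_mul_X_pow_eq_monomial,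
        MvPolynomial.coeff_neg, MvPolynomial.coeff_monomial] at hm
      split_ifs at hm with hmm
      · subst hmm
        simpa using h
      · simp at hm
    · rw [Pi.neg_apply, vecMonomial, Pi.single_eq_of_ne hji] at hm
      simp at hm
  · have := homOp_C_mul ν A 0 0 0 j
    simp only [map_zero, zero_mul] at this
    rw [this]
    simp

/-- The matrix is lower triangular because the linear part preserves `z₁ = 0`. The truncated
exponent `b - 1` is harmless, as its coefficient vanishes for `b = 0`. -/
theorem lieDeriv_monomial (α β γ : ℂ) (a b : ℕ) :
    lieDeriv !![α, 0; β, γ] (MvPolynomial.X 0 ^ a * MvPolynomial.X 1 ^ b)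
      = MvPolynomial.C (a * α + b * γ) * (MvPolynomial.X 0 ^ a * MvPolynomial.X 1 ^ b)
        + MvPolynomial.C (b * β) * (MvPolynomial.X 0 ^ (a + 1) * MvPolynomial.X 1 ^ (b - 1)) := by
  have h0 : MvPolynomial.pderiv 0 (MvPolynomial.X 0 ^ a * MvPolynomial.X 1 ^ b :
      MvPolynomial (Fin 2) ℂ)
      = (a : MvPolynomial (Fin 2) ℂ) * MvPolynomial.X 0 ^ (a - 1) * MvPolynomial.X 1 ^ b := by
    simp [MvPolynomial.pderiv_X]
    ring
  have h1 : MvPolynomial.pderiv 1 (MvPolynomial.X 0 ^ a * MvPolynomial.X 1 ^ b :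
      MvPolynomial (Fin 2) ℂ)
      = (b : MvPolynomial (Fin 2) ℂ) * MvPolynomial.X 0 ^ a * MvPolynomial.X 1 ^ (b - 1) := by
    simp [MvPolynomial.pderiv_X]
    ring
  rw [lieDeriv, h0, h1]
  rcases a with _ | a <;> rcases b with _ | b <;> simp [polyAct] <;> ring

/-- The value of the operator at `k = z₁^a z₂^b`, `h = 0`. The term `ν k A z`, coming from the
factor `χ₁^ν`, is what shifts the resonance of the first component by `ν` and what feeds monomials
into the second component. -/
theorem homOp_left_mem {ν : ℕ} (α β γ : ℂ) {S : Fin 2 → Set (Fin 2 →₀ ℕ)} (a b : ℕ) :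
    (α * (ν - a) - b * γ) • vecMonomial 0 (a + 1) b - (b * β) • vecMonomial 0 (a + 2) (b - 1)
      + ((ν + 1) * β) • vecMonomial 1 (a + 1) b + (ν * γ) • vecMonomial 1 a (b + 1)
      ∈ solvable ν !![α, 0; β, γ] S (a + b + 1) := by
  refine ⟨MvPolynomial.X 0 ^ a * MvPolynomial.X 1 ^ b, 0, 0, isHomogeneous_X_pow_mul_X_pow a b,
    MvPolynomial.isHomogeneous_zero _ _ _, fun i => MvPolynomial.isHomogeneous_zero _ _ _, by simp,
    fun i => ?_⟩
  have e : MvPolynomial.X 0 * (MvPolynomial.X 0 ^ a * MvPolynomial.X 1 ^ b : MvPolynomial (Fin 2) ℂ)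
      = MvPolynomial.X 0 ^ (a + 1) * MvPolynomial.X 1 ^ b := by ring
  rw [homOp, e]
  fin_cases i
  · simp [polyAct, vecMonomial, lieDeriv_monomial, MvPolynomial.smul_eq_C_mul]
    ring
  · simp [polyAct, vecMonomial, lieDeriv, MvPolynomial.smul_eq_C_mul]
    ring

/-- The value of the operator at `k = 0`, `h = z₁^a z₂^b`. It does not touch the first component, so
second components can be solved first and then disregarded. -/
theorem homOp_right_mem {ν : ℕ} (α β γ : ℂ) {S : Fin 2 → Set (Fin 2 →₀ ℕ)} (a b : ℕ) :
    (γ - a * α - b * γ) • vecMonomial 1 a b - (b * β) • vecMonomial 1 (a + 1) (b - 1)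
      ∈ solvable ν !![α, 0; β, γ] S (a + b) := by
  refine ⟨0, MvPolynomial.X 0 ^ a * MvPolynomial.X 1 ^ b, 0, MvPolynomial.isHomogeneous_zero _ _ _,
    isHomogeneous_X_pow_mul_X_pow a b, fun i => MvPolynomial.isHomogeneous_zero _ _ _, by simp,
    fun i => ?_⟩
  rw [homOp]
  fin_cases i
  · simp [polyAct, vecMonomial, lieDeriv]
  · simp [polyAct, vecMonomial, lieDeriv_monomial, MvPolynomial.smul_eq_C_mul]
    ring

theorem mem_of_smul_mem {V : Submodule ℂ (Fin 2 → MvPolynomial (Fin 2) ℂ)} {c : ℂ} (hc : c ≠ 0)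
    {v : Fin 2 → MvPolynomial (Fin 2) ℂ} (h : c • v ∈ V) : v ∈ V :=
  (Submodule.smul_mem_iff V hc).mp h

/-- Monomials are eigenvectors up to the coupling between components. The condition `l * (ν - a) =
b` is the resonance of the first component. A resonance of the second component involving `z₂`
satisfies `l * a + b = 0` and can be traded for a first-component monomial, which accounts for the
second alternative in `hR0`; a resonance without `z₂` has to stay, by `hR1`. -/
theorem homSolvable_diagonal {ν : ℕ} (hν : 1 ≤ ν) {l : ℂ} {R : Fin 2 → ℕ → ℕ → Prop}
    (hR : ∀ b, 2 ≤ b → R 0 0 b)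
    (hR0 : ∀ a b : ℕ, 1 ≤ a + b → l * (ν - a) = b ∨ l * a + b = 0 → R 0 (a + 1) b)
    (hR1 : ∀ d : ℕ, 2 ≤ d → l * d = 1 → R 1 d 0) :
    HomSolvable ν !![l, 0; 0, 1] (fun i => {m | R i (m 0) (m 1)}) := by
  have hν0 : (ν : ℂ) ≠ 0 := by exact_mod_cast (by omega : ν ≠ 0)
  have h1 : ∀ a b, 2 ≤ a + b → vecMonomial 1 a b
      ∈ solvable ν !![l, 0; 0, 1] (fun i => {m | R i (m 0) (m 1)}) (a + b) := by
    intro a b hab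
    by_cases hc : (1 - a * l - b * 1 : ℂ) = 0
    · rcases b with _ | b
      · refine vecMonomial_mem_of_mem (hR1 a (by omega) ?_)
        push_cast at hc
        linear_combination -hc
      · push_cast at hc
        have hres : l * a + b = 0 := by linear_combination -hc
        -- The change with `k = z₁^a z₂^b` produces `ν z₁^a z₂^(b+1)` in the second component, with
        -- `ν ≠ 0`, at the cost of a permitted monomial in the first.
        have := homOp_left_mem (ν := ν) (S := fun i => {m | R i (m 0) (m 1)}) l 0 1 a b
        simp only [mul_zero, zero_smul, sub_zero, add_zero, mul_one] at this
        have h2 := Submodule.smul_mem _ (l * (ν - a) - b : ℂ) (vecMonomial_mem_of_mem (ν := ν)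
          (A := !![l, 0; 0, 1]) (hR0 a b (by omega) (Or.inr hres)))
        rw [show a + 1 + b = a + b + 1 by omega] at h2
        have h3 := Submodule.sub_mem _ this h2
        rw [add_sub_cancel_left] at h3
        exact mem_of_smul_mem hν0 h3
    · have := homOp_right_mem (ν := ν) (S := fun i => {m | R i (m 0) (m 1)}) l 0 1 a b
      simp only [mul_zero, zero_smul, sub_zero] at this
      exact mem_of_smul_mem hc this
  refine homSolvable_of_vecMonomial_mem fun i a b hab => ?_
  fin_cases i
  · rcases a with _ | a
    · exact vecMonomial_mem_of_mem (hR b (by omega))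
    · by_cases hc : (l * (ν - a) - b : ℂ) = 0
      · exact vecMonomial_mem_of_mem (hR0 a b (by omega) (Or.inl (sub_eq_zero.mp hc)))
      · have := homOp_left_mem (ν := ν) (S := fun i => {m | R i (m 0) (m 1)}) l 0 1 a b
        simp only [mul_zero, zero_smul, sub_zero, add_zero, mul_one] at this
        have h2 := Submodule.smul_mem _ (ν : ℂ) (h1 a (b + 1) (by omega))
        have h3 := Submodule.sub_mem _ this h2
        rw [add_sub_cancel_right, show a + b + 1 = a + 1 + b by omega] at h3
        exact mem_of_smul_mem hc h3
  · exact h1 a b hab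

/-- The nilpotent part lowers the power of `z₂`, so the operator is triangular and induction on `b`
applies. In the second component the diagonal entries `1 - a - b` never vanish. In the first they
vanish exactly when `a + b = ν`, and there the off-diagonal entries are inverted instead. -/
theorem homSolvable_jordan_one {ν : ℕ} {R : Fin 2 → ℕ → ℕ → Prop}
    (hR : ∀ b, 2 ≤ b → R 0 0 b) (hR0 : R 0 1 ν) :
    HomSolvable ν !![1, 0; 1, 1] (fun i => {m | R i (m 0) (m 1)}) := by
  have h1 : ∀ b a, 2 ≤ a + b → vecMonomial 1 a b
      ∈ solvable ν !![1, 0; 1, 1] (fun i => {m | R i (m 0) (m 1)}) (a + b) := by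
    intro b
    induction b with
    | zero =>
      intro a hab
      have := homOp_right_mem (ν := ν) (S := fun i => {m | R i (m 0) (m 1)}) 1 1 1 a 0
      simp only [Nat.cast_zero, zero_smul, sub_zero, mul_one] at this
      refine mem_of_smul_mem ?_ this
      rw [sub_ne_zero]
      exact_mod_cast (by omega : 1 ≠ a)
    | succ b ih =>
      intro a hab
      have h2 := homOp_right_mem (ν := ν) (S := fun i => {m | R i (m 0) (m 1)}) 1 1 1 a (b + 1)
      have h3 := ih (a + 1) (by omega)
      rw [show a + 1 + b = a + (b + 1) by omega] at h3
      have h4 := Submodule.add_mem _ h2 (Submodule.smul_mem _ (((b + 1 : ℕ) : ℂ) * 1) h3)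
      rw [Nat.add_sub_cancel, sub_add_cancel] at h4
      refine mem_of_smul_mem ?_ h4
      have : ((a + b : ℕ) : ℂ) ≠ 0 := by exact_mod_cast (by omega : a + b ≠ 0)
      intro h0
      refine this ?_
      push_cast at h0 ⊢
      linear_combination -h0
  have hleft : ∀ a b, 1 ≤ a + b → (ν - a - b : ℂ) • vecMonomial 0 (a + 1) b
      - (b : ℂ) • vecMonomial 0 (a + 2) (b - 1)
      ∈ solvable ν !![1, 0; 1, 1] (fun i => {m | R i (m 0) (m 1)}) (a + b + 1) := by
    intro a b hab
    have h2 := homOp_left_mem (ν := ν) (S := fun i => {m | R i (m 0) (m 1)}) 1 1 1 a b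
    have h3 := Submodule.smul_mem _ ((ν + 1) * 1 : ℂ) (h1 b (a + 1) (by omega))
    have h4 := Submodule.smul_mem _ (ν * 1 : ℂ) (h1 (b + 1) a (by omega))
    rw [show a + 1 + b = a + b + 1 by omega] at h3
    have := Submodule.sub_mem _ (Submodule.sub_mem _ h2 h4) h3
    rw [add_sub_cancel_right, add_sub_cancel_right] at this
    simpa only [one_mul, mul_one] using this
  have h0 : ∀ b a, 1 ≤ a + b → vecMonomial 0 (a + 1) b
      ∈ solvable ν !![1, 0; 1, 1] (fun i => {m | R i (m 0) (m 1)}) (a + 1 + b) := by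
    intro b
    induction b with
    | zero =>
      intro a hab
      rcases eq_or_ne a ν with rfl | hne
      · obtain ⟨a, rfl⟩ := Nat.exists_eq_add_of_le' hab
        have := hleft a 1 (by omega)
        push_cast at this
        simp only [show (a + 1 - a - 1 : ℂ) = 0 by ring, zero_smul, zero_sub, one_smul,
          Submodule.neg_mem_iff] at this
        exact this
      · have := hleft a 0 (by omega)
        simp only [Nat.cast_zero, sub_zero, zero_smul] at this
        exact mem_of_smul_mem (sub_ne_zero.mpr (by exact_mod_cast hne.symm)) this
    | succ b ih =>
      intro a hab
      -- With zero diagonal entry, `z₁^(a+1) z₂^b` is reached as the off-diagonal term of its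
      -- neighbour with one more `z₂`. Such terms always contain `z₁²`, so `z₁ z₂^ν` is the only
      -- monomial missed.
      by_cases hν : a + (b + 1) = ν
      · rcases a with _ | a
        · rw [show b + 1 = ν by omega]
          exact vecMonomial_mem_of_mem hR0
        · subst hν
          have := hleft a (b + 1 + 1) (by omega)
          push_cast at this
          simp only [show (a + 1 + (b + 1) - a - (b + 1 + 1) : ℂ) = 0 by ring, zero_smul, zero_sub,
            Submodule.neg_mem_iff] at this
          rw [show a + (b + 1 + 1) + 1 = a + 1 + 1 + (b + 1) by omega] at this
          refine mem_of_smul_mem ?_ this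
          exact_mod_cast (b + 1).succ_ne_zero
      · have h2 := hleft a (b + 1) (by omega)
        have h3 := ih (a + 1) (by omega)
        rw [show a + 1 + 1 + b = a + (b + 1) + 1 by omega] at h3
        have h4 := Submodule.add_mem _ h2 (Submodule.smul_mem _ ((b + 1 : ℕ) : ℂ) h3)
        rw [Nat.add_sub_cancel, sub_add_cancel,
          show a + (b + 1) + 1 = a + 1 + (b + 1) by omega] at h4
        refine mem_of_smul_mem ?_ h4
        rw [sub_sub, sub_ne_zero]
        exact_mod_cast Ne.symm hν
  refine homSolvable_of_vecMonomial_mem fun i a b hab => ?_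
  fin_cases i
  · rcases a with _ | a
    · exact vecMonomial_mem_of_mem (hR b (by omega))
    · exact h0 b a (by omega)
  · exact h1 b a hab

/-- The operator is diagonal here, with eigenvalue `ν - a` on `z₁^(a+1) z₂^b` in the first component
and `-a` on `z₁^a z₂^b` in the second. -/
theorem homSolvable_star_two {ν : ℕ} {R : Fin 2 → ℕ → ℕ → Prop}
    (hR : ∀ b, 2 ≤ b → R 0 0 b) (hR0 : ∀ b, R 0 (ν + 1) b) (hR1 : ∀ b, 2 ≤ b → R 1 0 b) :
    HomSolvable ν !![1, 0; 0, 0] (fun i => {m | R i (m 0) (m 1)}) := by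
  refine homSolvable_of_vecMonomial_mem fun i a b hab => ?_
  fin_cases i
  · rcases a with _ | a
    · exact vecMonomial_mem_of_mem (hR b (by omega))
    · rcases eq_or_ne a ν with rfl | hne
      · exact vecMonomial_mem_of_mem (hR0 b)
      · have := homOp_left_mem (ν := ν) (S := fun i => {m | R i (m 0) (m 1)}) 1 0 0 a b
        simp only [mul_zero, zero_smul, sub_zero, add_zero, one_mul,
          show a + b + 1 = a + 1 + b by omega] at this
        refine mem_of_smul_mem ?_ this
        rw [sub_ne_zero]
        exact_mod_cast hne.symm
  · rcases a with _ | a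
    · exact vecMonomial_mem_of_mem (hR1 b (by omega))
    · have := homOp_right_mem (ν := ν) (S := fun i => {m | R i (m 0) (m 1)}) 1 0 0 (a + 1) b
      simp only [mul_zero, zero_smul, sub_zero, zero_sub, mul_one] at this
      exact mem_of_smul_mem (neg_ne_zero.mpr (by exact_mod_cast a.succ_ne_zero)) this

/-- Only the nilpotent shift survives. It reaches every second component divisible by `z₁` and,
modulo second components, every first component divisible by `z₁²`. -/
theorem homSolvable_jordan_zero {ν : ℕ} {R : Fin 2 → ℕ → ℕ → Prop}
    (hR : ∀ b, 2 ≤ b → R 0 0 b) (hR0 : ∀ b, 1 ≤ b → R 0 1 b) (hR1 : ∀ b, 2 ≤ b → R 1 0 b) :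
    HomSolvable ν !![0, 0; 1, 0] (fun i => {m | R i (m 0) (m 1)}) := by
  have h1 : ∀ a b, 2 ≤ a + b → vecMonomial 1 a b
      ∈ solvable ν !![0, 0; 1, 0] (fun i => {m | R i (m 0) (m 1)}) (a + b) := by
    intro a b hab
    rcases a with _ | a
    · exact vecMonomial_mem_of_mem (hR1 b (by omega))
    · have := homOp_right_mem (ν := ν) (S := fun i => {m | R i (m 0) (m 1)}) 0 1 0 a (b + 1)
      simp only [mul_zero, zero_smul, sub_zero, zero_sub, mul_one, Nat.add_sub_cancel,
        show a + (b + 1) = a + 1 + b by omega, ← neg_smul] at this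
      exact mem_of_smul_mem (neg_ne_zero.mpr (by exact_mod_cast b.succ_ne_zero)) this
  refine homSolvable_of_vecMonomial_mem fun i a b hab => ?_
  fin_cases i
  · rcases a with _ | _ | a
    · exact vecMonomial_mem_of_mem (hR b (by omega))
    · exact vecMonomial_mem_of_mem (hR0 b (by omega))
    · have h2 := homOp_left_mem (ν := ν) (S := fun i => {m | R i (m 0) (m 1)}) 0 1 0 a (b + 1)
      have h3 := Submodule.smul_mem _ ((ν + 1) * 1 : ℂ) (h1 (a + 1) (b + 1) (by omega))
      rw [show a + 1 + (b + 1) = a + (b + 1) + 1 by omega] at h3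
      have := Submodule.sub_mem _ h2 h3
      simp only [mul_zero, zero_mul, zero_smul, sub_zero, zero_sub, mul_one, Nat.add_sub_cancel,
        add_zero, add_sub_cancel_right, show a + (b + 1) + 1 = a + 1 + 1 + b by omega,
        ← neg_smul] at this
      exact mem_of_smul_mem (neg_ne_zero.mpr (by exact_mod_cast b.succ_ne_zero)) this
  · exact h1 a b hab

/-! ### Linear changes of coordinates -/

/-- The linear map `L = (a z₁, c z₁ + d z₂)` turns `A` into `a^ν L⁻¹ A L`, the factor `a^ν` coming
from `z₁^ν`. The hypotheses `hl`, `hm`, `hn` express this with `L` moved to the left, to avoid its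
inverse. A change tangent to the identity then finishes, and the conjugacy is the composite of the
two. -/
theorem exists_conjugate_of_homSolvable {ν : ℕ} (hν : 1 ≤ ν) {α β γ a c d l n m : ℂ}
    (ha : a ≠ 0) (hd : d ≠ 0) (hl : l = a ^ ν * α) (hm : m = a ^ ν * γ)
    (hn : c * l + d * n = a ^ ν * (β * a + γ * c)) {S : Fin 2 → Set (Fin 2 →₀ ℕ)}
    (hS : HomSolvable ν !![l, 0; n, m] S) {G : FormalMap}
    (hG : ∀ i, G i - (polyAct !![α, 0; β, γ] MvPolynomial.X i : MvPowerSeries (Fin 2) ℂ)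
      ∈ filt 0 2) :
    ∃ χ H : FormalMap, IsFormalChange χ ∧
      (∀ i, H i - (polyAct !![l, 0; n, m] MvPolynomial.X i : MvPowerSeries (Fin 2) ℂ)
        ∈ filt 0 2) ∧
      (∀ i m, 2 ≤ m 0 + m 1 → MvPowerSeries.coeff m (H i) ≠ 0 → m ∈ S i) ∧
      (contactMap ν G).comp χ = χ.comp (contactMap ν H) := by
  set L : FormalMap := ![cst a * Z1, cst c * Z1 + cst d * Z2] with hL
  have hL1 : ∀ i, L i ∈ filt 0 1 := by
    intro i
    fin_cases i
    · exact Ideal.mul_mem_left _ _ (X_mem_filt 0)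
    · exact Ideal.add_mem _ (Ideal.mul_mem_left _ _ (X_mem_filt 0))
        (Ideal.mul_mem_left _ _ (X_mem_filt 1))
  have hLs : MvPowerSeries.HasSubst L := hasSubst_of_mem_filt hL1
  -- `T = a^ν L⁻¹ (G ∘ L)`, that is, `z + z₁^ν T` is the conjugate of `z + z₁^ν G` by `L`.
  set T : FormalMap := ![cst (a⁻¹ * a ^ ν) * MvPowerSeries.subst L (G 0),
    cst d⁻¹ * (cst (a ^ ν) * MvPowerSeries.subst L (G 1)
      - cst (c * a⁻¹ * a ^ ν) * MvPowerSeries.subst L (G 0))] with hT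
  have hLG : ∀ i, MvPowerSeries.subst L (G i)
      - (cst (!![α, 0; β, γ] i 0) * L 0 + cst (!![α, 0; β, γ] i 1) * L 1) ∈ filt 0 2 := by
    intro i
    have := subst_mem_filt hL1 (hG i)
    rwa [MvPowerSeries.subst_sub hLs, subst_polyAct_X hLs] at this
  have hT2 : ∀ i, T i - (polyAct !![l, 0; n, m] MvPolynomial.X i : MvPowerSeries (Fin 2) ℂ)
      ∈ filt 0 2 := by
    have h0 := hLG 0
    have h1 := hLG 1
    simp only [Matrix.of_apply, Matrix.cons_val', Matrix.cons_val_zero, Matrix.cons_val_one,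
      Matrix.cons_val_fin_one, hL] at h0 h1
    rw [← hL] at h0 h1
    intro i
    rw [coe_polyAct_X]
    fin_cases i
    · convert Ideal.mul_mem_left _ (cst (a⁻¹ * a ^ ν)) h0 using 1
      have e1 : cst (a⁻¹ * a ^ ν) * (cst α * (cst a * Z1)) = cst l * Z1 := by
        rw [← mul_assoc, ← mul_assoc, ← map_mul, ← map_mul, hl]
        congr 2
        field_simp
      simp only [Fin.zero_eta, hT, Matrix.cons_val_zero, Matrix.of_apply, Matrix.cons_val',
        Matrix.cons_val_one, Matrix.cons_val_fin_one, map_zero, zero_mul, add_zero]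
      rw [mul_sub, e1]
    · have := Ideal.mul_mem_left _ (cst d⁻¹) (Ideal.sub_mem _
        (Ideal.mul_mem_left _ (cst (a ^ ν)) h1) (Ideal.mul_mem_left _ (cst (c * a⁻¹ * a ^ ν)) h0))
      convert this using 1
      have e1 : cst d⁻¹ * (cst (a ^ ν) * (cst β * (cst a * Z1) + cst γ * (cst c * Z1 + cst d * Z2))
          - cst (c * a⁻¹ * a ^ ν) * (cst α * (cst a * Z1))) = cst n * Z1 + cst m * Z2 := by
        have f1 : n = d⁻¹ * (a ^ ν * (β * a + γ * c) - c * a⁻¹ * a ^ ν * (α * a)) := by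
          field_simp
          linear_combination hn + c * (-hl)
        have f2 : m = d⁻¹ * (a ^ ν * (γ * d)) := by
          rw [hm]
          field_simp
        rw [f1, f2]
        simp only [cst, map_mul, map_sub, map_add]
        ring
      simp only [Fin.mk_one, hT, Matrix.cons_val_zero, Matrix.of_apply, Matrix.cons_val',
        Matrix.cons_val_one, Matrix.cons_val_fin_one, map_zero, zero_mul, add_zero]
      rw [← e1]
      ring
  obtain ⟨K, w, H, hK, hw, hH, hsupp, hdef⟩ := exists_formal_solution hν hS hT2
  set χ : FormalMap := ![MvPowerSeries.X 0 * K, w] with hχdef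
  have hχ1 : ∀ i, χ i ∈ filt 0 1 := changed_mem hw
  have hχ : MvPowerSeries.HasSubst χ := hasSubst_of_mem_filt hχ1
  have hF : MvPowerSeries.HasSubst (contactMap ν H) := hasSubst_of_mem_filt
    (contactMap_mem fun i => mem_filt_zero_one_of_sub_polyAct (hH i))
  set χt : FormalMap := ![cst a * χ 0, cst c * χ 0 + cst d * χ 1] with hχt
  have hχtL : χt = fun i => MvPowerSeries.subst χ (L i) := by
    funext i
    fin_cases i
    · simp [hχt, hL, MvPowerSeries.subst_mul hχ, MvPowerSeries.subst_X hχ]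
    · simp [hχt, hL, MvPowerSeries.subst_mul hχ, MvPowerSeries.subst_X hχ,
        MvPowerSeries.subst_add hχ]
  have hχt1 : ∀ i, χt i ∈ filt 0 1 := by
    intro i
    rw [hχtL]
    exact subst_mem_filt hχ1 (hL1 i)
  have hχts : MvPowerSeries.HasSubst χt := hasSubst_of_mem_filt hχt1
  have hsub : ∀ i, MvPowerSeries.subst χt (G i)
      = MvPowerSeries.subst χ (MvPowerSeries.subst L (G i)) := by
    intro i
    rw [hχtL, MvPowerSeries.subst_comp_subst_apply hLs hχ]
  have hd0 := hdef 0
  have hd1 := hdef 1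
  simp only [defect] at hd0 hd1
  rw [sub_eq_zero, subst_contactMap hχ] at hd0 hd1
  refine ⟨χt, H, ⟨fun i => mem_filt_zero_one.mp (hχt1 i), ?_, ?_⟩, hH, hsupp, ?_⟩
  · have k0 := changed_sub_X_mem hK hw 0
    have k1 := changed_sub_X_mem hK hw 1
    rw [← hχdef] at k0 k1
    have c0 : ∀ j, MvPowerSeries.coeff (Finsupp.single j 1) (χ 0)
        = MvPowerSeries.coeff (Finsupp.single j 1) (MvPowerSeries.X 0) := fun j => by
      have := k0 (Finsupp.single j 1) (Or.inr (by fin_cases j <;> simp))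
      rwa [map_sub, sub_eq_zero] at this
    have c1 : ∀ j, MvPowerSeries.coeff (Finsupp.single j 1) (χ 1)
        = MvPowerSeries.coeff (Finsupp.single j 1) (MvPowerSeries.X 1) := fun j => by
      have := k1 (Finsupp.single j 1) (Or.inr (by fin_cases j <;> simp))
      rwa [map_sub, sub_eq_zero] at this
    rw [Matrix.det_fin_two]
    simp only [FormalMap.linMatrix, Matrix.of_apply, hχt, Matrix.cons_val_zero,
      Matrix.cons_val_one, Matrix.cons_val_fin_one, map_add, MvPowerSeries.coeff_C_mul, c0, c1,
      MvPowerSeries.coeff_X]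
    simp [Finsupp.single_left_inj, ha, hd]
  · rw [hχt, hχdef]
    exact ⟨cst a * K, by simp only [Matrix.cons_val_zero]; ring⟩
  · funext i
    simp only [FormalMap.comp]
    rw [subst_contactMap hχts]
    fin_cases i
    · simp only [Fin.zero_eta, hsub]
      simp only [hχt, hT, Matrix.cons_val_zero] at hd0 ⊢
      rw [MvPowerSeries.subst_mul hF, MvPowerSeries.subst_C, ← hd0, MvPowerSeries.subst_mul hχ,
        MvPowerSeries.subst_C]
      have : (MvPowerSeries.C (a ^ ν) : MvPowerSeries (Fin 2) ℂ)
          = MvPowerSeries.C a * MvPowerSeries.C (a⁻¹ * a ^ ν) := by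
        rw [← map_mul]
        congr 1
        field_simp
      rw [mul_pow, ← map_pow, this]
      ring
    · simp only [Fin.mk_one, hsub]
      simp only [hχt, hT, Matrix.cons_val_zero, Matrix.cons_val_one, Matrix.cons_val_fin_one]
        at hd0 hd1 ⊢
      rw [MvPowerSeries.subst_add hF, MvPowerSeries.subst_mul hF, MvPowerSeries.subst_mul hF,
        MvPowerSeries.subst_C, MvPowerSeries.subst_C, ← hd0, ← hd1, MvPowerSeries.subst_mul hχ,
        MvPowerSeries.subst_mul hχ, MvPowerSeries.subst_sub hχ, MvPowerSeries.subst_mul hχ,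
        MvPowerSeries.subst_mul hχ, MvPowerSeries.subst_C, MvPowerSeries.subst_C,
        MvPowerSeries.subst_C, MvPowerSeries.subst_C]
      have e1 : cst d * cst d⁻¹ = 1 := by
        rw [← map_mul, mul_inv_cancel₀ hd, map_one]
      have e2 : cst c * cst (a⁻¹ * a ^ ν) = cst (c * a⁻¹ * a ^ ν) := by
        rw [← map_mul, mul_assoc]
      rw [mul_pow, ← map_pow]
      linear_combination (-(χ 0 ^ ν * (cst (a ^ ν) * MvPowerSeries.subst χ (MvPowerSeries.subst L (G 1))
        - cst (c * a⁻¹ * a ^ ν) * MvPowerSeries.subst χ (MvPowerSeries.subst L (G 0))))) * e1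
        - χ 0 ^ ν * MvPowerSeries.subst χ (MvPowerSeries.subst L (G 0)) * e2

/-! ### Splitting power series along rays of exponents -/

theorem coeff_X_pow_mul_X_pow (a b : ℕ) (m : Fin 2 →₀ ℕ) :
    MvPowerSeries.coeff m (Z1 ^ a * Z2 ^ b) = if m 0 = a ∧ m 1 = b then 1 else 0 := by
  classical
  rw [MvPowerSeries.X_pow_eq, MvPowerSeries.X_pow_eq, MvPowerSeries.monomial_mul_monomial,
    MvPowerSeries.coeff_monomial, one_mul]
  refine if_congr ?_ rfl rfl
  constructor
  · rintro rfl
    simp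
  · rintro ⟨rfl, rfl⟩
    ext i
    fin_cases i <;> simp

/-- The series `z₁^p z₂^q g(z₁^r z₂^s)`. -/
noncomputable def raySeries (p q r s : ℕ) (g : PowerSeries ℂ) : MvPowerSeries (Fin 2) ℂ :=
  Z1 ^ p * Z2 ^ q * evalAt g (Z1 ^ r * Z2 ^ s)

theorem coeff_evalAt_monomial {r s : ℕ} (hrs : r + s ≠ 0) (g : PowerSeries ℂ)
    (m : Fin 2 →₀ ℕ) : MvPowerSeries.coeff m (evalAt g (Z1 ^ r * Z2 ^ s))
      = ∑ᶠ n, if m 0 = r * n ∧ m 1 = s * n then PowerSeries.coeff n g else 0 := by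
  have hs : PowerSeries.HasSubst (Z1 ^ r * Z2 ^ s) := by
    refine PowerSeries.HasSubst.of_constantCoeff_zero ?_
    rw [← MvPowerSeries.coeff_zero_eq_constantCoeff_apply, coeff_X_pow_mul_X_pow, if_neg]
    simp
    omega
  rw [evalAt, PowerSeries.coeff_subst hs]
  refine finsum_congr fun n => ?_
  rw [mul_pow, ← pow_mul, ← pow_mul, coeff_X_pow_mul_X_pow, smul_eq_mul, mul_ite, mul_one,
    mul_zero]

/-- The condition `r + s ≠ 0` makes the step of the ray nonzero, so each exponent is met by at most
one index. -/
theorem coeff_raySeries_of_eq {p q r s : ℕ} (hrs : r + s ≠ 0) (g : PowerSeries ℂ)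
    {m : Fin 2 →₀ ℕ} {n : ℕ} (h0 : m 0 = p + r * n) (h1 : m 1 = q + s * n) :
    MvPowerSeries.coeff m (raySeries p q r s g) = PowerSeries.coeff n g := by
  obtain ⟨m', hm', h0', h1'⟩ : ∃ m' : Fin 2 →₀ ℕ,
      m = (Finsupp.single 0 p + Finsupp.single 1 q) + m' ∧ m' 0 = r * n ∧ m' 1 = s * n := by
    refine ⟨Finsupp.single 0 (r * n) + Finsupp.single 1 (s * n), ?_, by simp, by simp⟩
    ext i
    fin_cases i <;> simp [h0, h1]
  rw [raySeries, MvPowerSeries.X_pow_eq, MvPowerSeries.X_pow_eq,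
    MvPowerSeries.monomial_mul_monomial, hm', MvPowerSeries.coeff_add_monomial_mul, one_mul,
    one_mul, coeff_evalAt_monomial hrs,
    finsum_eq_single _ n, if_pos ⟨h0', h1'⟩]
  intro k hk
  rw [if_neg]
  rintro ⟨e0, e1⟩
  refine hk ?_
  rw [h0'] at e0
  rw [h1'] at e1
  rcases Nat.eq_zero_or_pos r with hr | hr
  · exact (Nat.eq_of_mul_eq_mul_left (by omega) e1).symm
  · exact (Nat.eq_of_mul_eq_mul_left hr e0).symm

theorem coeff_raySeries_of_ne {p q r s : ℕ} (hrs : r + s ≠ 0) (g : PowerSeries ℂ)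
    {m : Fin 2 →₀ ℕ} (h : ∀ n, ¬ (m 0 = p + r * n ∧ m 1 = q + s * n)) :
    MvPowerSeries.coeff m (raySeries p q r s g) = 0 := by
  classical
  rw [raySeries, MvPowerSeries.X_pow_eq, MvPowerSeries.X_pow_eq,
    MvPowerSeries.monomial_mul_monomial, MvPowerSeries.coeff_monomial_mul]
  split_ifs with hle
  · rw [one_mul, one_mul,
      coeff_evalAt_monomial hrs, finsum_eq_zero_of_forall_eq_zero]
    intro n
    rw [if_neg]
    rintro ⟨e0, e1⟩
    have l0 := hle 0
    have l1 := hle 1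
    simp at e0 e1 l0 l1
    exact h n ⟨by omega, by omega⟩
  · rfl

/-- The exponent of `z₁^a z₂^b`. -/
noncomputable def expo (a b : ℕ) : Fin 2 →₀ ℕ := Finsupp.single 0 a + Finsupp.single 1 b

theorem expo_zero (a b : ℕ) : expo a b 0 = a := by simp [expo]

theorem expo_one (a b : ℕ) : expo a b 1 = b := by simp [expo]

theorem eq_expo (m : Fin 2 →₀ ℕ) : m = expo (m 0) (m 1) := by
  ext i
  fin_cases i <;> simp [expo]

/-- The part of `φ` supported on the ray `(p, q) + ℕ (r, s)`, as a series in one variable. -/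
noncomputable def rayCoeff (p q r s : ℕ) (φ : MvPowerSeries (Fin 2) ℂ) : PowerSeries ℂ :=
  PowerSeries.mk fun n => MvPowerSeries.coeff (expo (p + r * n) (q + s * n)) φ

/-- Peeling lemma: subtracting the ray part only removes exponents. Applied repeatedly to a series
with known support, it ends with an empty support, hence with an explicit formula. -/
theorem coeff_sub_raySeries {p q r s : ℕ} (hrs : r + s ≠ 0) {φ : MvPowerSeries (Fin 2) ℂ}
    {m : Fin 2 →₀ ℕ}
    (h : MvPowerSeries.coeff m (φ - raySeries p q r s (rayCoeff p q r s φ)) ≠ 0) :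
    MvPowerSeries.coeff m φ ≠ 0 ∧ ∀ n, ¬ (m 0 = p + r * n ∧ m 1 = q + s * n) := by
  rw [map_sub] at h
  have hn : ∀ n, ¬ (m 0 = p + r * n ∧ m 1 = q + s * n) := by
    rintro n ⟨h0, h1⟩
    refine h ?_
    rw [coeff_raySeries_of_eq hrs _ h0 h1, rayCoeff, PowerSeries.coeff_mk, ← h0, ← h1, ← eq_expo,
      sub_self]
  refine ⟨?_, hn⟩
  rwa [coeff_raySeries_of_ne hrs _ hn, sub_zero] at h

theorem coeff_sub_monomial {a b : ℕ} {φ : MvPowerSeries (Fin 2) ℂ} {m : Fin 2 →₀ ℕ}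
    (h : MvPowerSeries.coeff m
      (φ - cst (MvPowerSeries.coeff (expo a b) φ) * (Z1 ^ a * Z2 ^ b)) ≠ 0) :
    MvPowerSeries.coeff m φ ≠ 0 ∧ ¬ (m 0 = a ∧ m 1 = b) := by
  rw [map_sub, MvPowerSeries.coeff_C_mul, coeff_X_pow_mul_X_pow] at h
  split_ifs at h with hm
  · refine absurd ?_ h
    rw [← hm.1, ← hm.2, ← eq_expo, mul_one, sub_self]
  · rw [mul_zero, sub_zero] at h
    exact ⟨h, hm⟩

theorem coeff_laurentTerm {ν q s : ℕ} (p : Polynomial ℂ) {m : Fin 2 →₀ ℕ} :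
    MvPowerSeries.coeff m (laurentTerm ν q s p)
      = ∑ l ∈ Finset.range (ν / q + 1),
        if m 0 = ν + 1 - q * l ∧ m 1 = s * l then p.coeff l else 0 := by
  rw [laurentTerm, map_sum]
  refine Finset.sum_congr rfl fun l _ => ?_
  rw [mul_assoc, MvPowerSeries.coeff_C_mul, coeff_X_pow_mul_X_pow, mul_ite, mul_one, mul_zero]

/-- The same peeling for a finite segment of exponents; `1 ≤ s` keeps its points distinct. -/
theorem exists_sub_laurentTerm {s : ℕ} (ν q : ℕ) (hs : 1 ≤ s) (φ : MvPowerSeries (Fin 2) ℂ) :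
    ∃ p : Polynomial ℂ, p.natDegree ≤ ν / q ∧ ∀ m : Fin 2 →₀ ℕ,
      MvPowerSeries.coeff m (φ - laurentTerm ν q s p) ≠ 0 →
        MvPowerSeries.coeff m φ ≠ 0 ∧ ∀ l ≤ ν / q, ¬ (m 0 = ν + 1 - q * l ∧ m 1 = s * l) := by
  refine ⟨∑ l ∈ Finset.range (ν / q + 1),
    Polynomial.monomial l (MvPowerSeries.coeff (expo (ν + 1 - q * l) (s * l)) φ), ?_, ?_⟩
  · refine Polynomial.natDegree_sum_le_of_forall_le _ _ fun l hl => ?_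
    have := Finset.mem_range.mp hl
    exact (Polynomial.natDegree_monomial_le _).trans (by omega)
  · intro m hm
    rw [map_sub, coeff_laurentTerm] at hm
    have hn : ∀ l ≤ ν / q, ¬ (m 0 = ν + 1 - q * l ∧ m 1 = s * l) := by
      rintro l hl ⟨h0, h1⟩
      refine hm ?_
      rw [Finset.sum_eq_single l, if_pos ⟨h0, h1⟩, Polynomial.finsetSum_coeff,
        Finset.sum_eq_single l, Polynomial.coeff_monomial_same, ← h0, ← h1, ← eq_expo, sub_self]
      · intro k _ hk
        rw [Polynomial.coeff_monomial, if_neg hk]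
      · intro h
        exact absurd (Finset.mem_range.mpr (by omega)) h
      · intro k _ hk
        rw [if_neg]
        rintro ⟨-, e⟩
        exact hk (Nat.eq_of_mul_eq_mul_left hs (e.symm.trans h1))
      · intro h
        exact absurd (Finset.mem_range.mpr (by omega)) h
    refine ⟨?_, hn⟩
    rwa [Finset.sum_eq_zero, sub_zero] at hm
    intro l hl
    rw [if_neg (hn l (by have := Finset.mem_range.mp hl; omega))]

theorem exists_sub_X_mul_homogeneous (ν : ℕ) (φ : MvPowerSeries (Fin 2) ℂ) :
    ∃ p : MvPolynomial (Fin 2) ℂ, p.IsHomogeneous ν ∧ ∀ m : Fin 2 →₀ ℕ,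
      MvPowerSeries.coeff m (φ - Z1 * (p : MvPowerSeries (Fin 2) ℂ)) ≠ 0 →
        MvPowerSeries.coeff m φ ≠ 0 ∧ ¬ (1 ≤ m 0 ∧ m 0 + m 1 = ν + 1) := by
  classical
  refine ⟨∑ a ∈ Finset.finsuppAntidiag Finset.univ ν, MvPolynomial.monomial a
    (MvPowerSeries.coeff (Finsupp.single 0 1 + a) φ), ?_, ?_⟩
  · refine MvPolynomial.IsHomogeneous.sum _ _ _ fun m hm =>
      MvPolynomial.isHomogeneous_monomial _ ?_
    rw [Finset.mem_finsuppAntidiag] at hm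
    rw [Finsupp.degree_eq_sum, hm.1]
  · intro m hm
    rw [map_sub, ← pow_one Z1, MvPowerSeries.X_pow_eq, MvPowerSeries.coeff_monomial_mul, MvPolynomial.coeff_coe,
      MvPolynomial.coeff_sum] at hm
    simp only [MvPolynomial.coeff_monomial, Finset.sum_ite_eq', Finset.mem_finsuppAntidiag,
      Fin.sum_univ_two, Finset.subset_univ, and_true, one_mul] at hm
    have hle : Finsupp.single 0 1 ≤ m ↔ 1 ≤ m 0 := by
      rw [Finsupp.single_le_iff]
    have hn : ¬ (1 ≤ m 0 ∧ m 0 + m 1 = ν + 1) := by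
      rintro ⟨h0, h1⟩
      refine hm ?_
      rw [if_pos (hle.mpr h0), if_pos, add_tsub_cancel_of_le (hle.mpr h0), sub_self]
      simp
      omega
    refine ⟨?_, hn⟩
    split_ifs at hm with h1 h2
    · refine absurd ⟨hle.mp h1, ?_⟩ hn
      have := hle.mp h1
      simp at h2
      omega
    · simpa using hm
    · simpa using hm

/-! ### The normal forms -/

theorem eq_zero_of_forall_coeff {φ : MvPowerSeries (Fin 2) ℂ}
    (h : ∀ m : Fin 2 →₀ ℕ, MvPowerSeries.coeff m φ ≠ 0 → False) : φ = 0 := by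
  ext m
  rw [map_zero]
  by_contra hne
  exact h m hne

theorem coeff_polyAct_X (M : Matrix (Fin 2) (Fin 2) ℂ) (i : Fin 2) (m : Fin 2 →₀ ℕ) :
    MvPowerSeries.coeff m (polyAct M MvPolynomial.X i : MvPowerSeries (Fin 2) ℂ)
      = M i 0 * (if m 0 = 1 ∧ m 1 = 0 then 1 else 0)
        + M i 1 * (if m 0 = 0 ∧ m 1 = 1 then 1 else 0) := by
  rw [coe_polyAct_X, map_add, MvPowerSeries.coeff_C_mul, MvPowerSeries.coeff_C_mul,
    ← coeff_X_pow_mul_X_pow, ← coeff_X_pow_mul_X_pow]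
  simp

theorem coeff_of_lt_two {M : Matrix (Fin 2) (Fin 2) ℂ} {i : Fin 2} {φ : MvPowerSeries (Fin 2) ℂ}
    (h : φ - (polyAct M MvPolynomial.X i : MvPowerSeries (Fin 2) ℂ) ∈ filt 0 2) {m : Fin 2 →₀ ℕ}
    (hm : m 0 + m 1 < 2) : MvPowerSeries.coeff m φ
      = M i 0 * (if m 0 = 1 ∧ m 1 = 0 then 1 else 0)
        + M i 1 * (if m 0 = 0 ∧ m 1 = 1 then 1 else 0) := by
  have := h m (Or.inr hm)
  rwa [map_sub, sub_eq_zero, coeff_polyAct_X] at this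

theorem coeff_expo_one_zero {M : Matrix (Fin 2) (Fin 2) ℂ} {i : Fin 2}
    {φ : MvPowerSeries (Fin 2) ℂ}
    (h : φ - (polyAct M MvPolynomial.X i : MvPowerSeries (Fin 2) ℂ) ∈ filt 0 2) :
    MvPowerSeries.coeff (expo 1 0) φ = M i 0 := by
  rw [coeff_of_lt_two h] <;> simp [expo_zero, expo_one]

theorem coeff_expo_zero_one {M : Matrix (Fin 2) (Fin 2) ℂ} {i : Fin 2}
    {φ : MvPowerSeries (Fin 2) ℂ}
    (h : φ - (polyAct M MvPolynomial.X i : MvPowerSeries (Fin 2) ℂ) ∈ filt 0 2) :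
    MvPowerSeries.coeff (expo 0 1) φ = M i 1 := by
  rw [coeff_of_lt_two h] <;> simp [expo_zero, expo_one]

theorem support_cases {M : Matrix (Fin 2) (Fin 2) ℂ} {R : Fin 2 → ℕ → ℕ → Prop} {H : FormalMap}
    (hH : ∀ i, H i - (polyAct M MvPolynomial.X i : MvPowerSeries (Fin 2) ℂ) ∈ filt 0 2)
    (hR : ∀ i m, 2 ≤ m 0 + m 1 → MvPowerSeries.coeff m (H i) ≠ 0 →
      m ∈ ({m | R i (m 0) (m 1)} : Set (Fin 2 →₀ ℕ)))
    {i : Fin 2} {m : Fin 2 →₀ ℕ} (hm : MvPowerSeries.coeff m (H i) ≠ 0) :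
    (m 0 = 1 ∧ m 1 = 0 ∧ M i 0 ≠ 0) ∨ (m 0 = 0 ∧ m 1 = 1 ∧ M i 1 ≠ 0)
      ∨ (2 ≤ m 0 + m 1 ∧ R i (m 0) (m 1)) := by
  by_cases h2 : 2 ≤ m 0 + m 1
  · exact Or.inr (Or.inr ⟨h2, hR i m h2 hm⟩)
  · rw [coeff_of_lt_two (hH i) (by omega)] at hm
    by_cases h0 : m 0 = 1 ∧ m 1 = 0
    · left
      refine ⟨h0.1, h0.2, fun h => hm ?_⟩
      simp [h0.1, h]
    · by_cases h1 : m 0 = 0 ∧ m 1 = 1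
      · right; left
        refine ⟨h1.1, h1.2, fun h => hm ?_⟩
        simp [h1.1, h]
      · exact absurd (by simp [h0, h1]) hm

/-- The exponents left over in the diagonal case with eigenvalues `l` and `1`. -/
def diagonalSupport (ν : ℕ) (l : ℂ) : Fin 2 → ℕ → ℕ → Prop :=
  ![fun a b => a = 0 ∨ ∃ c : ℕ, a = c + 1 ∧ (l * (ν - c) = b ∨ l * c + b = 0),
    fun a b => b = 0 ∧ l * a = 1]

theorem homSolvable_diagonalSupport {ν : ℕ} (hν : 1 ≤ ν) (l : ℂ) :
    HomSolvable ν !![l, 0; 0, 1] (fun i => {m | diagonalSupport ν l i (m 0) (m 1)}) :=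
  homSolvable_diagonal hν (fun _ _ => Or.inl rfl) (fun a _ _ h => Or.inr ⟨a, rfl, h⟩)
    fun _ _ h => ⟨rfl, h⟩

theorem contactMap_eq {ν : ℕ} {H : FormalMap} {A B : MvPowerSeries (Fin 2) ℂ}
    (h0 : H 0 = A) (h1 : H 1 = B) : contactMap ν H = ![Z1 + Z1 ^ ν * A, Z2 + Z1 ^ ν * B] := by
  funext i
  fin_cases i
  · simp [contactMap, h0]
  · simp [contactMap, h1]

/-! ### Resonances and normal forms for the eigenvalues `l` and `1`. -/

section Diagonal

variable {ν : ℕ} {l : ℂ} {H : FormalMap}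

/-- `z + z₁^ν H` is reduced, with diagonal linear part of eigenvalues `l` and `1`. -/
structure IsDiagonalReduced (ν : ℕ) (l : ℂ) (H : FormalMap) : Prop where
  linear : ∀ i, H i - (polyAct !![l, 0; 0, 1] MvPolynomial.X i : MvPowerSeries (Fin 2) ℂ)
    ∈ filt 0 2
  support : ∀ i m, 2 ≤ m 0 + m 1 → MvPowerSeries.coeff m (H i) ≠ 0 →
    m ∈ ({m | diagonalSupport ν l i (m 0) (m 1)} : Set (Fin 2 →₀ ℕ))

theorem IsDiagonalReduced.cases_zero (h : IsDiagonalReduced ν l H) {m : Fin 2 →₀ ℕ}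
    (hm : MvPowerSeries.coeff m (H 0) ≠ 0) :
    (m 0 = 1 ∧ m 1 = 0 ∧ l ≠ 0) ∨ (m 0 = 0 ∧ 2 ≤ m 1) ∨
      ∃ c : ℕ, m 0 = c + 1 ∧ 1 ≤ c + m 1 ∧ (l * (ν - c) = m 1 ∨ l * c + m 1 = 0) := by
  rcases support_cases h.linear h.support hm with ⟨h0, h1, h2⟩ | ⟨_, _, h2⟩ | ⟨h0, h1⟩
  · exact Or.inl ⟨h0, h1, h2⟩
  · exact absurd rfl h2
  · rcases h1 with h1 | ⟨c, h1, h2⟩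
    · exact Or.inr (Or.inl ⟨h1, by omega⟩)
    · exact Or.inr (Or.inr ⟨c, h1, by omega, h2⟩)

theorem IsDiagonalReduced.cases_one (h : IsDiagonalReduced ν l H) {m : Fin 2 →₀ ℕ}
    (hm : MvPowerSeries.coeff m (H 1) ≠ 0) :
    (m 0 = 0 ∧ m 1 = 1) ∨ (2 ≤ m 0 ∧ m 1 = 0 ∧ l * m 0 = 1) := by
  rcases support_cases h.linear h.support hm with ⟨_, _, h2⟩ | ⟨h0, h1, _⟩ | ⟨h0, h1, h2⟩
  · exact absurd rfl h2
  · exact Or.inl ⟨h0, h1⟩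
  · exact Or.inr ⟨by omega, h1, h2⟩

theorem IsDiagonalReduced.coeff_zero (h : IsDiagonalReduced ν l H) :
    MvPowerSeries.coeff (expo 1 0) (H 0) = l := coeff_expo_one_zero (h.linear 0)

theorem IsDiagonalReduced.coeff_one (h : IsDiagonalReduced ν l H) :
    MvPowerSeries.coeff (expo 0 1) (H 1) = 1 := coeff_expo_zero_one (h.linear 1)

theorem IsDiagonalReduced.snd_eq (h : IsDiagonalReduced ν l H)
    (hl : ∀ d : ℕ, 2 ≤ d → l * d ≠ 1) : H 1 = Z2 := by
  have : H 1 - cst (MvPowerSeries.coeff (expo 0 1) (H 1)) * (Z1 ^ 0 * Z2 ^ 1) = 0 := by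
    refine eq_zero_of_forall_coeff fun m hm => ?_
    obtain ⟨h1, h2⟩ := coeff_sub_monomial hm
    rcases h.cases_one h1 with h3 | ⟨h3, _, h4⟩
    · exact h2 h3
    · exact hl _ h3 h4
  rw [h.coeff_one, sub_eq_zero] at this
  simpa using this

/-- Outside the exceptional set the only resonance is `c = ν`, with exponent zero on `z₂`. A
solution with `c < ν` writes `l` as a fraction with denominator at most `ν`, and one with `c > ν`
makes `l` zero or a negative rational. -/
theorem IsDiagonalReduced.isNormalForm_generic (h : IsDiagonalReduced ν l H)
    (hl : l ∉ exceptionalSet ν) : ∃ t, IsNormalForm ν (.starGeneric l) t (contactMap ν H) := by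
  simp only [exceptionalSet, Set.mem_union, Set.mem_ofPred_eq, Set.mem_singleton_iff, not_or] at hl
  obtain ⟨⟨⟨hE1, hE2⟩, hE3⟩, hE4⟩ := hl
  have hneg : ∀ a b : ℕ, 1 ≤ a → l * a + b ≠ 0 := by
    intro a b ha hab
    have ha0 : (a : ℂ) ≠ 0 := by exact_mod_cast (by omega : a ≠ 0)
    rcases Nat.eq_zero_or_pos b with rfl | hb
    · exact hE3 (by simpa [ha0] using hab)
    · refine hE4 ⟨-(b / a : ℚ), ?_, ?_⟩
      · have : (0 : ℚ) < b / a := by positivity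
        linarith
      · push_cast
        field_simp
        linear_combination hab
  refine ⟨rayCoeff 0 2 0 1 (H 0 - cst l * (Z1 ^ 1 * Z2 ^ 0)
    - cst (MvPowerSeries.coeff (expo (ν + 1) 0) (H 0 - cst l * (Z1 ^ 1 * Z2 ^ 0)))
      * (Z1 ^ (ν + 1) * Z2 ^ 0)), ?_, MvPowerSeries.coeff (expo (ν + 1) 0)
        (H 0 - cst l * (Z1 ^ 1 * Z2 ^ 0)), ?_⟩
  · simp only [exceptionalSet, Set.mem_union, Set.mem_ofPred_eq, Set.mem_singleton_iff, not_or]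
    exact ⟨⟨⟨hE1, hE2⟩, hE3⟩, hE4⟩
  · refine contactMap_eq ?_ (h.snd_eq fun d hd hld => hE2 ⟨d, hd, ?_⟩)
    · set φ₁ := H 0 - cst l * (Z1 ^ 1 * Z2 ^ 0) with hφ₁
      set φ₂ := φ₁ - cst (MvPowerSeries.coeff (expo (ν + 1) 0) φ₁) * (Z1 ^ (ν + 1) * Z2 ^ 0)
        with hφ₂
      have : φ₂ - raySeries 0 2 0 1 (rayCoeff 0 2 0 1 φ₂) = 0 := by
        refine eq_zero_of_forall_coeff fun m hm => ?_
        obtain ⟨h1, h2⟩ := coeff_sub_raySeries (by omega) hm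
        obtain ⟨h1, h3⟩ := coeff_sub_monomial h1
        rw [hφ₁, ← h.coeff_zero] at h1
        obtain ⟨h1, h4⟩ := coeff_sub_monomial h1
        rcases h.cases_zero h1 with ⟨h5, h6, _⟩ | ⟨h5, h6⟩ | ⟨c, h5, h6, h7 | h7⟩
        · exact h4 ⟨h5, h6⟩
        · exact h2 (m 1 - 2) ⟨by omega, by omega⟩
        · rcases lt_trichotomy c ν with hc | rfl | hc
          · refine hE1 ⟨ν - c, m 1, by omega, by omega, ?_⟩
            rw [← h7, Nat.cast_sub hc.le, eq_div_iff]
            rw [sub_ne_zero]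
            exact_mod_cast hc.ne'
          · rw [sub_self, mul_zero] at h7
            exact h3 ⟨h5, by exact_mod_cast h7.symm⟩
          · refine hneg (c - ν) (m 1) (by omega) ?_
            rw [← h7, Nat.cast_sub hc.le]
            ring
        · rcases Nat.eq_zero_or_pos c with rfl | hc
          · have : (m 1 : ℂ) = 0 := by simpa using h7
            have : m 1 = 0 := by exact_mod_cast this
            omega
          · exact hneg c (m 1) hc h7
      simp only [raySeries, pow_zero, pow_one, one_mul, mul_one] at this hφ₁ hφ₂
      linear_combination this - hφ₁ - hφ₂
    · rw [← hld, mul_div_assoc, div_self, mul_one]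
      exact_mod_cast (by omega : d ≠ 0)

theorem IsDiagonalReduced.isNormalForm_zero (h : IsDiagonalReduced ν 0 H) :
    ∃ t, IsNormalForm ν .starZero t (contactMap ν H) := by
  refine ⟨rayCoeff 0 2 0 1 (H 0 - raySeries 2 0 1 0 (rayCoeff 2 0 1 0 (H 0))),
    rayCoeff 2 0 1 0 (H 0), contactMap_eq ?_ (h.snd_eq fun d _ => by simp)⟩
  set φ₁ := H 0 - raySeries 2 0 1 0 (rayCoeff 2 0 1 0 (H 0)) with hφ₁
  have : φ₁ - raySeries 0 2 0 1 (rayCoeff 0 2 0 1 φ₁) = 0 := by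
    refine eq_zero_of_forall_coeff fun m hm => ?_
    obtain ⟨h1, h2⟩ := coeff_sub_raySeries (by omega) hm
    obtain ⟨h1, h3⟩ := coeff_sub_raySeries (by omega) h1
    rcases h.cases_zero h1 with ⟨_, _, h5⟩ | ⟨h5, h6⟩ | ⟨c, h5, h6, h7⟩
    · exact h5 rfl
    · exact h2 (m 1 - 2) ⟨by omega, by omega⟩
    · have h8 : m 1 = 0 := by
        simp only [zero_mul, zero_add] at h7
        rcases h7 with h7 | h7
        · exact_mod_cast h7.symm
        · exact_mod_cast h7
      exact h3 (c - 1) ⟨by omega, by omega⟩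
  simp only [raySeries, pow_zero, pow_one, one_mul, mul_one] at this hφ₁
  linear_combination this - hφ₁

theorem exists_of_mul_eq_mul {p q a b : ℕ} (hq : 1 ≤ q) (hpq : Nat.Coprime p q)
    (h : p * a = q * b) : ∃ n, a = q * n ∧ b = p * n := by
  have hdvd : q ∣ a := hpq.symm.dvd_of_dvd_mul_left ⟨b, h⟩
  obtain ⟨n, rfl⟩ := hdvd
  refine ⟨n, rfl, ?_⟩
  refine Nat.eq_of_mul_eq_mul_left hq ?_
  rw [← h]
  ring

/-- For `l = -p/q` in lowest terms the two resonance equations become `p(c - ν) = q b` and `p c = q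
b`. Their solutions form two rays of direction `(q, p)`, starting at `(ν + 1, 0)` and `(1, 0)`; the
latter also contains the linear term. -/
theorem IsDiagonalReduced.isNormalForm_neg {p q : ℕ} (hp : 1 ≤ p) (hq : 1 ≤ q)
    (hpq : Nat.Coprime p q) (h : IsDiagonalReduced ν (-((p : ℂ) / q)) H) :
    ∃ t, IsNormalForm ν (.starNeg p q) t (contactMap ν H) := by
  have hq0 : (q : ℂ) ≠ 0 := by exact_mod_cast (by omega : q ≠ 0)
  refine ⟨rayCoeff 0 2 0 1 (H 0 - raySeries 1 0 q p (rayCoeff 1 0 q p (H 0))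
      - raySeries (ν + 1) 0 q p (rayCoeff (ν + 1) 0 q p
        (H 0 - raySeries 1 0 q p (rayCoeff 1 0 q p (H 0))))), hp, hq, hpq,
    rayCoeff 1 0 q p (H 0), rayCoeff (ν + 1) 0 q p
      (H 0 - raySeries 1 0 q p (rayCoeff 1 0 q p (H 0))), ?_,
    contactMap_eq ?_ (h.snd_eq fun d hd hld => ?_)⟩
  · rw [← PowerSeries.coeff_zero_eq_constantCoeff_apply, rayCoeff, PowerSeries.coeff_mk]
    simpa using h.coeff_zero
  · set φ₁ := H 0 - raySeries 1 0 q p (rayCoeff 1 0 q p (H 0)) with hφ₁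
    set φ₂ := φ₁ - raySeries (ν + 1) 0 q p (rayCoeff (ν + 1) 0 q p φ₁) with hφ₂
    have : φ₂ - raySeries 0 2 0 1 (rayCoeff 0 2 0 1 φ₂) = 0 := by
      refine eq_zero_of_forall_coeff fun m hm => ?_
      obtain ⟨h1, h2⟩ := coeff_sub_raySeries (by omega) hm
      obtain ⟨h1, h3⟩ := coeff_sub_raySeries (by omega) h1
      obtain ⟨h1, h4⟩ := coeff_sub_raySeries (by omega) h1
      rcases h.cases_zero h1 with ⟨h5, h6, _⟩ | ⟨h5, h6⟩ | ⟨c, h5, h6, h7 | h7⟩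
      · exact h4 0 ⟨by omega, by omega⟩
      · exact h2 (m 1 - 2) ⟨by omega, by omega⟩
      · have e1 : (p * c : ℂ) = q * m 1 + p * ν := by
          field_simp at h7
          linear_combination h7
        have e2 : p * c = q * m 1 + p * ν := by exact_mod_cast e1
        have hc : ν ≤ c := by
          by_contra hlt
          have := Nat.mul_lt_mul_of_pos_left (not_le.mp hlt) hp
          omega
        obtain ⟨k, rfl⟩ := Nat.exists_eq_add_of_le hc
        obtain ⟨n, rfl, hn⟩ := exists_of_mul_eq_mul hq hpq (a := k) (b := m 1) (by
          rw [mul_add] at e2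
          omega)
        exact h3 n ⟨by omega, by omega⟩
      · have e1 : (p * c : ℂ) = q * m 1 := by
          field_simp at h7
          linear_combination -h7
        have e2 : p * c = q * m 1 := by exact_mod_cast e1
        obtain ⟨n, rfl, hn⟩ := exists_of_mul_eq_mul hq hpq e2
        exact h4 n ⟨by omega, by omega⟩
    simp only [raySeries, pow_zero, pow_one, one_mul, mul_one] at this hφ₁ hφ₂
    linear_combination this - hφ₁ - hφ₂
  · field_simp at hld
    have : (p * d + q : ℂ) = 0 := by linear_combination -hld
    have : p * d + q = 0 := by exact_mod_cast this
    omega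

/-- The first component of a reduced map with positive rational eigenvalue `p / q`. -/
theorem IsDiagonalReduced.fst_eq_laurent {p q : ℕ} (hp : 1 ≤ p) (hq : 1 ≤ q)
    (hpq : Nat.Coprime p q) (h : IsDiagonalReduced ν ((p : ℂ) / q) H) :
    ∃ (t : PowerSeries ℂ) (p₀ : Polynomial ℂ), p₀.natDegree ≤ ν / q ∧
      H 0 = cst ((p : ℂ) / q) * Z1 + laurentTerm ν q p p₀ + Z2 ^ 2 * evalAt t Z2 := by
  have hq0 : (q : ℂ) ≠ 0 := by exact_mod_cast (by omega : q ≠ 0)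
  obtain ⟨p₀, hp₀, hcoeff⟩ := exists_sub_laurentTerm ν q hp
    (H 0 - cst ((p : ℂ) / q) * (Z1 ^ 1 * Z2 ^ 0))
  set φ₁ := H 0 - cst ((p : ℂ) / q) * (Z1 ^ 1 * Z2 ^ 0) with hφ₁
  set φ₂ := φ₁ - laurentTerm ν q p p₀ with hφ₂
  refine ⟨rayCoeff 0 2 0 1 φ₂, p₀, hp₀, ?_⟩
  have : φ₂ - raySeries 0 2 0 1 (rayCoeff 0 2 0 1 φ₂) = 0 := by
    refine eq_zero_of_forall_coeff fun m hm => ?_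
    obtain ⟨h1, h2⟩ := coeff_sub_raySeries (by omega) hm
    obtain ⟨h1, h3⟩ := hcoeff m h1
    rw [hφ₁, ← h.coeff_zero] at h1
    obtain ⟨h1, h4⟩ := coeff_sub_monomial h1
    rcases h.cases_zero h1 with ⟨h5, h6, _⟩ | ⟨h5, h6⟩ | ⟨c, h5, h6, h7 | h7⟩
    · exact h4 ⟨h5, h6⟩
    · exact h2 (m 1 - 2) ⟨by omega, by omega⟩
    -- The resonance reads `p(ν - c) = q b`, so by coprimality `ν - c = q n` and `b = p n`. Since `c
    -- ≥ 0` there are finitely many solutions, whence a polynomial of degree at most `ν / q`.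
    · have e1 : (p * ν : ℂ) = q * m 1 + p * c := by
        field_simp at h7
        linear_combination h7
      have e2 : p * ν = q * m 1 + p * c := by exact_mod_cast e1
      have hc : c ≤ ν := by
        by_contra hlt
        have := Nat.mul_lt_mul_of_pos_left (not_le.mp hlt) hp
        omega
      obtain ⟨k, hk⟩ := Nat.exists_eq_add_of_le hc
      obtain ⟨n, rfl, hn⟩ := exists_of_mul_eq_mul hq hpq (a := k) (b := m 1) (by
        rw [hk, mul_add] at e2
        omega)
      refine h3 n ?_ ⟨by omega, hn⟩
      rw [Nat.le_div_iff_mul_le (by omega), mul_comm]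
      omega
    · have e1 : (p * c + q * m 1 : ℂ) = 0 := by
        field_simp at h7
        linear_combination h7
      have e2 : p * c + q * m 1 = 0 := by exact_mod_cast e1
      have e3 : c = 0 := by
        rcases Nat.mul_eq_zero.mp (Nat.eq_zero_of_add_eq_zero_right e2) with h | h <;> omega
      have e4 : m 1 = 0 := by
        rcases Nat.mul_eq_zero.mp (Nat.eq_zero_of_add_eq_zero_left e2) with h | h <;> omega
      omega
  simp only [raySeries, pow_zero, pow_one, one_mul, mul_one] at this hφ₁ hφ₂ ⊢
  rw [hφ₂, hφ₁] at this
  rw [hφ₂, hφ₁]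
  linear_combination this

theorem IsDiagonalReduced.isNormalForm_inv {q : ℕ} (hq : 2 ≤ q)
    (h : IsDiagonalReduced ν (1 / (q : ℂ)) H) :
    ∃ t, IsNormalForm ν (.starInv q) t (contactMap ν H) := by
  have hq0 : (q : ℂ) ≠ 0 := by exact_mod_cast (by omega : q ≠ 0)
  have h' : IsDiagonalReduced ν (((1 : ℕ) : ℂ) / q) H := by rwa [Nat.cast_one]
  obtain ⟨t, p₀, hp₀, h0⟩ := h'.fst_eq_laurent le_rfl (by omega) (Nat.coprime_one_left q)
  rw [Nat.cast_one] at h0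
  refine ⟨t, hq, MvPowerSeries.coeff (expo q 0) (H 1 - cst 1 * (Z1 ^ 0 * Z2 ^ 1)), p₀, hp₀,
    contactMap_eq h0 ?_⟩
  set φ₁ := H 1 - cst 1 * (Z1 ^ 0 * Z2 ^ 1) with hφ₁
  have : φ₁ - cst (MvPowerSeries.coeff (expo q 0) φ₁) * (Z1 ^ q * Z2 ^ 0) = 0 := by
    refine eq_zero_of_forall_coeff fun m hm => ?_
    obtain ⟨h1, h2⟩ := coeff_sub_monomial hm
    rw [hφ₁, ← h.coeff_one] at h1
    obtain ⟨h1, h3⟩ := coeff_sub_monomial h1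
    rcases h.cases_one h1 with h4 | ⟨h4, h5, h6⟩
    · exact h3 h4
    · refine h2 ⟨?_, h5⟩
      field_simp at h6
      exact_mod_cast h6
  simp only [pow_zero, pow_one, one_mul, mul_one, map_one] at this hφ₁
  rw [hφ₁] at this ⊢
  linear_combination this

theorem IsDiagonalReduced.isNormalForm_pos {p q : ℕ} (hp : 2 ≤ p) (hq : 1 ≤ q) (hqν : q ≤ ν)
    (hpq : Nat.Coprime p q) (h : IsDiagonalReduced ν ((p : ℂ) / q) H) :
    ∃ t, IsNormalForm ν (.starPos p q) t (contactMap ν H) := by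
  have hq0 : (q : ℂ) ≠ 0 := by exact_mod_cast (by omega : q ≠ 0)
  obtain ⟨t, p₀, hp₀, h0⟩ := h.fst_eq_laurent (by omega) hq hpq
  refine ⟨t, hq, hqν, hp, hpq, p₀, hp₀, contactMap_eq h0 (h.snd_eq fun d hd hld => ?_)⟩
  field_simp at hld
  have e : p * d = q := by exact_mod_cast hld
  have := Nat.Coprime.eq_one_of_dvd hpq ⟨d, e.symm⟩
  omega

/-- For `l = 1` the resonance is `b + c = ν`: every monomial of degree `ν + 1` divisible by `z₁`
remains. -/
theorem IsDiagonalReduced.isNormalForm_one (h : IsDiagonalReduced ν 1 H) :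
    ∃ t, IsNormalForm ν .starOne t (contactMap ν H) := by
  obtain ⟨p, hp, hcoeff⟩ := exists_sub_X_mul_homogeneous ν (H 0 - cst 1 * (Z1 ^ 1 * Z2 ^ 0))
  set φ₁ := H 0 - cst 1 * (Z1 ^ 1 * Z2 ^ 0) with hφ₁
  set φ₂ := φ₁ - Z1 * (p : MvPowerSeries (Fin 2) ℂ) with hφ₂
  refine ⟨rayCoeff 0 2 0 1 φ₂, p, hp, contactMap_eq ?_ (h.snd_eq fun d hd hld => ?_)⟩
  · have : φ₂ - raySeries 0 2 0 1 (rayCoeff 0 2 0 1 φ₂) = 0 := by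
      refine eq_zero_of_forall_coeff fun m hm => ?_
      obtain ⟨h1, h2⟩ := coeff_sub_raySeries (by omega) hm
      obtain ⟨h1, h3⟩ := hcoeff m h1
      rw [hφ₁, ← h.coeff_zero] at h1
      obtain ⟨h1, h4⟩ := coeff_sub_monomial h1
      rcases h.cases_zero h1 with ⟨h5, h6, _⟩ | ⟨h5, h6⟩ | ⟨c, h5, h6, h7 | h7⟩
      · exact h4 ⟨h5, h6⟩
      · exact h2 (m 1 - 2) ⟨by omega, by omega⟩
      · have e1 : (ν : ℂ) = m 1 + c := by linear_combination h7
        have e2 : ν = m 1 + c := by exact_mod_cast e1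
        exact h3 ⟨by omega, by omega⟩
      · have e1 : (c + m 1 : ℂ) = 0 := by linear_combination h7
        have e2 : c + m 1 = 0 := by exact_mod_cast e1
        omega
    simp only [raySeries, pow_zero, pow_one, one_mul, mul_one, map_one] at this hφ₁ hφ₂ ⊢
    rw [hφ₂, hφ₁] at this
    rw [hφ₂, hφ₁]
    linear_combination this
  · rw [one_mul] at hld
    have : d = 1 := by exact_mod_cast hld
    omega

theorem IsDiagonalReduced.exists_isNormalForm (h : IsDiagonalReduced ν l H) :
    ∃ T t, IsNormalForm ν T t (contactMap ν H) := by
  by_cases hl : l ∈ exceptionalSet ν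
  · have hpos : ∀ p q : ℕ, 1 ≤ p → 1 ≤ q → q ≤ ν → l = (p : ℂ) / q →
        ∃ T t, IsNormalForm ν T t (contactMap ν H) := by
      intro p q hp hq hqν hl
      -- Cancelling common factors keeps the denominator at most `ν`. The reduced numerator and
      -- denominator then select the family.
      obtain ⟨g, p', q', hg, hcop, rfl, rfl⟩ := Nat.exists_coprime' (m := p) (n := q)
        (Nat.gcd_pos_of_pos_left _ hp)
      have hg0 : (g : ℂ) ≠ 0 := by exact_mod_cast hg.ne'
      have hp' : 1 ≤ p' := Nat.pos_of_mul_pos_right hp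
      have hq' : 1 ≤ q' := Nat.pos_of_mul_pos_right hq
      have hq'ν : q' ≤ ν := (Nat.le_mul_of_pos_right q' hg).trans hqν
      have hl' : l = (p' : ℂ) / q' := by
        rw [hl]
        push_cast
        rw [mul_div_mul_right _ _ hg0]
      subst hl'
      rcases hp'.lt_or_eq with hp2 | rfl
      · exact ⟨_, h.isNormalForm_pos hp2 hq' hq'ν hcop⟩
      · rcases hq'.lt_or_eq with hq2 | rfl
        · rw [Nat.cast_one] at h
          exact ⟨_, h.isNormalForm_inv hq2⟩
        · rw [Nat.cast_one, div_one] at h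
          exact ⟨_, h.isNormalForm_one⟩
    rcases hl with ((⟨q, n, hq, hqν, hl⟩ | ⟨d, hd, rfl⟩) | hl) | ⟨r, hr, rfl⟩
    · rcases Nat.eq_zero_or_pos n with rfl | hn
      · rw [Nat.cast_zero, zero_div] at hl
        subst hl
        exact ⟨_, h.isNormalForm_zero⟩
      · exact hpos n q hn hq hqν hl
    · exact ⟨_, h.isNormalForm_inv hd⟩
    · rw [Set.mem_singleton_iff] at hl
      subst hl
      exact ⟨_, h.isNormalForm_zero⟩
    · refine ⟨.starNeg r.num.natAbs r.den, IsDiagonalReduced.isNormalForm_neg ?_ r.pos r.reduced ?_⟩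
      · have := Rat.num_neg.mpr hr
        omega
      · convert h using 1
        have h1 : ((r.num.natAbs : ℤ) : ℂ) = ((-r.num : ℤ) : ℂ) := by
          congr 1
          have := Rat.num_neg.mpr hr
          omega
        rw [Int.cast_natCast] at h1
        rw [h1, Rat.cast_def]
        push_cast
        ring
  · exact ⟨_, h.isNormalForm_generic hl⟩

end Diagonal

/-! ### Normal forms for the two Jordan blocks and for the eigenvalues `1` and `0`. -/

theorem exists_isNormalForm_jordan_one {ν : ℕ} {H : FormalMap}
    (hH : ∀ i, H i - (polyAct !![1, 0; 1, 1] MvPolynomial.X i : MvPowerSeries (Fin 2) ℂ)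
      ∈ filt 0 2)
    (hR : ∀ i m, 2 ≤ m 0 + m 1 → MvPowerSeries.coeff m (H i) ≠ 0 →
      m ∈ ({m | (![fun a b => a = 0 ∨ (a = 1 ∧ b = ν), fun _ _ => False] :
        Fin 2 → ℕ → ℕ → Prop) i (m 0) (m 1)} : Set (Fin 2 →₀ ℕ))) :
    ∃ t, IsNormalForm ν .J1 t (contactMap ν H) := by
  have c0 : MvPowerSeries.coeff (expo 1 0) (H 0) = 1 := coeff_expo_one_zero (hH 0)
  have c1 : MvPowerSeries.coeff (expo 0 1) (H 1) = 1 := coeff_expo_zero_one (hH 1)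
  have c2 : MvPowerSeries.coeff (expo 1 0) (H 1) = 1 := coeff_expo_one_zero (hH 1)
  set φ₁ := H 0 - cst 1 * (Z1 ^ 1 * Z2 ^ 0) with hφ₁
  set φ₂ := φ₁ - cst (MvPowerSeries.coeff (expo 1 ν) φ₁) * (Z1 ^ 1 * Z2 ^ ν) with hφ₂
  refine ⟨rayCoeff 0 2 0 1 φ₂, MvPowerSeries.coeff (expo 1 ν) φ₁, contactMap_eq ?_ ?_⟩
  · have : φ₂ - raySeries 0 2 0 1 (rayCoeff 0 2 0 1 φ₂) = 0 := by
      refine eq_zero_of_forall_coeff fun m hm => ?_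
      obtain ⟨h1, h2⟩ := coeff_sub_raySeries (by omega) hm
      obtain ⟨h1, h3⟩ := coeff_sub_monomial h1
      rw [hφ₁, ← c0] at h1
      obtain ⟨h1, h4⟩ := coeff_sub_monomial h1
      rcases support_cases hH hR h1 with ⟨h5, h6, _⟩ | ⟨_, _, h5⟩ | ⟨h5, h6 | h6⟩
      · exact h4 ⟨h5, h6⟩
      · exact h5 rfl
      · exact h2 (m 1 - 2) ⟨by omega, by omega⟩
      · exact h3 h6
    simp only [raySeries, pow_zero, pow_one, one_mul, mul_one, map_one] at this hφ₁ hφ₂ ⊢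
    linear_combination this - hφ₁ - hφ₂
  · set ψ := H 1 - cst (MvPowerSeries.coeff (expo 0 1) (H 1)) * (Z1 ^ 0 * Z2 ^ 1) with hψ
    have : ψ - cst (MvPowerSeries.coeff (expo 1 0) ψ) * (Z1 ^ 1 * Z2 ^ 0) = 0 := by
      refine eq_zero_of_forall_coeff fun m hm => ?_
      obtain ⟨h1, h2⟩ := coeff_sub_monomial hm
      obtain ⟨h1, h3⟩ := coeff_sub_monomial h1
      rcases support_cases hH hR h1 with ⟨h5, h6, _⟩ | ⟨h5, h6, _⟩ | ⟨_, h6⟩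
      · exact h2 ⟨h5, h6⟩
      · exact h3 ⟨h5, h6⟩
      · exact h6
    have e : MvPowerSeries.coeff (expo 1 0) ψ = 1 := by
      rw [hψ, map_sub, MvPowerSeries.coeff_C_mul, coeff_X_pow_mul_X_pow, expo_zero, c2]
      simp
    rw [e, hψ, c1] at this
    simp only [pow_zero, pow_one, one_mul, mul_one, map_one] at this
    linear_combination this

theorem exists_isNormalForm_star_two {ν : ℕ} {H : FormalMap}
    (hH : ∀ i, H i - (polyAct !![1, 0; 0, 0] MvPolynomial.X i : MvPowerSeries (Fin 2) ℂ)
      ∈ filt 0 2)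
    (hR : ∀ i m, 2 ≤ m 0 + m 1 → MvPowerSeries.coeff m (H i) ≠ 0 →
      m ∈ ({m | (![fun a _ => a = 0 ∨ a = ν + 1, fun a _ => a = 0] :
        Fin 2 → ℕ → ℕ → Prop) i (m 0) (m 1)} : Set (Fin 2 →₀ ℕ))) :
    ∃ t, IsNormalForm ν .star2 t (contactMap ν H) := by
  have c0 : MvPowerSeries.coeff (expo 1 0) (H 0) = 1 := coeff_expo_one_zero (hH 0)
  set φ₁ := H 0 - cst 1 * (Z1 ^ 1 * Z2 ^ 0) with hφ₁
  set φ₂ := φ₁ - raySeries (ν + 1) 0 0 1 (rayCoeff (ν + 1) 0 0 1 φ₁) with hφ₂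
  refine ⟨rayCoeff 0 2 0 1 φ₂, rayCoeff (ν + 1) 0 0 1 φ₁, rayCoeff 0 2 0 1 (H 1),
    contactMap_eq ?_ ?_⟩
  · have : φ₂ - raySeries 0 2 0 1 (rayCoeff 0 2 0 1 φ₂) = 0 := by
      refine eq_zero_of_forall_coeff fun m hm => ?_
      obtain ⟨h1, h2⟩ := coeff_sub_raySeries (by omega) hm
      obtain ⟨h1, h3⟩ := coeff_sub_raySeries (by omega) h1
      rw [hφ₁, ← c0] at h1
      obtain ⟨h1, h4⟩ := coeff_sub_monomial h1
      rcases support_cases hH hR h1 with ⟨h5, h6, _⟩ | ⟨_, _, h5⟩ | ⟨h5, h6 | h6⟩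
      · exact h4 ⟨h5, h6⟩
      · exact h5 rfl
      · exact h2 (m 1 - 2) ⟨by omega, by omega⟩
      · exact h3 (m 1) ⟨by omega, by omega⟩
    simp only [raySeries, pow_zero, pow_one, one_mul, mul_one, map_one] at this hφ₁ hφ₂ ⊢
    linear_combination this - hφ₁ - hφ₂
  · have : H 1 - raySeries 0 2 0 1 (rayCoeff 0 2 0 1 (H 1)) = 0 := by
      refine eq_zero_of_forall_coeff fun m hm => ?_
      obtain ⟨h1, h2⟩ := coeff_sub_raySeries (by omega) hm
      rcases support_cases hH hR h1 with ⟨_, _, h5⟩ | ⟨_, _, h5⟩ | ⟨h5, h6⟩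
      · exact h5 rfl
      · exact h5 rfl
      · have h6 : m 0 = 0 := h6
        exact h2 (m 1 - 2) ⟨by omega, by omega⟩
    simp only [raySeries, pow_zero, pow_one, one_mul] at this
    linear_combination this

theorem exists_isNormalForm_jordan_zero {ν : ℕ} {H : FormalMap}
    (hH : ∀ i, H i - (polyAct !![0, 0; 1, 0] MvPolynomial.X i : MvPowerSeries (Fin 2) ℂ)
      ∈ filt 0 2)
    (hR : ∀ i m, 2 ≤ m 0 + m 1 → MvPowerSeries.coeff m (H i) ≠ 0 →
      m ∈ ({m | (![fun a _ => a = 0 ∨ a = 1, fun a _ => a = 0] :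
        Fin 2 → ℕ → ℕ → Prop) i (m 0) (m 1)} : Set (Fin 2 →₀ ℕ))) :
    ∃ t, IsNormalForm ν .J0 t (contactMap ν H) := by
  have c2 : MvPowerSeries.coeff (expo 1 0) (H 1) = 1 := coeff_expo_one_zero (hH 1)
  set φ₁ := H 0 - raySeries 1 1 0 1 (rayCoeff 1 1 0 1 (H 0)) with hφ₁
  set ψ := H 1 - cst 1 * (Z1 ^ 1 * Z2 ^ 0) with hψ
  refine ⟨rayCoeff 0 2 0 1 φ₁, rayCoeff 1 1 0 1 (H 0), rayCoeff 0 2 0 1 ψ,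
    contactMap_eq ?_ ?_⟩
  · have : φ₁ - raySeries 0 2 0 1 (rayCoeff 0 2 0 1 φ₁) = 0 := by
      refine eq_zero_of_forall_coeff fun m hm => ?_
      obtain ⟨h1, h2⟩ := coeff_sub_raySeries (by omega) hm
      obtain ⟨h1, h3⟩ := coeff_sub_raySeries (by omega) h1
      rcases support_cases hH hR h1 with ⟨_, _, h5⟩ | ⟨_, _, h5⟩ | ⟨h5, h6 | h6⟩
      · exact h5 rfl
      · exact h5 rfl
      · exact h2 (m 1 - 2) ⟨by omega, by omega⟩
      · exact h3 (m 1 - 1) ⟨by omega, by omega⟩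
    simp only [raySeries, pow_zero, pow_one, one_mul] at this hφ₁ ⊢
    linear_combination this - hφ₁
  · have : ψ - raySeries 0 2 0 1 (rayCoeff 0 2 0 1 ψ) = 0 := by
      refine eq_zero_of_forall_coeff fun m hm => ?_
      obtain ⟨h1, h2⟩ := coeff_sub_raySeries (by omega) hm
      rw [hψ, ← c2] at h1
      obtain ⟨h1, h3⟩ := coeff_sub_monomial h1
      rcases support_cases hH hR h1 with ⟨h5, h6, _⟩ | ⟨_, _, h5⟩ | ⟨h5, h6⟩
      · exact h3 ⟨h5, h6⟩
      · exact h5 rfl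
      · have h6 : m 0 = 0 := h6
        exact h2 (m 1 - 2) ⟨by omega, by omega⟩
    simp only [raySeries, pow_zero, pow_one, one_mul, mul_one, map_one] at this hψ ⊢
    linear_combination this - hψ

/-! ### Existence of the formal normal form -/

/-- The case distinction is on the linear part: `γ ≠ 0` is scaled to `1`; if `γ = 0` and `α ≠ 0`,
then `α` is scaled to `1`; otherwise the linear part is nilpotent. -/
theorem exists_isNormalForm {ν : ℕ} (hν : 1 ≤ ν) {α β γ : ℂ} (h : α ≠ 0 ∨ β ≠ 0 ∨ γ ≠ 0)
    {G : FormalMap}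
    (hG : ∀ i, G i - (polyAct !![α, 0; β, γ] MvPolynomial.X i : MvPowerSeries (Fin 2) ℂ)
      ∈ filt 0 2) :
    ∃ T t F χ, IsNormalForm ν T t F ∧ IsFormalChange χ ∧ (contactMap ν G).comp χ = χ.comp F := by
  have hdiag : ∀ a c d l : ℂ, a ≠ 0 → d ≠ 0 → l = a ^ ν * α → 1 = a ^ ν * γ →
      c * l + d * 0 = a ^ ν * (β * a + γ * c) →
      ∃ T t F χ, IsNormalForm ν T t F ∧ IsFormalChange χ ∧
        (contactMap ν G).comp χ = χ.comp F := by
    intro a c d l ha hd hl hm hn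
    obtain ⟨χ, H, hχ, hH, hS, hcomp⟩ := exists_conjugate_of_homSolvable hν ha hd hl hm hn
      (homSolvable_diagonalSupport hν l) hG
    obtain ⟨T, t, hT⟩ := IsDiagonalReduced.exists_isNormalForm ⟨hH, hS⟩
    exact ⟨T, t, _, χ, hT, hχ, hcomp⟩
  by_cases hγ : γ = 0
  · by_cases hα : α = 0
    · have hβ : β ≠ 0 := by
        rcases h with h | h | h
        · exact absurd hα h
        · exact h
        · exact absurd hγ h
      -- Only the nilpotent entry `β` is left, and rescaling `z₂` by `β` normalises it to `1`.
      obtain ⟨χ, H, hχ, hH, hS, hcomp⟩ := exists_conjugate_of_homSolvable (a := 1) (c := 0)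
        (d := β) (l := 0) (n := 1) (m := 0) hν one_ne_zero hβ (by rw [hα, mul_zero])
        (by rw [hγ, mul_zero]) (by rw [one_pow]; ring)
        (homSolvable_jordan_zero (ν := ν) (R := ![fun a _ => a = 0 ∨ a = 1, fun a _ => a = 0])
          (fun _ _ => Or.inl rfl) (fun _ _ => Or.inr rfl) (fun _ _ => rfl)) hG
      obtain ⟨t, hT⟩ := exists_isNormalForm_jordan_zero hH hS
      exact ⟨_, t, _, χ, hT, hχ, hcomp⟩
    · obtain ⟨a, ha⟩ := IsAlgClosed.exists_pow_nat_eq α⁻¹ (by omega : 0 < ν)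
      have ha0 : a ≠ 0 := by
        rintro rfl
        rw [zero_pow (by omega)] at ha
        exact inv_ne_zero hα ha.symm
      -- The value of `c` makes `(a, c)` an eigenvector for the eigenvalue `α`, which removes the
      -- off-diagonal entry.
      obtain ⟨χ, H, hχ, hH, hS, hcomp⟩ := exists_conjugate_of_homSolvable (a := a)
        (c := α⁻¹ * β * a)
        (d := 1) (l := 1) (n := 0) (m := 0) hν ha0 one_ne_zero
        (by rw [ha, inv_mul_cancel₀ hα]) (by rw [hγ, mul_zero]) (by rw [ha, hγ]; ring)
        (homSolvable_star_two (ν := ν)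
          (R := ![fun a _ => a = 0 ∨ a = ν + 1, fun a _ => a = 0])
          (fun _ _ => Or.inl rfl) (fun _ => Or.inr rfl) (fun _ _ => rfl)) hG
      obtain ⟨t, hT⟩ := exists_isNormalForm_star_two hH hS
      exact ⟨_, t, _, χ, hT, hχ, hcomp⟩
  · obtain ⟨a, ha⟩ := IsAlgClosed.exists_pow_nat_eq γ⁻¹ (by omega : 0 < ν)
    have ha0 : a ≠ 0 := by
      rintro rfl
      rw [zero_pow (by omega)] at ha
      exact inv_ne_zero hγ ha.symm
    have hm : 1 = a ^ ν * γ := by rw [ha, inv_mul_cancel₀ hγ]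
    by_cases hαγ : α = γ
    · by_cases hβ : β = 0
      · refine hdiag a 0 1 1 ha0 one_ne_zero (by rw [hαγ, ← hm]) hm ?_
        rw [hβ]
        ring
      -- The value of `d` normalises the off-diagonal entry of the Jordan block to `1`.
      · obtain ⟨χ, H, hχ, hH, hS, hcomp⟩ := exists_conjugate_of_homSolvable (a := a) (c := 0)
          (d := γ⁻¹ * (β * a)) (l := 1) (n := 1) (m := 1) hν ha0
          (mul_ne_zero (inv_ne_zero hγ) (mul_ne_zero hβ ha0))
          (by rw [hαγ, ← hm]) hm (by rw [ha]; ring)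
          (homSolvable_jordan_one (ν := ν)
            (R := ![fun a b => a = 0 ∨ (a = 1 ∧ b = ν), fun _ _ => False])
            (fun _ _ => Or.inl rfl) (Or.inr ⟨rfl, rfl⟩)) hG
        obtain ⟨t, hT⟩ := exists_isNormalForm_jordan_one hH hS
        exact ⟨_, t, _, χ, hT, hχ, hcomp⟩
    -- The eigenvalues are distinct, and `(a, β a / (α - γ))` is an eigenvector for `α`.
    · refine hdiag a (β * a / (α - γ)) 1 _ ha0 one_ne_zero rfl hm ?_
      have : α - γ ≠ 0 := sub_ne_zero.mpr hαγ
      field_simp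
      ring

/-! ### Invariants of formal conjugacy -/

section Invariants

variable {ν : ℕ} {G H χ : FormalMap}

/-- The target map is the identity up to `filt ν (ν + 1)`, so composing with it changes a series of
order `k` only by `z₁^ν` times terms of order `k`. -/
theorem subst_contactMap_sub_mem (hH : ∀ i, H i ∈ filt 0 1) {φ : MvPowerSeries (Fin 2) ℂ}
    {k N : ℕ} (hφ : φ ∈ filt 0 k) (hN : N ≤ k) :
    MvPowerSeries.subst (contactMap ν H) φ - φ ∈ filt ν (ν + N) := by
  have := subst_sub_subst_mem_filt (N := ν + N) X_mem_filt (contactMap_mem (ν := ν) hH)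
    (contactMap_sub_X_mem (ν := ν) hH) hφ (by omega)
  rwa [MvPowerSeries.subst_self, id] at this

theorem X_pow_mul_mem_filt_iff {d : ℕ} {φ : MvPowerSeries (Fin 2) ℂ} :
    MvPowerSeries.X 0 ^ ν * φ ∈ filt ν (ν + d) ↔ φ ∈ filt 0 d := by
  refine ⟨fun h => ?_, fun h => mem_filt_iff_exists.mpr ⟨φ, h, rfl⟩⟩
  obtain ⟨ψ, hψ, e⟩ := mem_filt_iff_exists.mp h
  have hX : (MvPowerSeries.X 0 : MvPowerSeries (Fin 2) ℂ) ^ ν ≠ 0 := by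
    intro h0
    have := congrArg (MvPowerSeries.coeff (expo ν 0)) h0
    rw [← mul_one (MvPowerSeries.X 0 ^ ν), ← pow_zero Z2, coeff_X_pow_mul_X_pow] at this
    simp [expo_zero, expo_one] at this
  rwa [mul_left_cancel₀ hX e]

theorem mem_filt_zero_two {φ : MvPowerSeries (Fin 2) ℂ} (h : MvPowerSeries.constantCoeff φ = 0)
    (h0 : MvPowerSeries.coeff (expo 1 0) φ = 0) (h1 : MvPowerSeries.coeff (expo 0 1) φ = 0) :
    φ ∈ filt 0 2 := by
  intro m hm
  have : (m 0 = 0 ∧ m 1 = 0) ∨ (m 0 = 1 ∧ m 1 = 0) ∨ (m 0 = 0 ∧ m 1 = 1) := by omega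
  rcases this with ⟨e0, e1⟩ | ⟨e0, e1⟩ | ⟨e0, e1⟩
  · rw [eq_expo m, e0, e1]
    simpa [expo] using h
  · rw [eq_expo m, e0, e1, h0]
  · rw [eq_expo m, e0, e1, h1]

theorem sub_linear_mem_filt {φ : MvPowerSeries (Fin 2) ℂ}
    (h : MvPowerSeries.constantCoeff φ = 0) :
    φ - (cst (MvPowerSeries.coeff (expo 1 0) φ) * Z1
      + cst (MvPowerSeries.coeff (expo 0 1) φ) * Z2) ∈ filt 0 2 := by
  have e0 : ∀ a b, MvPowerSeries.coeff (expo a b) Z1 = if a = 1 ∧ b = 0 then 1 else 0 := by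
    intro a b
    simpa [expo_zero, expo_one] using coeff_X_pow_mul_X_pow 1 0 (expo a b)
  have e1 : ∀ a b, MvPowerSeries.coeff (expo a b) Z2 = if a = 0 ∧ b = 1 then 1 else 0 := by
    intro a b
    simpa [expo_zero, expo_one] using coeff_X_pow_mul_X_pow 0 1 (expo a b)
  refine mem_filt_zero_two ?_ ?_ ?_
  · simp [h]
  · simp [e0, e1]
  · simp [e0, e1]

theorem pow_sub_mem_filt_one {K : MvPowerSeries (Fin 2) ℂ} :
    K ^ ν - cst (MvPowerSeries.constantCoeff K ^ ν) ∈ filt 0 1 := by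
  rw [mem_filt_zero_one]
  simp

/-- Formally conjugate maps have proportional, conjugate linear parts. -/
theorem linear_part_of_conjugate {α β γ l n m : ℂ}
    (hG : ∀ i, G i - (polyAct !![α, 0; β, γ] MvPolynomial.X i : MvPowerSeries (Fin 2) ℂ)
      ∈ filt 0 2)
    (hH : ∀ i, H i - (polyAct !![l, 0; n, m] MvPolynomial.X i : MvPowerSeries (Fin 2) ℂ)
      ∈ filt 0 2)
    (hχ : IsFormalChange χ) (hcomp : (contactMap ν G).comp χ = χ.comp (contactMap ν H)) :
    ∃ a c d : ℂ, a ≠ 0 ∧ d ≠ 0 ∧ l = a ^ ν * α ∧ m = a ^ ν * γ ∧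
      c * l + d * n = a ^ ν * (β * a + γ * c) := by
  obtain ⟨K, hK⟩ := hχ.preserves_line
  have hχ1 : ∀ i, χ i ∈ filt 0 1 := fun i => mem_filt_zero_one.mpr (hχ.constantCoeff_eq i)
  have hχs := hasSubst_of_mem_filt hχ1
  have hH1 : ∀ i, H i ∈ filt 0 1 := fun i => mem_filt_zero_one_of_sub_polyAct (hH i)
  have hF := hasSubst_of_mem_filt (contactMap_mem (ν := ν) hH1)
  set a := MvPowerSeries.constantCoeff K with ha
  set c := MvPowerSeries.coeff (expo 1 0) (χ 1) with hc
  set d := MvPowerSeries.coeff (expo 0 1) (χ 1) with hd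
  have ex0 : Finsupp.single 0 1 = expo 1 0 := by simp [expo]
  have ex1 : Finsupp.single 1 1 = expo 0 1 := by simp [expo]
  have h00 : MvPowerSeries.coeff (expo 1 0) (χ 0) = a := by
    rw [hK, ← ex0]
    have := MvPowerSeries.coeff_add_monomial_mul (Finsupp.single (0 : Fin 2) 1) 0 K (1 : ℂ)
    rw [add_zero, one_mul] at this
    rw [ha, ← MvPowerSeries.coeff_zero_eq_constantCoeff_apply, ← this]
    rfl
  have h01 : MvPowerSeries.coeff (expo 0 1) (χ 0) = 0 :=
    MvPowerSeries.X_dvd_iff.mp hχ.preserves_line _ (expo_zero 0 1)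
  have hdet : a * d ≠ 0 := by
    have := hχ.det_ne_zero
    rw [Matrix.det_fin_two] at this
    simp only [FormalMap.linMatrix, Matrix.of_apply, ex0, ex1] at this
    rw [h00, h01] at this
    simpa using this
  have hA : ∀ i, χ i - (cst (MvPowerSeries.coeff (expo 1 0) (χ i)) * Z1
      + cst (MvPowerSeries.coeff (expo 0 1) (χ i)) * Z2) ∈ filt 0 2 :=
    fun i => sub_linear_mem_filt (hχ.constantCoeff_eq i)
  have key : ∀ i, cst (a ^ ν) * (cst (!![α, 0; β, γ] i 0) * χ 0 + cst (!![α, 0; β, γ] i 1) * χ 1)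
      - (cst (MvPowerSeries.coeff (expo 1 0) (χ i)) * H 0
        + cst (MvPowerSeries.coeff (expo 0 1) (χ i)) * H 1) ∈ filt 0 2 := by
    intro i
    have e := congrFun hcomp i
    simp only [FormalMap.comp] at e
    rw [subst_contactMap hχs] at e
    -- The nonlinear part of `χ` contributes `z₁^ν` times terms of order two. Hence only its linear
    -- part acts on `H` in the degree one comparison.
    have b1 := subst_contactMap_sub_mem (ν := ν) hH1 (hA i) le_rfl
    have b2 := subst_mem_filt hχ1 (hG i)
    rw [MvPowerSeries.subst_sub hχs, subst_polyAct_X hχs] at b2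
    have b3 : K ^ ν * MvPowerSeries.subst χ (G i)
        - (cst (MvPowerSeries.coeff (expo 1 0) (χ i)) * H 0
        + cst (MvPowerSeries.coeff (expo 0 1) (χ i)) * H 1) ∈ filt 0 2 := by
      rw [← X_pow_mul_mem_filt_iff (ν := ν)]
      convert b1 using 1
      rw [MvPowerSeries.subst_sub hF, MvPowerSeries.subst_add hF, MvPowerSeries.subst_mul hF,
        MvPowerSeries.subst_mul hF, MvPowerSeries.subst_C, MvPowerSeries.subst_C,
        MvPowerSeries.subst_X hF, MvPowerSeries.subst_X hF, ← e, hK]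
      simp only [contactMap]
      ring
    have b4 : MvPowerSeries.subst χ (G i) ∈ filt 0 1 :=
      subst_mem_filt hχ1 (mem_filt_zero_one_of_sub_polyAct (hG i))
    have b5 := mul_mem_filt_of_le (c := 0) (l := 2) (pow_sub_mem_filt_one (ν := ν) (K := K)) b4
      (by omega) (by omega)
    have := Ideal.sub_mem _ (Ideal.sub_mem _ b3 b5) (Ideal.mul_mem_left _ (cst (a ^ ν)) b2)
    convert this using 1
    ring
  have g0 : ∀ i, MvPowerSeries.coeff (expo 1 0) (H i) = !![l, 0; n, m] i 0 :=
    fun i => coeff_expo_one_zero (hH i)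
  have g1 : ∀ i, MvPowerSeries.coeff (expo 0 1) (H i) = !![l, 0; n, m] i 1 :=
    fun i => coeff_expo_zero_one (hH i)
  have k00 := key 0 (expo 1 0) (by simp [expo_zero, expo_one])
  have k10 := key 1 (expo 1 0) (by simp [expo_zero, expo_one])
  have k11 := key 1 (expo 0 1) (by simp [expo_zero, expo_one])
  simp only [map_sub, map_add, MvPowerSeries.coeff_C_mul, g0, g1, h00, h01, ← hc, ← hd] at k00 k10 k11
  simp at k00 k10 k11
  have ha0 : a ≠ 0 := left_ne_zero_of_mul hdet
  have hd0 : d ≠ 0 := right_ne_zero_of_mul hdet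
  refine ⟨a, c, d, ha0, hd0, ?_, ?_, ?_⟩
  · refine mul_left_cancel₀ ha0 ?_
    linear_combination -k00
  · refine mul_left_cancel₀ hd0 ?_
    linear_combination -k11
  · linear_combination -k10

/-- The linear part of `χ` is triangular and invertible, so its entry `d` at `z₂` in the second
component is nonzero and `z₂^k` occurs in `χ 1 ^ k` with coefficient `d^k`. -/
theorem not_X_dvd_pow (hχ : IsFormalChange χ) (k : ℕ) : ¬ Z1 ∣ χ 1 ^ k := by
  intro hdvd
  have hd : MvPowerSeries.coeff (expo 0 1) (χ 1) ≠ 0 := by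
    intro h0
    have := hχ.det_ne_zero
    rw [Matrix.det_fin_two] at this
    simp only [FormalMap.linMatrix, Matrix.of_apply] at this
    have ex1 : Finsupp.single 1 1 = expo 0 1 := by simp [expo]
    rw [ex1, h0, MvPowerSeries.X_dvd_iff.mp hχ.preserves_line _ (expo_zero 0 1)] at this
    simp at this
  set c := MvPowerSeries.coeff (expo 1 0) (χ 1)
  set d := MvPowerSeries.coeff (expo 0 1) (χ 1)
  have h1 : χ 1 ^ k - (cst c * Z1 + cst d * Z2) ^ k ∈ filt 0 (k + 1) :=
    pow_sub_pow_mem_filt (Ideal.add_mem _ (Ideal.mul_mem_left _ _ (X_mem_filt 0))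
      (Ideal.mul_mem_left _ _ (X_mem_filt 1))) (mem_filt_zero_one.mpr (hχ.constantCoeff_eq 1))
      (sub_linear_mem_filt (hχ.constantCoeff_eq 1)) (by omega)
  have h2 : Z1 ∣ (cst c * Z1 + cst d * Z2) ^ k - (cst d * Z2) ^ k :=
    Dvd.dvd.trans (Dvd.intro_left (cst c) (by ring)) (sub_dvd_pow_sub_pow _ (cst d * Z2) k)
  have c1 := h1 (expo 0 k) (Or.inr (by simp [expo_zero, expo_one]))
  have c2 := MvPowerSeries.X_dvd_iff.mp h2 (expo 0 k) (expo_zero 0 k)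
  have c3 := MvPowerSeries.X_dvd_iff.mp hdvd (expo 0 k) (expo_zero 0 k)
  have c4 : MvPowerSeries.coeff (expo 0 k) ((cst d * Z2) ^ k) = d ^ k := by
    rw [mul_pow, ← map_pow, MvPowerSeries.coeff_C_mul, ← one_mul (Z2 ^ k), ← pow_zero Z1,
      coeff_X_pow_mul_X_pow]
    simp [expo_zero, expo_one]
  rw [map_sub] at c1 c2
  refine pow_ne_zero k hd ?_
  linear_combination -c4 - c2 - c1 + c3

/-- A change preserving the line restricts to an invertible change on it, so it cannot make a
nonzero restriction vanish. Modulo `z₁` a series with nonzero restriction is `z₂^b` times a unit,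
and its image is `χ 1 ^ b` times a unit. -/
theorem X_dvd_subst_iff (hχ : IsFormalChange χ) (φ : MvPowerSeries (Fin 2) ℂ) :
    Z1 ∣ MvPowerSeries.subst χ φ ↔ Z1 ∣ φ := by
  have hχ1 : ∀ i, χ i ∈ filt 0 1 := fun i => mem_filt_zero_one.mpr (hχ.constantCoeff_eq i)
  have hχs := hasSubst_of_mem_filt hχ1
  have hback : ∀ ψ, Z1 ∣ ψ → Z1 ∣ MvPowerSeries.subst χ ψ := by
    rintro _ ⟨ψ, rfl⟩
    rw [MvPowerSeries.subst_mul hχs, MvPowerSeries.subst_X hχs]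
    exact Dvd.dvd.mul_right hχ.preserves_line _
  refine ⟨fun h => ?_, hback φ⟩
  by_contra hφ
  have hex : ∃ b, MvPowerSeries.coeff (expo 0 b) φ ≠ 0 := by
    by_contra! hall
    refine hφ (MvPowerSeries.X_dvd_iff.mpr fun m hm => ?_)
    rw [eq_expo m, hm]
    exact hall _
  classical
  -- Here `b` is the order of vanishing of `φ(0, z₂)`.
  obtain ⟨b, hb, hmin⟩ : ∃ b, MvPowerSeries.coeff (expo 0 b) φ ≠ 0 ∧
      ∀ c < b, MvPowerSeries.coeff (expo 0 c) φ = 0 :=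
    ⟨Nat.find hex, Nat.find_spec hex, fun c hc => not_not.mp (Nat.find_min hex hc)⟩
  set g := rayCoeff 0 b 0 1 φ
  have h1 : Z1 ∣ φ - raySeries 0 b 0 1 g := by
    refine MvPowerSeries.X_dvd_iff.mpr fun m hm => ?_
    by_contra hne
    obtain ⟨h2, h3⟩ := coeff_sub_raySeries (by omega) hne
    by_cases hlt : m 1 < b
    · refine h2 ?_
      rw [eq_expo m, hm]
      exact hmin _ hlt
    · exact h3 (m 1 - b) ⟨by omega, by omega⟩
  have h2 := hback _ h1
  rw [MvPowerSeries.subst_sub hχs] at h2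
  have h3 := (dvd_sub_right h).mp h2
  rw [raySeries, MvPowerSeries.subst_mul hχs, pow_zero, one_mul, MvPowerSeries.subst_pow hχs,
    MvPowerSeries.subst_X hχs] at h3
  refine not_X_dvd_pow hχ b ((IsUnit.dvd_mul_right ?_).mp h3)
  rw [MvPowerSeries.isUnit_iff_constantCoeff]
  set U := evalAt g (Z1 ^ 0 * Z2 ^ 1)
  have hU : MvPowerSeries.constantCoeff U = MvPowerSeries.coeff (expo 0 b) φ := by
    have := coeff_raySeries_of_eq (p := 0) (q := 0) (r := 0) (s := 1) (by omega) g (m := 0) (n := 0)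
      (by simp) (by simp)
    rw [raySeries, pow_zero, pow_zero, one_mul, one_mul] at this
    rw [← MvPowerSeries.coeff_zero_eq_constantCoeff_apply]
    simp only [U, pow_zero, one_mul] at this ⊢
    rw [this]
    simp [g, rayCoeff]
  have h4 : U - cst (MvPowerSeries.constantCoeff U) ∈ filt 0 1 := by
    rw [mem_filt_zero_one]
    simp
  have h5 := subst_mem_filt hχ1 h4
  rw [mem_filt_zero_one, MvPowerSeries.subst_sub hχs, MvPowerSeries.subst_C, map_sub,
    MvPowerSeries.constantCoeff_C, sub_eq_zero] at h5
  have hUe : evalAt g (1 * Z2 ^ 1) = U := by simp only [U, pow_zero]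
  rw [hUe, h5, hU]
  exact isUnit_iff_ne_zero.mpr hb

theorem isUnit_of_sub_mem_filt {K K' : MvPowerSeries (Fin 2) ℂ}
    (hK : MvPowerSeries.constantCoeff K ≠ 0) (h : K' - K ∈ filt 0 1) : IsUnit K' := by
  rw [mem_filt_zero_one, map_sub, sub_eq_zero] at h
  rw [MvPowerSeries.isUnit_iff_constantCoeff, h]
  exact isUnit_iff_ne_zero.mpr hK

/-- Being tangential is invariant under formal conjugacy. -/
theorem X_dvd_iff_of_conjugate (hν : 1 ≤ ν) (hH1 : ∀ i, H i ∈ filt 0 1)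
    (hχ : IsFormalChange χ) (hcomp : (contactMap ν G).comp χ = χ.comp (contactMap ν H)) :
    Z1 ∣ H 0 ↔ Z1 ∣ G 0 := by
  obtain ⟨K, hK⟩ := hχ.preserves_line
  have hχ1 : ∀ i, χ i ∈ filt 0 1 := fun i => mem_filt_zero_one.mpr (hχ.constantCoeff_eq i)
  have hχs := hasSubst_of_mem_filt hχ1
  have hF := hasSubst_of_mem_filt (contactMap_mem (ν := ν) hH1)
  have hK0 : MvPowerSeries.constantCoeff K ≠ 0 := by
    intro h0
    have hdet := hχ.det_ne_zero
    rw [Matrix.det_fin_two] at hdet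
    simp only [FormalMap.linMatrix, Matrix.of_apply] at hdet
    have h2 : χ 0 ∈ filt 0 2 := by
      rw [hK]
      exact mul_mem_filt_of_le X_zero_mem_filt (mem_filt_zero_one.mpr h0) (by omega) (by omega)
    rw [h2 (Finsupp.single 0 1) (by simp), h2 (Finsupp.single 1 1) (by simp)] at hdet
    simp at hdet
  have e := congrFun hcomp 0
  simp only [FormalMap.comp] at e
  rw [subst_contactMap hχs] at e
  have b1 := subst_contactMap_sub_mem (ν := ν) hH1 (mem_filt_zero_zero K) le_rfl
  obtain ⟨κ, -, hκ⟩ := mem_filt_iff_exists.mp b1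
  set K' := MvPowerSeries.subst (contactMap ν H) K with hK'
  have hKu : IsUnit (K ^ ν) := IsUnit.pow ν (isUnit_of_sub_mem_filt hK0 (by simp))
  have hKu' : IsUnit K' := by
    refine isUnit_of_sub_mem_filt hK0 ?_
    rw [hκ]
    exact Ideal.mul_mem_right _ _ (filt_mono (Nat.zero_le _) hν (X_zero_pow_mem_filt ν))
  have e2 : MvPowerSeries.subst (contactMap ν H) (χ 0) = (Z1 + Z1 ^ ν * H 0) * K' := by
    rw [hK, MvPowerSeries.subst_mul hF, MvPowerSeries.subst_X hF]
    rfl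
  rw [e2] at e
  nth_rewrite 1 2 [hK] at e
  -- Since `K ∘ (z + z₁^ν H) = K' = K + z₁^ν κ`, the terms `z₁ K` cancel in the first component.
  -- What remains is divisible by `z₁^ν`, and the correction `z₁ κ` is invisible on the line.
  have e3 : MvPowerSeries.X 0 ^ ν * (K ^ ν * MvPowerSeries.subst χ (G 0) - (Z1 * κ + H 0 * K')) = 0 := by
    linear_combination e + Z1 * hκ
  have e4 : K ^ ν * MvPowerSeries.subst χ (G 0) = Z1 * κ + H 0 * K' := by
    refine sub_eq_zero.mp (eq_zero_of_forall_mem_filt fun n => ?_)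
    rw [← X_pow_mul_mem_filt_iff (ν := ν), e3]
    exact Ideal.zero_mem _
  rw [← X_dvd_subst_iff hχ (G 0)]
  refine Iff.trans ?_ hKu.dvd_mul_left
  rw [e4, dvd_add_right (dvd_mul_right _ _), hKu'.dvd_mul_right]

end Invariants

/-! ### The linear part of a normal form and its type -/

/-- The series contains no `z₁`, so divisibility by `z₁` kills all its coefficients. -/
theorem X_dvd_raySeries_iff (t : PowerSeries ℂ) : Z1 ∣ Z2 ^ 2 * evalAt t Z2 ↔ t = 0 := by
  have e : Z2 ^ 2 * evalAt t Z2 = raySeries 0 2 0 1 t := by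
    simp only [raySeries, pow_zero, pow_one, one_mul]
  constructor
  · intro h
    ext n
    rw [e] at h
    have := MvPowerSeries.X_dvd_iff.mp h (expo 0 (2 + 1 * n)) (expo_zero _ _)
    rwa [coeff_raySeries_of_eq (n := n) (by omega) _ (by rw [expo_zero]; omega)
      (by rw [expo_one])] at this
  · rintro rfl
    rw [e, MvPowerSeries.X_dvd_iff]
    intro m hm
    by_cases h : ∃ n, m 0 = 0 + 0 * n ∧ m 1 = 2 + 1 * n
    · obtain ⟨n, h0, h1⟩ := h
      rw [coeff_raySeries_of_eq (by omega) _ h0 h1, map_zero]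
    · exact coeff_raySeries_of_ne (by omega) _ fun n hn => h ⟨n, hn⟩

/-- The nonzero entries of the linear part of a normal form of the given type: `(l, n, m)` stands
for `(l z₁, n z₁ + m z₂)`. -/
noncomputable def NormalFormType.linearPart : NormalFormType → ℂ × ℂ × ℂ
  | .starGeneric lam => (lam, 0, 1)
  | .starZero => (0, 0, 1)
  | .starNeg p q => (-((p : ℂ) / q), 0, 1)
  | .starInv q => (1 / (q : ℂ), 0, 1)
  | .starPos p q => ((p : ℂ) / q, 0, 1)
  | .starOne => (1, 0, 1)
  | .J1 => (1, 1, 1)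
  | .star2 => (1, 0, 0)
  | .J0 => (0, 1, 0)

/-- `F = z + z₁^ν H` where `H` has linear part `(l z₁, n z₁ + m z₂)` and preserves `z₁ = 0` if and
only if `t = 0`. -/
def HasLinearPart (ν : ℕ) (t : PowerSeries ℂ) (F : FormalMap) (P : ℂ × ℂ × ℂ) : Prop :=
  ∃ H : FormalMap, F = contactMap ν H ∧
    (∀ i, H i - (polyAct !![P.1, 0; P.2.1, P.2.2] MvPolynomial.X i : MvPowerSeries (Fin 2) ℂ)
      ∈ filt 0 2) ∧ (Z1 ∣ H 0 ↔ t = 0)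

/-- Every listed first component is a multiple of `z₁` plus `z₂² t(z₂)`. The first summand carries
the eigenvalue and does not affect tangentiality, which is decided by `t`. -/
theorem hasLinearPart_of_eq {ν : ℕ} {t : PowerSeries ℂ} {l n m : ℂ} {F : FormalMap}
    {A B C : MvPowerSeries (Fin 2) ℂ}
    (hF : F = ![Z1 + Z1 ^ ν * (A + Z2 ^ 2 * evalAt t Z2), Z2 + Z1 ^ ν * B]) (hA : A = Z1 * C)
    (hC : C - cst l ∈ filt 0 1) (hB : B - (cst n * Z1 + cst m * Z2) ∈ filt 0 2) :
    HasLinearPart ν t F (l, n, m) := by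
  refine ⟨![A + Z2 ^ 2 * evalAt t Z2, B], ?_, ?_, ?_⟩
  · rw [hF, contactMap_eq rfl rfl]
    rfl
  · intro i
    rw [coe_polyAct_X]
    fin_cases i
    · have h1 := mul_mem_filt_of_le (c := 0) (l := 2) X_zero_mem_filt hC (by omega) (by omega)
      have h2 := mul_mem_filt_of_le (c := 0) (l := 2) (pow_mem_filt (X_mem_filt 1) 2)
        (mem_filt_zero_zero (evalAt t Z2)) (by omega) (by omega)
      convert Ideal.add_mem _ h1 h2 using 1
      simp [hA, cst]
      ring
    · simpa using hB
  · rw [← X_dvd_raySeries_iff t]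
    simp only [Matrix.cons_val_zero]
    exact dvd_add_right ⟨C, hA⟩

theorem evalAt_sub_mem_filt {r s : ℕ} (hrs : r + s ≠ 0) (g : PowerSeries ℂ) :
    evalAt g (Z1 ^ r * Z2 ^ s) - cst (PowerSeries.constantCoeff g) ∈ filt 0 1 := by
  have := coeff_raySeries_of_eq (p := 0) (q := 0) hrs g (m := 0) (n := 0) (by simp) (by simp)
  rw [raySeries, pow_zero, pow_zero, one_mul, one_mul] at this
  rw [mem_filt_zero_one, map_sub, ← MvPowerSeries.coeff_zero_eq_constantCoeff_apply, this]
  simp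

theorem exists_laurentTerm_eq {ν q s : ℕ} (hν : 1 ≤ ν) (hq : 1 ≤ q) (hs : 1 ≤ s)
    (p : Polynomial ℂ) : ∃ C ∈ filt 0 1, laurentTerm ν q s p = Z1 * C := by
  refine ⟨∑ l ∈ Finset.range (ν / q + 1), cst (p.coeff l) * (Z1 ^ (ν - q * l) * Z2 ^ (s * l)),
    Ideal.sum_mem _ fun l hl => Ideal.mul_mem_left _ _ ?_, ?_⟩
  · refine mul_mem_filt_of_le (pow_mem_filt (X_mem_filt 0) _) (pow_mem_filt (X_mem_filt 1) _)
      (by omega) ?_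
    rcases Nat.eq_zero_or_pos l with rfl | hl
    · simp
      omega
    · have := Nat.mul_pos hs hl
      omega
  · rw [laurentTerm, Finset.mul_sum]
    refine Finset.sum_congr rfl fun l hl => ?_
    have hl' : l ≤ ν / q := by
      have := Finset.mem_range.mp hl
      omega
    have : q * l ≤ ν := by
      rw [mul_comm]
      exact (Nat.le_div_iff_mul_le (by omega)).mp hl'
    rw [show ν + 1 - q * l = ν - q * l + 1 by omega]
    ring

theorem IsNormalForm.hasLinearPart {ν : ℕ} (hν : 1 ≤ ν) {T : NormalFormType}
    {t : PowerSeries ℂ} {F : FormalMap} (h : IsNormalForm ν T t F) :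
    HasLinearPart ν t F T.linearPart := by
  have hX : ∀ k, 1 ≤ k → ∀ φ : MvPowerSeries (Fin 2) ℂ, Z1 ^ k * φ ∈ filt 0 1 := fun k hk φ =>
    Ideal.mul_mem_right _ _ (filt_mono le_rfl (by omega) (pow_mem_filt (X_mem_filt 0) k))
  have hB : Z2 - (cst 0 * Z1 + cst 1 * Z2) ∈ filt 0 2 := by simp
  have hY : ∀ φ : MvPowerSeries (Fin 2) ℂ, Z2 ^ 2 * φ ∈ filt 0 2 := fun φ =>
    Ideal.mul_mem_right _ _ (filt_mono le_rfl (by omega) (pow_mem_filt (X_mem_filt 1) 2))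
  have c0 : cst 0 = 0 := map_zero _
  have c1 : cst 1 = 1 := map_one _
  cases T with
  | starGeneric lam =>
    obtain ⟨_, a, hF⟩ := h
    refine hasLinearPart_of_eq hF (C := cst lam + Z1 ^ ν * cst a) (by ring) ?_ hB
    rw [add_sub_cancel_left]
    exact hX ν hν _
  | starZero =>
    obtain ⟨g, hF⟩ := h
    refine hasLinearPart_of_eq hF (C := Z1 ^ 1 * evalAt g Z1) (by ring) ?_ hB
    rw [c0, sub_zero]
    exact hX 1 le_rfl _
  | starNeg p q =>
    obtain ⟨hp, hq, _, g₁, g₂, hg, hF⟩ := h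
    refine hasLinearPart_of_eq hF (C := evalAt g₁ (Z1 ^ q * Z2 ^ p)
      + Z1 ^ ν * evalAt g₂ (Z1 ^ q * Z2 ^ p)) (by ring) ?_ hB
    have h1 := evalAt_sub_mem_filt (r := q) (s := p) (by omega) g₁
    rw [hg] at h1
    convert Ideal.add_mem _ h1 (hX ν hν (evalAt g₂ (Z1 ^ q * Z2 ^ p))) using 1
    ring
  | starInv q =>
    obtain ⟨hq, a, p₀, _, hF⟩ := h
    obtain ⟨C, hC, hL⟩ := exists_laurentTerm_eq (q := q) hν (by omega) le_rfl p₀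
    refine hasLinearPart_of_eq hF (C := cst (1 / (q : ℂ)) + C) (by rw [hL]; ring) ?_ ?_
    · rwa [add_sub_cancel_left]
    · have : cst a * Z1 ^ q ∈ filt 0 2 := Ideal.mul_mem_left _ _
        (filt_mono le_rfl (by omega) (pow_mem_filt (X_mem_filt 0) q))
      convert this using 1
      simp
  | starPos p q =>
    obtain ⟨hq, _, hp, _, p₀, _, hF⟩ := h
    obtain ⟨C, hC, hL⟩ := exists_laurentTerm_eq (s := p) hν hq (by omega) p₀
    refine hasLinearPart_of_eq hF (C := cst ((p : ℂ) / q) + C) (by rw [hL]; ring) ?_ hB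
    rwa [add_sub_cancel_left]
  | starOne =>
    obtain ⟨p, hp, hF⟩ := h
    refine hasLinearPart_of_eq hF (C := 1 + (p : MvPowerSeries (Fin 2) ℂ)) (by ring) ?_ hB
    rw [c1, add_sub_cancel_left]
    exact filt_mono le_rfl hν (coe_mem_filt_of_isHomogeneous hp)
  | J1 =>
    obtain ⟨a, hF⟩ := h
    refine hasLinearPart_of_eq hF (C := 1 + cst a * Z2 ^ ν) (by ring) ?_ (by simp)
    rw [c1, add_sub_cancel_left]
    exact Ideal.mul_mem_left _ _ (filt_mono le_rfl (by omega) (pow_mem_filt (X_mem_filt 1) ν))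
  | star2 =>
    obtain ⟨g₁, g₂, hF⟩ := h
    refine hasLinearPart_of_eq hF (C := 1 + Z1 ^ ν * evalAt g₁ Z2) (by ring) ?_ ?_
    · rw [c1, add_sub_cancel_left]
      exact hX ν hν _
    · simpa using hY (evalAt g₂ Z2)
  | J0 =>
    obtain ⟨g₁, g₂, hF⟩ := h
    refine hasLinearPart_of_eq hF (C := Z2 * evalAt g₁ Z2) (by ring) ?_ ?_
    · rw [c0, sub_zero]
      exact Ideal.mul_mem_right _ _ (X_mem_filt 1)
    · simpa using hY (evalAt g₂ Z2)

/-- The type of the normal forms with exceptional rational eigenvalue `r`. -/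
def starTypeOfRat (r : ℚ) : NormalFormType :=
  if r < 0 then .starNeg r.num.natAbs r.den
  else if r = 0 then .starZero
  else if r = 1 then .starOne
  else if r.num = 1 then .starInv r.den
  else .starPos r.num.natAbs r.den

/-- The exceptional families with diagonal linear part are recorded as one function of the rational
eigenvalue. Coprimality of `p` and `q` is what lets them be recovered from it, so equality of labels
reduces to equality of eigenvalues. -/
theorem IsNormalForm.type_cases {ν : ℕ} (hν : 1 ≤ ν) {T : NormalFormType} {t : PowerSeries ℂ}
    {F : FormalMap} (h : IsNormalForm ν T t F) :
    T = .J1 ∨ T = .star2 ∨ T = .J0 ∨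
      (∃ l, l ∉ exceptionalSet ν ∧ T = .starGeneric l) ∨
      ∃ r : ℚ, (r : ℂ) ∈ exceptionalSet ν ∧ T.linearPart = ((r : ℂ), 0, 1) ∧
        T = starTypeOfRat r := by
  cases T with
  | starGeneric lam => exact Or.inr (Or.inr (Or.inr (Or.inl ⟨lam, h.1, rfl⟩)))
  | starZero =>
    refine Or.inr (Or.inr (Or.inr (Or.inr ⟨0, Or.inl (Or.inr ?_), ?_, ?_⟩)))
    · simp
    · simp [NormalFormType.linearPart]
    · simp [starTypeOfRat]
  | starNeg p q =>
    obtain ⟨hp, hq, hpq, _⟩ := h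
    have hp' : (0 : ℚ) < p := by exact_mod_cast hp
    have hq' : (0 : ℚ) < q := by exact_mod_cast hq
    have hr : ((-p : ℤ) : ℚ) / ((q : ℤ) : ℚ) < 0 := by
      push_cast
      exact div_neg_of_neg_of_pos (by linarith) hq'
    have hc : Nat.Coprime (-p : ℤ).natAbs (q : ℤ).natAbs := by simpa using hpq
    have hnum := Rat.num_div_eq_of_coprime (a := -p) (b := q) (by exact_mod_cast hq) hc
    have hden := Rat.den_div_eq_of_coprime (a := -p) (b := q) (by exact_mod_cast hq) hc
    refine Or.inr (Or.inr (Or.inr (Or.inr ⟨((-p : ℤ) : ℚ) / ((q : ℤ) : ℚ), Or.inr ⟨_, hr, rfl⟩,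
      ?_, ?_⟩)))
    · simp [NormalFormType.linearPart, neg_div]
    · rw [starTypeOfRat, if_pos hr, hnum]
      have : (((-p : ℤ) : ℚ) / ((q : ℤ) : ℚ)).den = q := by exact_mod_cast hden
      rw [this, Int.natAbs_neg, Int.natAbs_natCast]
  | starInv q =>
    obtain ⟨hq, _⟩ := h
    have hc : Nat.Coprime (1 : ℤ).natAbs (q : ℤ).natAbs := by simp
    have hq' : (2 : ℚ) ≤ q := by exact_mod_cast hq
    have hnum := Rat.num_div_eq_of_coprime (a := 1) (b := q) (by exact_mod_cast (by omega)) hc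
    have hden := Rat.den_div_eq_of_coprime (a := 1) (b := q) (by exact_mod_cast (by omega)) hc
    have hden' : (((1 : ℤ) : ℚ) / ((q : ℤ) : ℚ)).den = q := by exact_mod_cast hden
    refine Or.inr (Or.inr (Or.inr (Or.inr ⟨((1 : ℤ) : ℚ) / ((q : ℤ) : ℚ),
      Or.inl (Or.inl (Or.inr ⟨q, hq, ?_⟩)), ?_, ?_⟩)))
    · simp
    · simp [NormalFormType.linearPart]
    · rw [starTypeOfRat, if_neg, if_neg, if_neg, if_pos hnum, hden']
      · intro h1
        rw [h1] at hden'
        simp at hden'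
        omega
      · intro h0
        rw [h0] at hnum
        simp at hnum
      · rw [← Rat.num_neg, hnum]
        omega
  | starPos p q =>
    obtain ⟨hq, hqν, hp, hpq, _⟩ := h
    have hc : Nat.Coprime (p : ℤ).natAbs (q : ℤ).natAbs := by simpa using hpq
    have hnum := Rat.num_div_eq_of_coprime (a := p) (b := q) (by exact_mod_cast hq) hc
    have hden := Rat.den_div_eq_of_coprime (a := p) (b := q) (by exact_mod_cast hq) hc
    have hden' : (((p : ℤ) : ℚ) / ((q : ℤ) : ℚ)).den = q := by exact_mod_cast hden
    refine Or.inr (Or.inr (Or.inr (Or.inr ⟨((p : ℤ) : ℚ) / ((q : ℤ) : ℚ),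
      Or.inl (Or.inl (Or.inl ⟨q, p, hq, hqν, ?_⟩)), ?_, ?_⟩)))
    · simp
    · simp [NormalFormType.linearPart]
    · rw [starTypeOfRat, if_neg, if_neg, if_neg, if_neg, hnum, hden', Int.natAbs_natCast]
      · rw [hnum]
        omega
      · intro h1
        rw [h1] at hnum
        simp at hnum
        omega
      · intro h0
        rw [h0] at hnum
        simp at hnum
        omega
      · rw [← Rat.num_neg, hnum]
        omega
  | starOne =>
    refine Or.inr (Or.inr (Or.inr (Or.inr ⟨1, Or.inl (Or.inl (Or.inl ⟨1, 1, le_rfl, hν, ?_⟩)),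
      ?_, ?_⟩)))
    · simp
    · simp [NormalFormType.linearPart]
    · simp [starTypeOfRat]
  | J1 => exact Or.inl rfl
  | star2 => exact Or.inr (Or.inl rfl)
  | J0 => exact Or.inr (Or.inr (Or.inl rfl))

/-- The type of a normal form is determined by its linear part, up to conjugacy and scaling. -/
theorem IsNormalForm.type_unique {ν : ℕ} (hν : 1 ≤ ν) {T T' : NormalFormType}
    {t t' : PowerSeries ℂ} {F F' : FormalMap} (h : IsNormalForm ν T t F)
    (h' : IsNormalForm ν T' t' F') {α β γ : ℂ}
    (hT : ∃ a c d : ℂ, a ≠ 0 ∧ d ≠ 0 ∧ T.linearPart.1 = a ^ ν * α ∧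
      T.linearPart.2.2 = a ^ ν * γ ∧
      c * T.linearPart.1 + d * T.linearPart.2.1 = a ^ ν * (β * a + γ * c))
    (hT' : ∃ a c d : ℂ, a ≠ 0 ∧ d ≠ 0 ∧ T'.linearPart.1 = a ^ ν * α ∧
      T'.linearPart.2.2 = a ^ ν * γ ∧
      c * T'.linearPart.1 + d * T'.linearPart.2.1 = a ^ ν * (β * a + γ * c)) : T = T' := by
  obtain ⟨a, c, d, ha, hd, hl, hm, hn⟩ := hT
  obtain ⟨a', c', d', ha', hd', hl', hm', hn'⟩ := hT'
  have hs : a ^ ν ≠ 0 := pow_ne_zero ν ha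
  have hs' : a' ^ ν ≠ 0 := pow_ne_zero ν ha'
  have hcross : T.linearPart.1 * T'.linearPart.2.2 = T'.linearPart.1 * T.linearPart.2.2 := by
    rw [hl, hm, hl', hm']
    ring
  have hm0 : T.linearPart.2.2 = 0 ↔ T'.linearPart.2.2 = 0 := by
    rw [hm, hm', mul_eq_zero, mul_eq_zero, or_iff_right hs, or_iff_right hs']
  have hl0 : T.linearPart.1 = 0 ↔ T'.linearPart.1 = 0 := by
    rw [hl, hl', mul_eq_zero, mul_eq_zero, or_iff_right hs, or_iff_right hs']
  -- When the eigenvalues agree, `c` drops out of the third relation and leaves `d n = a^(ν+1) β`;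
  -- so `n` vanishes exactly when `β` does.
  have hn0 : T.linearPart.1 = T.linearPart.2.2 → T'.linearPart.1 = T'.linearPart.2.2 →
      (T.linearPart.2.1 = 0 ↔ T'.linearPart.2.1 = 0) := by
    intro e e'
    have f : d * T.linearPart.2.1 = a ^ ν * a * β := by
      rw [e, hm] at hn
      linear_combination hn
    have f' : d' * T'.linearPart.2.1 = a' ^ ν * a' * β := by
      rw [e', hm'] at hn'
      linear_combination hn'
    constructor
    · intro h0
      rw [h0, mul_zero] at f
      have hβ : β = 0 := (mul_eq_zero.mp f.symm).resolve_left (mul_ne_zero hs ha)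
      rw [hβ, mul_zero] at f'
      exact (mul_eq_zero.mp f').resolve_left hd'
    · intro h0
      rw [h0, mul_zero] at f'
      have hβ : β = 0 := (mul_eq_zero.mp f'.symm).resolve_left (mul_ne_zero hs' ha')
      rw [hβ, mul_zero] at f
      exact (mul_eq_zero.mp f).resolve_left hd
  clear hl hm hn hl' hm' hn'
  have key : ∀ {T : NormalFormType} {t : PowerSeries ℂ} {F : FormalMap}, IsNormalForm ν T t F →
      T = .J1 ∨ T = .star2 ∨ T = .J0 ∨ ∃ l, T.linearPart = (l, 0, 1) ∧
        ((l ∉ exceptionalSet ν ∧ T = .starGeneric l) ∨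
          ∃ r : ℚ, l = r ∧ l ∈ exceptionalSet ν ∧ T = starTypeOfRat r) := by
    intro T t F h
    rcases h.type_cases hν with h | h | h | ⟨l, hl, h⟩ | ⟨r, hrE, hr, hrT⟩
    · exact Or.inl h
    · exact Or.inr (Or.inl h)
    · exact Or.inr (Or.inr (Or.inl h))
    · exact Or.inr (Or.inr (Or.inr ⟨l, by rw [h]; rfl, Or.inl ⟨hl, h⟩⟩))
    · exact Or.inr (Or.inr (Or.inr ⟨r, hr, Or.inr ⟨r, rfl, hrE, hrT⟩⟩))
  rcases key h with rfl | rfl | rfl | ⟨l, hL, hl⟩ <;>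
  rcases key h' with rfl | rfl | rfl | ⟨l', hL', hl'⟩
  -- Both linear parts are diagonal with second eigenvalue `1`, so the scaling drops out and the
  -- first eigenvalues are equal. Membership in the exceptional set then separates the generic
  -- family from the rational ones.
  case inr.inr.inr.inr.inr.inr =>
    rw [hL, hL'] at hcross
    have e : l = l' := by simpa using hcross
    subst e
    rcases hl with ⟨h1, h2⟩ | ⟨r, h1, h2, h3⟩ <;> rcases hl' with ⟨h1', h2'⟩ | ⟨r', h1', h2', h3'⟩
    · rw [h2, h2']
    · exact absurd h2' h1
    · exact absurd h2 h1'
    · rw [h3, h3', Rat.cast_injective (h1.symm.trans h1')]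
  -- The mixed pairs are told apart by whether the eigenvalues vanish. The exception is `J1` against
  -- a diagonal type, where `hcross` forces the eigenvalue `1` and the off-diagonal entry decides.
  all_goals first
    | rfl
    | simp_all [NormalFormType.linearPart]

/-! ### Expansions of germs -/

/-- `φ` is the power series expansion at the origin of the scalar germ `g`. -/
def Expands (g : (Fin 2 → ℂ) → ℂ) (φ : MvPowerSeries (Fin 2) ℂ) : Prop :=
  ∀ᶠ z in 𝓝 (0 : Fin 2 → ℂ),
    HasSum (fun m : Fin 2 →₀ ℕ => MvPowerSeries.coeff m φ * (z 0 ^ m 0 * z 1 ^ m 1)) (g z)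

theorem hasSum_iff_of_forall_eq {ι : Type*} {f g : ι → ℂ} {a : ℂ} (h : ∀ i, f i = g i) :
    HasSum f a ↔ HasSum g a := by
  rw [funext h]

/-! ### From multilinear series to double power series. -/

section Multilinear

variable {p : FormalMultilinearSeries ℂ (Fin 2 → ℂ) ℂ}

/-- The value of the `n`-th term of a power series on a choice of basis vectors. -/
noncomputable def basisValue (p : FormalMultilinearSeries ℂ (Fin 2 → ℂ) ℂ) (x : Σ n, Finset (Fin n)) : ℂ :=
  p x.1 (x.2.piecewise (fun _ => Pi.single 0 1) fun _ => Pi.single 1 1)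

/-- The exponents of `z₁` and `z₂` belonging to a choice of basis vectors. -/
noncomputable def basisExpo (x : Σ n, Finset (Fin n)) : Fin 2 →₀ ℕ :=
  expo x.2.card (x.1 - x.2.card)

/-- Expanding `z = z₁e₁ + z₂e₂` in each slot gives one term for each subset of slots, namely those
receiving `e₁`. -/
theorem apply_eq_sum_basisValue (z : Fin 2 → ℂ) (n : ℕ) :
    p n (fun _ => z) = ∑ s : Finset (Fin n),
      basisValue p ⟨n, s⟩ * (z 0 ^ basisExpo ⟨n, s⟩ 0 * z 1 ^ basisExpo ⟨n, s⟩ 1) := by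
  have hz : (fun _ : Fin n => z) = (fun _ => z 0 • (Pi.single 0 1 : Fin 2 → ℂ)) +
      fun _ => z 1 • (Pi.single 1 1 : Fin 2 → ℂ) := by
    funext _ i
    fin_cases i <;> simp
  rw [hz, ContinuousMultilinearMap.map_add_univ]
  refine Finset.sum_congr rfl fun s _ => ?_
  have hs : (s.piecewise (fun _ => z 0 • (Pi.single 0 1 : Fin 2 → ℂ))
      fun _ => z 1 • (Pi.single 1 1 : Fin 2 → ℂ)) =
      fun i => (s.piecewise (fun _ => z 0) (fun _ => z 1) i) •
        (s.piecewise (fun _ => (Pi.single 0 1 : Fin 2 → ℂ)) (fun _ => Pi.single 1 1) i) := by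
    funext i
    by_cases hi : i ∈ s <;> simp [hi]
  rw [hs, ContinuousMultilinearMap.map_smul_univ, smul_eq_mul, mul_comm, basisValue, basisExpo,
    expo_zero, expo_one, Finset.prod_piecewise]
  simp [← Finset.compl_eq_univ_sdiff, Finset.card_compl]

theorem norm_basisValue_le {C r : ℝ} (hp : ∀ n, ‖p n‖ ≤ C * r ^ n) (x : Σ n, Finset (Fin n)) :
    ‖basisValue p x‖ ≤ C * r ^ x.1 := by
  refine (ContinuousMultilinearMap.le_opNorm _ _).trans ?_
  rw [Finset.prod_eq_one, mul_one]
  · exact hp x.1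
  · intro i _
    by_cases hi : i ∈ x.2 <;> simp [hi, Pi.norm_single]

theorem finite_basisExpo_fiber (m : Fin 2 →₀ ℕ) : Finite {x // basisExpo x = m} := by
  refine Set.Finite.subset (s := Set.range fun s : Finset (Fin (m 0 + m 1)) =>
    (⟨m 0 + m 1, s⟩ : Σ n, Finset (Fin n))) (Set.finite_range _) ?_
  rintro ⟨n, s⟩ h
  have h : expo s.card (n - s.card) = m := h
  have hs : s.card ≤ n := by simpa using s.card_le_univ
  have : n = m 0 + m 1 := by
    rw [← h, expo_zero, expo_one]
    omega
  subst this
  exact ⟨s, rfl⟩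

/-- The `n`-th term splits into `2^n` pieces, so absolute convergence is compared with a geometric
series of ratio `2r‖z‖`; hence the halved radius. -/
theorem summable_basisValue {C r : ℝ} (hC : 0 < C) (hr : 0 < r) (hp : ∀ n, ‖p n‖ ≤ C * r ^ n)
    {z : Fin 2 → ℂ} (hz : ‖z‖ < 1 / (2 * r)) :
    Summable fun x : Σ n, Finset (Fin n) =>
      basisValue p x * (z 0 ^ basisExpo x 0 * z 1 ^ basisExpo x 1) := by
  have hb : ∀ x : Σ n, Finset (Fin n),
      ‖basisValue p x * (z 0 ^ basisExpo x 0 * z 1 ^ basisExpo x 1)‖ ≤ C * (r * ‖z‖) ^ x.1 := by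
    rintro ⟨n, s⟩
    have hs : s.card ≤ n := by simpa using s.card_le_univ
    rw [norm_mul, norm_mul, norm_pow, norm_pow, mul_pow, ← mul_assoc C]
    refine mul_le_mul (norm_basisValue_le hp _) ?_ (by positivity) (by positivity)
    calc ‖z 0‖ ^ basisExpo ⟨n, s⟩ 0 * ‖z 1‖ ^ basisExpo ⟨n, s⟩ 1
        ≤ ‖z‖ ^ basisExpo ⟨n, s⟩ 0 * ‖z‖ ^ basisExpo ⟨n, s⟩ 1 := by
          gcongr <;> exact norm_le_pi_norm z _
      _ = ‖z‖ ^ n := by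
          rw [← pow_add, basisExpo, expo_zero, expo_one, Nat.add_sub_cancel' hs]
  refine Summable.of_norm_bounded (g := fun x => C * (r * ‖z‖) ^ x.1) ?_ hb
  rw [summable_sigma_of_nonneg fun x => by positivity]
  refine ⟨fun n => Summable.of_finite, ?_⟩
  have : ∀ n : ℕ, ∑' _ : Finset (Fin n), C * (r * ‖z‖) ^ n = C * (2 * r * ‖z‖) ^ n := by
    intro n
    rw [tsum_fintype]
    simp [mul_pow]
    ring
  simp only [this]
  refine (summable_geometric_of_lt_one (by positivity) ?_).mul_left C
  rwa [lt_div_iff₀ (by positivity), mul_comm] at hz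

end Multilinear

/-- The coefficient of a monomial collects the finitely many choices of basis vectors having that
exponent. Absolute summability allows the regrouping from degrees to exponents. -/
theorem exists_expands {g : (Fin 2 → ℂ) → ℂ} (hg : AnalyticAt ℂ g 0) : ∃ φ, Expands g φ := by
  obtain ⟨p, R, hp⟩ := hg
  obtain ⟨C, r, hC, hr, hb⟩ := p.le_mul_pow_of_radius_pos (hp.r_pos.trans_le hp.r_le)
  refine ⟨fun m => ∑' x : {x // basisExpo x = m}, basisValue p x, ?_⟩
  have h1 : ∀ᶠ z in 𝓝 (0 : Fin 2 → ℂ), ‖z‖ < 1 / (2 * r) := by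
    have := Metric.ball_mem_nhds (0 : Fin 2 → ℂ) (ε := 1 / (2 * r)) (by positivity)
    filter_upwards [this] with z hz
    simpa using hz
  filter_upwards [h1, Metric.eball_mem_nhds 0 hp.r_pos] with z hz hzR
  have hsum := hp.hasSum hzR
  rw [zero_add] at hsum
  have hall : HasSum (fun x : Σ n, Finset (Fin n) =>
      basisValue p x * (z 0 ^ basisExpo x 0 * z 1 ^ basisExpo x 1)) (g z) := by
    refine HasSum.sigma_of_hasSum hsum (fun n => ?_) (summable_basisValue hC hr hb hz)
    rw [apply_eq_sum_basisValue]
    exact hasSum_fintype _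
  rw [← (Equiv.sigmaFiberEquiv basisExpo).hasSum_iff] at hall
  refine hall.sigma fun m => ?_
  have := finite_basisExpo_fiber m
  have hw : HasSum (fun x : {x // basisExpo x = m} => basisValue p x)
      (∑' x : {x // basisExpo x = m}, basisValue p x) := Summable.of_finite.hasSum
  refine (hasSum_iff_of_forall_eq fun x => ?_).mpr (hw.mul_right (z 0 ^ m 0 * z 1 ^ m 1))
  simp [Equiv.sigmaFiberEquiv, x.2]

theorem hasFPowerSeriesAt_of_hasSum {c : ℕ → ℂ} {g : ℂ → ℂ}
    (h : ∀ᶠ x in 𝓝 (0 : ℂ), HasSum (fun n => c n * x ^ n) (g x)) :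
    HasFPowerSeriesAt g (FormalMultilinearSeries.ofScalars ℂ c) 0 := by
  rw [hasFPowerSeriesAt_iff]
  filter_upwards [h] with x hx
  simpa [mul_comm] using hx

theorem eq_zero_of_hasSum_zero {c : ℕ → ℂ}
    (h : ∀ᶠ x in 𝓝 (0 : ℂ), HasSum (fun n => c n * x ^ n) 0) (n : ℕ) : c n = 0 := by
  have h0 := (hasFPowerSeriesAt_of_hasSum (g := 0) h).eq_zero
  have := congrArg (fun p => FormalMultilinearSeries.coeff p n) h0
  rwa [FormalMultilinearSeries.coeff_ofScalars] at this

/-- Pairs of natural numbers as exponents. -/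
noncomputable def expoEquiv : ℕ × ℕ ≃ (Fin 2 →₀ ℕ) where
  toFun x := expo x.1 x.2
  invFun m := (m 0, m 1)
  left_inv x := by simp [expo_zero, expo_one]
  right_inv m := (eq_expo m).symm

/-- The one-variable identity theorem is used twice: for fixed `x` the series in `y` vanishes, so
each of its coefficients does, and each coefficient is a series in `x` to which the same applies. -/
theorem Expands.eq_zero {φ : MvPowerSeries (Fin 2) ℂ} (h : Expands 0 φ) : φ = 0 := by
  obtain ⟨ε, hε, hb⟩ := Metric.eventually_nhds_iff_ball.mp h
  have hsum : ∀ x y : ℂ, ‖x‖ < ε → ‖y‖ < ε → HasSum (fun m : ℕ × ℕ =>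
      MvPowerSeries.coeff (expo m.2 m.1) φ * x ^ m.2 * y ^ m.1) 0 := by
    intro x y hx hy
    have := hb ![x, y] (by
      rw [mem_ball_zero_iff, pi_norm_lt_iff hε]
      intro i
      fin_cases i <;> simpa)
    rw [← ((Equiv.prodComm ℕ ℕ).trans expoEquiv).hasSum_iff] at this
    refine (hasSum_iff_of_forall_eq fun m => ?_).mp this
    simp [expoEquiv, expo_zero, expo_one, mul_assoc]
  have hball : ∀ᶠ x in 𝓝 (0 : ℂ), ‖x‖ < ε := by
    filter_upwards [Metric.ball_mem_nhds (0 : ℂ) hε] with x hx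
    simpa using hx
  -- A nonzero second coordinate, used to get convergence of each series in `x`: a row of the
  -- summable double family is divided by `y₀^k`.
  obtain ⟨y₀, hy₀, hy₀ε⟩ : ∃ y : ℂ, y ≠ 0 ∧ ‖y‖ < ε :=
    ⟨(ε / 2 : ℝ), by simpa using hε.ne', by
      rw [Complex.norm_real, Real.norm_of_nonneg (by linarith)]
      linarith⟩
  have hinner : ∀ x : ℂ, ‖x‖ < ε → ∀ k,
      HasSum (fun n => MvPowerSeries.coeff (expo n k) φ * x ^ n) 0 := by
    intro x hx
    have hs : ∀ k, Summable fun n => MvPowerSeries.coeff (expo n k) φ * x ^ n := by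
      intro k
      have := (hsum x y₀ hx hy₀ε).summable.prod_factor k
      simpa [hy₀] using this.mul_right ((y₀ ^ k)⁻¹)
    have h0 : ∀ k, ∑' n, MvPowerSeries.coeff (expo n k) φ * x ^ n = 0 := by
      refine eq_zero_of_hasSum_zero ?_
      filter_upwards [hball] with y hy
      exact (hsum x y hx hy).prod_fiberwise fun k => (hs k).hasSum.mul_right (y ^ k)
    intro k
    rw [← h0 k]
    exact (hs k).hasSum
  ext m
  rw [(MvPowerSeries.coeff m).map_zero, eq_expo m]
  refine eq_zero_of_hasSum_zero (c := fun n => MvPowerSeries.coeff (expo n (m 1)) φ) ?_ (m 0)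
  filter_upwards [hball] with x hx
  exact hinner x hx (m 1)

theorem Expands.unique {g : (Fin 2 → ℂ) → ℂ} {φ ψ : MvPowerSeries (Fin 2) ℂ}
    (hφ : Expands g φ) (hψ : Expands g ψ) : φ = ψ := by
  refine sub_eq_zero.mp (Expands.eq_zero ?_)
  filter_upwards [hφ, hψ] with z h1 h2
  simpa [sub_mul] using h1.sub h2

theorem Expands.add {g h : (Fin 2 → ℂ) → ℂ} {φ ψ : MvPowerSeries (Fin 2) ℂ}
    (hφ : Expands g φ) (hψ : Expands h ψ) : Expands (g + h) (φ + ψ) := by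
  filter_upwards [hφ, hψ] with z h1 h2
  simpa [add_mul] using h1.add h2

theorem expands_X (i : Fin 2) : Expands (fun z => z i) (MvPowerSeries.X i) := by
  refine Eventually.of_forall fun z => ?_
  convert hasSum_single (Finsupp.single i 1) ?_ using 1
  · fin_cases i <;> simp [MvPowerSeries.coeff_X]
  · intro m hm
    simp [MvPowerSeries.coeff_X, hm]

theorem Expands.X_zero_pow_mul {g : (Fin 2 → ℂ) → ℂ} {φ : MvPowerSeries (Fin 2) ℂ}
    (h : Expands g φ) (k : ℕ) :
    Expands (fun z => z 0 ^ k * g z) (MvPowerSeries.X 0 ^ k * φ) := by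
  filter_upwards [h] with z hz
  have hinj : Function.Injective fun m : Fin 2 →₀ ℕ => Finsupp.single 0 k + m :=
    add_right_injective _
  rw [← hinj.hasSum_iff]
  · refine (hasSum_iff_of_forall_eq fun m => ?_).mp (hz.mul_left (z 0 ^ k))
    simp only [Function.comp_apply, MvPowerSeries.X_pow_eq, MvPowerSeries.coeff_add_monomial_mul]
    simp [pow_add]
    ring
  · intro m hm
    have hm0 : m 0 < k := by
      by_contra hk
      refine hm ⟨m - Finsupp.single 0 k, add_tsub_cancel_of_le ?_⟩
      intro i
      fin_cases i
      · simpa using hk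
      · simp
    rw [MvPowerSeries.X_pow_dvd_iff.mp (dvd_mul_right _ φ) m hm0, zero_mul]

theorem isExpansion_contactMap {f fo : (Fin 2 → ℂ) → (Fin 2 → ℂ)} {ν : ℕ} {G : FormalMap}
    (hf : ∀ᶠ z in 𝓝 (0 : Fin 2 → ℂ), f z = z + z 0 ^ ν • fo z) (hG : IsExpansion fo G) :
    IsExpansion f (contactMap ν G) := by
  intro i
  filter_upwards [hf, (expands_X i).add (Expands.X_zero_pow_mul (hG i) ν)] with z hz h
  rw [hz]
  exact h

theorem Expands.constantCoeff_eq {g : (Fin 2 → ℂ) → ℂ} {φ : MvPowerSeries (Fin 2) ℂ}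
    (h : Expands g φ) : MvPowerSeries.constantCoeff φ = g 0 := by
  have h0 := h.self_of_nhds
  refine (hasSum_single 0 ?_).unique h0 |>.symm ▸ ?_
  · intro m hm
    have : m 0 ≠ 0 ∨ m 1 ≠ 0 := by
      by_contra! hc
      refine hm ?_
      ext i
      fin_cases i
      · exact hc.1
      · exact hc.2
    rcases this with h | h <;> simp [h]
  · simp

theorem tendsto_single (i : Fin 2) :
    Tendsto (fun x : ℂ => (Pi.single i x : Fin 2 → ℂ)) (𝓝 0) (𝓝 0) := by
  have : Continuous fun x : ℂ => (Pi.single i x : Fin 2 → ℂ) :=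
    continuous_single (A := fun _ : Fin 2 => ℂ) i
  simpa using this.tendsto 0

theorem Expands.hasSum_fst {g : (Fin 2 → ℂ) → ℂ} {φ : MvPowerSeries (Fin 2) ℂ}
    (h : Expands g φ) : ∀ᶠ x in 𝓝 (0 : ℂ),
      HasSum (fun n => MvPowerSeries.coeff (expo n 0) φ * x ^ n) (g (Pi.single 0 x)) := by
  filter_upwards [(tendsto_single 0).eventually h] with x hx
  have hinj : Function.Injective fun n => expo n 0 := fun a b hab => by
    simpa [expo_zero] using DFunLike.congr_fun hab 0
  rw [← hinj.hasSum_iff] at hx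
  · refine (hasSum_iff_of_forall_eq fun n => ?_).mp hx
    simp [expo_zero, expo_one]
  · intro m hm
    have : m 1 ≠ 0 := fun h0 => hm ⟨m 0, by rw [← h0]; exact (eq_expo m).symm⟩
    simp [this]

theorem Expands.hasSum_snd {g : (Fin 2 → ℂ) → ℂ} {φ : MvPowerSeries (Fin 2) ℂ}
    (h : Expands g φ) : ∀ᶠ x in 𝓝 (0 : ℂ),
      HasSum (fun n => MvPowerSeries.coeff (expo 0 n) φ * x ^ n) (g (Pi.single 1 x)) := by
  filter_upwards [(tendsto_single 1).eventually h] with x hx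
  have hinj : Function.Injective fun n => expo 0 n := fun a b hab => by
    simpa [expo_one] using DFunLike.congr_fun hab 1
  rw [← hinj.hasSum_iff] at hx
  · refine (hasSum_iff_of_forall_eq fun n => ?_).mp hx
    simp [expo_zero, expo_one]
  · intro m hm
    have : m 0 ≠ 0 := fun h0 => hm ⟨m 1, by rw [← h0]; exact (eq_expo m).symm⟩
    simp [this]

/-- Restriction to a coordinate axis turns the partial derivative into that of a one-variable power
series. -/
theorem fderiv_single_eq_of_hasSum {g : (Fin 2 → ℂ) → ℂ} (hg : DifferentiableAt ℂ g 0) {i : Fin 2}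
    {c : ℕ → ℂ} (h : ∀ᶠ x in 𝓝 (0 : ℂ), HasSum (fun n => c n * x ^ n) (g (Pi.single i x))) :
    fderiv ℂ g 0 (Pi.single i 1) = c 1 := by
  have h1 := (hasFPowerSeriesAt_of_hasSum h).hasDerivAt
  have hL : HasDerivAt (fun x : ℂ => (Pi.single i x : Fin 2 → ℂ)) (Pi.single i 1) 0 := by
    rw [hasDerivAt_pi]
    intro j
    by_cases hj : j = i
    · subst hj
      simp only [Pi.single_eq_same]
      exact hasDerivAt_id' (0 : ℂ)
    · simpa [hj] using hasDerivAt_const (0 : ℂ) (0 : ℂ)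
  have hg' : HasFDerivAt g (fderiv ℂ g 0) (Pi.single i (0 : ℂ)) := by
    simpa using hg.hasFDerivAt
  have h2 := hg'.comp_hasDerivAt (0 : ℂ) hL
  have := h2.unique h1
  simpa using this

/-- On the line only the coefficients without `z₁` are seen, and by one-variable uniqueness they all
vanish when the restriction does. -/
theorem isTangential_iff_X_dvd {fo : (Fin 2 → ℂ) → (Fin 2 → ℂ)} {G : FormalMap}
    (hG : IsExpansion fo G) : IsTangential fo ↔ Z1 ∣ G 0 := by
  rw [MvPowerSeries.X_dvd_iff]
  constructor
  · intro h m hm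
    rw [eq_expo m, hm]
    refine eq_zero_of_hasSum_zero (c := fun n => MvPowerSeries.coeff (expo 0 n) (G 0)) ?_ (m 1)
    filter_upwards [(tendsto_single 1).eventually h, Expands.hasSum_snd (hG 0)] with x h1 h2
    rwa [h1 (by simp)] at h2
  · intro h
    filter_upwards [hG 0] with z hz hz0
    refine hz.unique ?_
    convert hasSum_zero using 1
    funext m
    by_cases hm : m 0 = 0
    · rw [h m hm, zero_mul]
    · simp [hz0, hm]

theorem linPart_single_apply {fo : (Fin 2 → ℂ) → (Fin 2 → ℂ)} {G : FormalMap}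
    (hfo : DifferentiableAt ℂ fo 0) (hG : IsExpansion fo G) (i : Fin 2) :
    linPart fo (Pi.single 0 1) i = MvPowerSeries.coeff (expo 1 0) (G i) ∧
      linPart fo (Pi.single 1 1) i = MvPowerSeries.coeff (expo 0 1) (G i) := by
  have hd := hasFDerivAt_pi'.mp hfo.hasFDerivAt i
  have h0 := fderiv_single_eq_of_hasSum hd.differentiableAt (Expands.hasSum_fst (hG i))
  have h1 := fderiv_single_eq_of_hasSum hd.differentiableAt (Expands.hasSum_snd (hG i))
  rw [hd.fderiv] at h0 h1
  exact ⟨h0, h1⟩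

/-- The expansion of `fo` has a nonzero lower triangular linear part. -/
theorem exists_linear_part {fo : (Fin 2 → ℂ) → (Fin 2 → ℂ)} {G : FormalMap}
    (hfo : DifferentiableAt ℂ fo 0) (hG : IsExpansion fo G) (hsing : fo 0 = 0)
    (hpure : linPart fo ≠ 0) (hline : ∀ z : Fin 2 → ℂ, z 0 = 0 → linPart fo z 0 = 0) :
    ∃ α β γ : ℂ, (α ≠ 0 ∨ β ≠ 0 ∨ γ ≠ 0) ∧
      ∀ i, G i - (polyAct !![α, 0; β, γ] MvPolynomial.X i : MvPowerSeries (Fin 2) ℂ)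
        ∈ filt 0 2 := by
  have hc := linPart_single_apply hfo hG
  have h0 : MvPowerSeries.coeff (expo 0 1) (G 0) = 0 := by
    rw [← (hc 0).2]
    exact hline _ (by simp)
  refine ⟨MvPowerSeries.coeff (expo 1 0) (G 0), MvPowerSeries.coeff (expo 1 0) (G 1),
    MvPowerSeries.coeff (expo 0 1) (G 1), ?_, fun i => ?_⟩
  · by_contra! h
    refine hpure ?_
    ext z i
    have hz : z = z 0 • (Pi.single 0 1 : Fin 2 → ℂ) + z 1 • (Pi.single 1 1 : Fin 2 → ℂ) := by
      funext j
      fin_cases j <;> simp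
    rw [hz, map_add, map_smul, map_smul, Pi.add_apply, Pi.smul_apply, Pi.smul_apply, (hc i).1,
      (hc i).2]
    fin_cases i
    · simp [h.1, h0]
    · simp [h.2.1, h.2.2]
  · have := sub_linear_mem_filt (φ := G i) (by
      rw [Expands.constantCoeff_eq (hG i), hsing, Pi.zero_apply])
    rw [coe_polyAct_X]
    fin_cases i
    · simpa [h0] using this
    · simpa using this

theorem theorem2p1 (f fo : (Fin 2 → ℂ) → (Fin 2 → ℂ)) (ν : ℕ)
    (hf : IsTangentToIdGerm f) (hfix : FixesLine f)
    (hν : 1 ≤ ν) (hcontact : HasOrderOfContact f ν fo)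
    (hsing : fo 0 = 0) (hpure : linPart fo ≠ 0)
    (hH4 : ∀ z : Fin 2 → ℂ, z 0 = 0 → linPart fo z 0 = 0) :
    (∃! T : NormalFormType, ∃ (t : PowerSeries ℂ) (Fhat : FormalMap),
      IsNormalForm ν T t Fhat ∧ IsFormallyConjugate f Fhat) ∧
    (∀ (T : NormalFormType) (t : PowerSeries ℂ) (Fhat : FormalMap),
      IsNormalForm ν T t Fhat → IsFormallyConjugate f Fhat → (t = 0 ↔ IsTangential fo)) := by
  have hcomp : ∀ i, AnalyticAt ℂ (fun z => fo z i) 0 := analyticAt_pi_iff.mp hcontact.analytic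
  choose G hG using fun i => exists_expands (hcomp i)
  have hG : IsExpansion fo G := hG
  have hF := isExpansion_contactMap hcontact.eq hG
  obtain ⟨α, β, γ, hne, hlin⟩ :=
    exists_linear_part hcontact.analytic.differentiableAt hG hsing hpure hH4
  have hinv : ∀ (T : NormalFormType) (t : PowerSeries ℂ) (Fhat : FormalMap),
      IsNormalForm ν T t Fhat → IsFormallyConjugate f Fhat →
      (t = 0 ↔ IsTangential fo) ∧ ∃ a c d : ℂ, a ≠ 0 ∧ d ≠ 0 ∧
        T.linearPart.1 = a ^ ν * α ∧ T.linearPart.2.2 = a ^ ν * γ ∧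
        c * T.linearPart.1 + d * T.linearPart.2.1 = a ^ ν * (β * a + γ * c) := by
    rintro T t Fhat hT ⟨F, hFf, χ, hχ, hconj⟩
    -- Formal conjugacy is stated for some expansion of `f`; uniqueness of expansions identifies it
    -- with the one built from `G`.
    obtain rfl : F = contactMap ν G := funext fun i => Expands.unique (hFf i) (hF i)
    obtain ⟨H, rfl, hH, hdvd⟩ := hT.hasLinearPart hν
    refine ⟨?_, linear_part_of_conjugate hlin hH hχ hconj⟩
    rw [isTangential_iff_X_dvd hG, ← hdvd]
    exact X_dvd_iff_of_conjugate hν (fun i => mem_filt_zero_one_of_sub_polyAct (hH i)) hχ hconj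
  refine ⟨?_, fun T t Fhat hT hconj => (hinv T t Fhat hT hconj).1⟩
  obtain ⟨T, t, Fhat, χ, hT, hχ, hconj⟩ := exists_isNormalForm hν hne hlin
  have hfc : IsFormallyConjugate f Fhat := ⟨_, hF, χ, hχ, hconj⟩
  refine ⟨T, ⟨t, Fhat, hT, hfc⟩, ?_⟩
  rintro T' ⟨t', Fhat', hT', hfc'⟩
  exact hT'.type_unique hν hT (hinv T' t' Fhat' hT' hfc').2 (hinv T t Fhat hT hfc).2
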